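/- Let $S^1$ be the unit circle, let $T^2=S^1\times S^1$ carry the product orientation, and let $\mathrm{pr}\colon T^2\to S^1$ be the projection onto the first factor. Let $n\in\mathbb{Z}$, let $p\colon L_n\to T^2$ be a smooth complex line bundle with first Chern class $c_1(L_n)=n\in H^2(T^2;\mathbb{Z})\cong\mathbb{Z}$, choose a smooth Hermitian metric on $L_n$, and let $r\colon \mathrm{Tot}(L_n)\to\mathbb{R}_{\ge 0}$ be the fibrewise radial distance. The standard $n$-model is the map $$f\colon \mathrm{Tot}(L_n)\to S^1\times\mathbb{R}_{\ge0},\qquad f(x)=(\mathrm{pr}(p(x)),\,r^2(x)).$$ (1) Identify $T^2$ with the zero section. Then $f\colon(\mathrm{Tot}(L_n),T^2)\to(S^1\times\mathbb{R}_{\ge0},S^1\times\{0\})$ is a boundary fibration. Here a smooth map of pairs $f\colon(X,D)\to(Y,Z)$, with $D\subset X$ an embedded submanifold of codimension at least two and $Z\subset Y$ an embedded hypersurface, is called a boundary fibration if (i) $f^{-1}(Z)=D$, and the normal Hessian of $f$ along $D$ is definite, i.e. near each point of $D$, for a local defining function $z$ of $Z$, the function $z\circ f$ is critical along $D$ and its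 Hessian is positive or negative definite on $T_xX/T_xD$; (ii) $f|_D\colon D\to Z$ is a submersion; and (iii) $f|_{X\setminus D}\colon X\setminus D\to Y\setminus Z$ is a smooth locally trivial fibration. (2) For every $\varepsilon>0$, put $\gamma=S^1\times\{\varepsilon\}$, oriented as $S^1=\mathbb{R}/\mathbb{Z}$. Then $f^{-1}(\gamma)\to\gamma$ is a bundle of tori, and its monodromy around $\gamma$ is the $(-n)$-th power of a Dehn twist. Precisely: orient $\mathrm{Tot}(L_n)$ by the orientation of $T^2$ followed by the complex orientation of the fibres of $p$, orient $S^1\times\mathbb{R}_{\ge0}$ as a product, and orient the fibres of $f$ by the rule "base first". There are a diffeomorphism $\varphi$ of $T^2$ and a diffeomorphism, over $\gamma=\mathbb{R}/\mathbb{Z}$ and orientation preserving on fibres, from the mapping torus $(\mathbb{R}\times T^2)/\bigl((t+1,v)\sim(t,\varphi(v))\bigr)$ to $f^{-1}(\gamma)$; and for every such $\varphi$, its class in the mapping class group of $T^2$ equals $[\delta]^{-n}$ for some right-handed Dehn twist $\delta$ of the oriented torus $T^2$ about a nonseparating simple closed curve. -/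

import Mathlib

open Set Function Bundle Manifold
open scoped Manifold ContDiff

noncomputable section

namespace BoundaryFibration

/-! ### Boundary maps and boundary fibrations -/

section General

variable {EX HX X EY HY Y ED HD D EZ HZ Z : Type*}
  [NormedAddCommGroup EX] [NormedSpace ℝ EX] [TopologicalSpace HX]
  [NormedAddCommGroup EY] [NormedSpace ℝ EY] [TopologicalSpace HY]
  [NormedAddCommGroup ED] [NormedSpace ℝ ED] [TopologicalSpace HD]
  [NormedAddCommGroup EZ] [NormedSpace ℝ EZ] [TopologicalSpace HZ]
  [TopologicalSpace X] [ChartedSpace HX X] [TopologicalSpace Y] [ChartedSpace HY Y]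
  [TopologicalSpace D] [ChartedSpace HD D] [TopologicalSpace Z] [ChartedSpace HZ Z]
  (I : ModelWithCorners ℝ EX HX) (J : ModelWithCorners ℝ EY HY)
  (ID : ModelWithCorners ℝ ED HD) (IZ : ModelWithCorners ℝ EZ HZ)

/-- `z` is a local defining function, on the open set `U`, for the hypersurface `S ⊆ Y`. -/
structure IsDefiningFunctionOn (S U : Set Y) (z : Y → ℝ) : Prop where
  isOpen : IsOpen U
  smooth : ContMDiffOn J 𝓘(ℝ, ℝ) ∞ z U
  zero_iff : ∀ y ∈ U, z y = 0 ↔ y ∈ S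
  regular : ∀ y ∈ U ∩ S, mfderiv J 𝓘(ℝ, ℝ) z y ≠ 0

/-- The Hessian of a function `h` at a point `x`, computed in the preferred chart at `x` (through
which the tangent space at `x` is identified with the model space). It is used only at critical
points of `h`, where it does not depend on the chart. -/
def hessian (h : X → ℝ) (x : X) (v w : TangentSpace I x) : ℝ :=
  iteratedFDerivWithin ℝ 2 (h ∘ (extChartAt I x).symm) (range I) (extChartAt I x x)
    ![(v : EX), (w : EX)]

/-- A smooth map of pairs `f : (X, D) → (Y, Z)`, with `D` and `Z` given by smooth embeddings
`i : D → X` and `j : Z → Y`, is a *boundary map* if `Z` is a hypersurface, `D` has codimension at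
least two, `f⁻¹(Z) = D` (a strong map of pairs), and the normal Hessian of `f` is definite along
`D`: for a local defining function `z` of `Z`, the function `z ∘ f` is critical along `D`, and its
Hessian is positive definite, or negative definite, on the normal space `T_x X / T_x D`. (Passing
to another defining function multiplies the normal Hessian by a nonzero number.) -/
structure IsBoundaryMap (f : X → Y) (i : D → X) (j : Z → Y) : Prop where
  smooth : ContMDiff I J ∞ f
  embedding_source : IsSmoothEmbedding ID I ∞ i
  embedding_target : IsSmoothEmbedding IZ J ∞ j
  hypersurface : Module.finrank ℝ EZ + 1 = Module.finrank ℝ EY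
  codim_ge_two : Module.finrank ℝ ED + 2 ≤ Module.finrank ℝ EX
  preimage_eq : f ⁻¹' range j = range i
  normalHessian_definite : ∀ d : D, ∃ (U : Set Y) (z : Y → ℝ),
    f (i d) ∈ U ∧ IsDefiningFunctionOn J (range j) U z ∧
    mfderiv I 𝓘(ℝ, ℝ) (z ∘ f) (i d) = 0 ∧
    ((∀ v : TangentSpace I (i d), v ∉ range (mfderiv ID I i d) →
        0 < hessian I (z ∘ f) (i d) v v) ∨
     (∀ v : TangentSpace I (i d), v ∉ range (mfderiv ID I i d) →
        hessian I (z ∘ f) (i d) v v < 0))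

/-- A *fibrating boundary map*: moreover `f|_D : D → Z` is a submersion. -/
structure IsFibratingBoundaryMap (f : X → Y) (i : D → X) (j : Z → Y) : Prop
    extends IsBoundaryMap I J ID IZ f i j where
  submersive : ∃ g : D → Z, ContMDiff ID IZ ∞ g ∧ (∀ d, j (g d) = f (i d)) ∧
    ∀ d, Surjective (mfderiv ID IZ g d)

/-- `f` is a (smooth, locally trivial) fibration over the subset `V ⊆ Y`: every point of `V` has an
open neighbourhood `U ⊆ V` with a diffeomorphism `(f, Φ) : f⁻¹(U) ≅ U × F`, with inverse `Ψ`, for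
some nonempty smooth manifold `F`. -/
def IsFibrationOver (f : X → Y) (V : Set Y) : Prop :=
  ∀ y ∈ V, ∃ U : Set Y, IsOpen U ∧ y ∈ U ∧ U ⊆ V ∧
    ∃ (EF : Type) (_ : NormedAddCommGroup EF) (_ : NormedSpace ℝ EF) (_ : FiniteDimensional ℝ EF)
      (HF : Type) (_ : TopologicalSpace HF) (IF : ModelWithCorners ℝ EF HF) (_ : IF.Boundaryless)
      (F : Type) (_ : TopologicalSpace F) (_ : ChartedSpace HF F) (_ : IsManifold IF ∞ F)
      (_ : Nonempty F) (Φ : X → F) (Ψ : Y × F → X),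
      ContMDiffOn I IF ∞ Φ (f ⁻¹' U) ∧ ContMDiffOn (J.prod IF) I ∞ Ψ (U ×ˢ univ) ∧
      (∀ x ∈ f ⁻¹' U, Ψ (f x, Φ x) = x) ∧
      ∀ u ∈ U, ∀ v : F, f (Ψ (u, v)) = u ∧ Φ (Ψ (u, v)) = v

/-- A *boundary fibration* `f : (X, D) → (Y, Z)`: a fibrating boundary map that restricts to a
fibration `X ∖ D → Y ∖ Z`. -/
structure IsBoundaryFibration (f : X → Y) (i : D → X) (j : Z → Y) : Prop
    extends IsFibratingBoundaryMap I J ID IZ f i j where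
  fibration : IsFibrationOver I J f (range j)ᶜ

end General

/-! ### Mapping class groups and mapping tori -/

section MappingClass

variable {EF HF : Type*} [NormedAddCommGroup EF] [NormedSpace ℝ EF] [TopologicalSpace HF]
  (I : ModelWithCorners ℝ EF HF) (F : Type*) [TopologicalSpace F] [ChartedSpace HF F]

/-- The group of diffeomorphisms of `F`; the product is composition. -/
instance diffeoGroup : Group (F ≃ₘ⟮I, I⟯ F) where
  mul φ ψ := ψ.trans φ
  one := Diffeomorph.refl I F ∞
  inv φ := φ.symm
  mul_assoc _ _ _ := rfl
  one_mul _ := Diffeomorph.ext fun _ => rfl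
  mul_one _ := Diffeomorph.ext fun _ => rfl
  inv_mul_cancel φ := Diffeomorph.ext fun x => φ.symm_apply_apply x

/-- A smooth isotopy, as a level-preserving diffeomorphism of `ℝ × F`, from the identity at time
`0` to `φ` at time `1`. -/
def IsIsotopyTo (Ψ : (ℝ × F) ≃ₘ⟮𝓘(ℝ, ℝ).prod I, 𝓘(ℝ, ℝ).prod I⟯ (ℝ × F))
    (φ : F ≃ₘ⟮I, I⟯ F) : Prop :=
  (∀ p, (Ψ p).1 = p.1) ∧ (∀ x, Ψ (0, x) = (0, x)) ∧ ∀ x, Ψ (1, x) = (1, φ x)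

/-- The subgroup of the diffeomorphisms that are smoothly isotopic to the identity. -/
def isotopicToId : Subgroup (F ≃ₘ⟮I, I⟯ F) where
  carrier := {φ | ∃ Ψ, IsIsotopyTo I F Ψ φ}
  one_mem' := ⟨Diffeomorph.refl _ _ _, fun _ => rfl, fun _ => rfl, fun _ => rfl⟩
  mul_mem' := by
    rintro φ ψ ⟨Φ, h1, h2, h3⟩ ⟨Ψ, k1, k2, k3⟩
    refine ⟨Ψ.trans Φ, fun p => ?_, fun x => ?_, fun x => ?_⟩
    · simp [h1, k1]
    · simp [h2, k2]
    · simp only [Diffeomorph.coe_trans, comp_apply, k3, h3]; rfl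
  inv_mem' := by
    rintro φ ⟨Φ, h1, h2, h3⟩
    refine ⟨Φ.symm, fun p => ?_, fun x => ?_, fun x => ?_⟩
    · conv_rhs => rw [← Φ.apply_symm_apply p]
      rw [h1]
    · apply Φ.injective; simp [h2]
    · apply Φ.injective
      exact (Φ.apply_symm_apply _).trans
        ((h3 _).trans (congrArg (Prod.mk 1) (φ.apply_symm_apply x))).symm

instance isotopicToId_normal : (isotopicToId I F).Normal where
  conj_mem := by
    rintro φ ⟨Φ, h1, h2, h3⟩ g
    let G := (Diffeomorph.refl 𝓘(ℝ, ℝ) ℝ ∞).prodCongr g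
    have hG : ∀ p : ℝ × F, G p = (p.1, g p.2) := fun _ => rfl
    have hG' : ∀ p : ℝ × F, G.symm p = (p.1, g.symm p.2) := fun _ => rfl
    refine ⟨(G.symm.trans Φ).trans G, fun p => ?_, fun x => ?_, fun x => ?_⟩
    · simp [hG, hG', h1]
    · simp [hG, hG', h2]
    · simp only [Diffeomorph.coe_trans, comp_apply, hG, hG', h3]; rfl

/-- The mapping class group of `F`: diffeomorphisms modulo smooth isotopy. -/
abbrev MappingClassGroup : Type _ := (F ≃ₘ⟮I, I⟯ F) ⧸ isotopicToId I F

variable {I F} {EX HX X Y : Type*} [NormedAddCommGroup EX] [NormedSpace ℝ EX]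
  [TopologicalSpace HX] [TopologicalSpace X] [ChartedSpace HX X]

/-- Let `γ : ℝ → Y` be the `1`-periodic parametrization of a circle in `Y`. The smooth map
`H : ℝ × F → X` identifies `f⁻¹(γ) → γ` with the mapping torus of `φ`, that is, with the quotient of
`ℝ × F` by `(t + 1, v) ∼ (t, φ v)`, as a fibre bundle over `γ = ℝ / ℤ`. Going once around `γ`, the
point `v` of the fibre `F` thus returns as `φ v`. -/
structure IsMappingTorus (I : ModelWithCorners ℝ EF HF) (IX : ModelWithCorners ℝ EX HX)
    (f : X → Y) (γ : ℝ → Y) (φ : F ≃ₘ⟮I, I⟯ F) (H : ℝ × F → X) : Prop where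
  smooth : ContMDiff (𝓘(ℝ, ℝ).prod I) IX ∞ H
  immersive : ∀ p, Injective (mfderiv (𝓘(ℝ, ℝ).prod I) IX H p)
  injective : ∀ t, Injective fun v => H (t, v)
  range_eq : ∀ t, (range fun v => H (t, v)) = f ⁻¹' {γ t}
  glue : ∀ t v, H (t + 1, v) = H (t, φ v)

end MappingClass

/-! ### The torus and its Dehn twists -/

/-- The torus `T² = S¹ × S¹`. -/
abbrev Torus : Type := Circle × Circle

/-- The product smooth structure on the torus. -/
abbrev IT : ModelWithCorners ℝ (EuclideanSpace ℝ (Fin 1) × EuclideanSpace ℝ (Fin 1))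
    (ModelProd (EuclideanSpace ℝ (Fin 1)) (EuclideanSpace ℝ (Fin 1))) := (𝓡 1).prod (𝓡 1)

/-- The point `e^{2πit}` of the circle. -/
def circ (t : ℝ) : Circle := Circle.exp (2 * Real.pi * t)

/-- The invariant positive vector field on the circle, the velocity of `t ↦ z e^{2πit}`. -/
def circleField (z : Circle) : TangentSpace (𝓡 1) z :=
  mfderiv 𝓘(ℝ, ℝ) (𝓡 1) (fun t : ℝ => z * circ t) 0 (1 : ℝ)

/-- The coordinate vector field `∂₁` on the torus. -/
def torusField₁ (q : Torus) : TangentSpace IT q :=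
  ((circleField q.1 : EuclideanSpace ℝ (Fin 1)), (0 : EuclideanSpace ℝ (Fin 1)))

/-- The coordinate vector field `∂₂` on the torus. -/
def torusField₂ (q : Torus) : TangentSpace IT q :=
  ((0 : EuclideanSpace ℝ (Fin 1)), (circleField q.2 : EuclideanSpace ℝ (Fin 1)))

/-- The tangent frame `(u, w)` is positive for the orientation of the torus given by `(∂₁, ∂₂)`. -/
def IsPositiveTorusFrame (q : Torus) (u w : TangentSpace IT q) : Prop :=
  ∃ a b c d : ℝ, u = a • torusField₁ q + b • torusField₂ q ∧
    w = c • torusField₁ q + d • torusField₂ q ∧ 0 < a * d - b * c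

/-- `A : S¹ × ℝ → T²` is an orientation-preserving embedding of the open annulus, where the annulus
carries the orientation given by `(∂_θ, ∂_t)`. -/
structure IsOrientedAnnulus (A : Circle × ℝ → Torus) : Prop where
  smooth : ContMDiff ((𝓡 1).prod 𝓘(ℝ, ℝ)) IT ∞ A
  injective : Injective A
  oriented : ∀ p : Circle × ℝ, IsPositiveTorusFrame (A p)
    (mfderiv (𝓡 1) IT (fun z : Circle => A (z, p.2)) p.1 (circleField p.1))
    (mfderiv 𝓘(ℝ, ℝ) IT (fun t : ℝ => A (p.1, t)) p.2 (1 : ℝ))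

/-- `δ` is a right-handed Dehn twist of the oriented torus about the core curve `A(S¹ × {1/2})` of
the annulus `A`: the identity outside the annulus, and `(θ, t) ↦ (θ + 2πχ(t), t)` on it, where `χ`
is smooth with `χ = 0` for `t ≤ 0` and `χ = 1` for `t ≥ 1`. An arc that crosses the core is turned
to the right by `δ`. -/
structure IsRightHandedDehnTwistAlong (A : Circle × ℝ → Torus) (δ : Torus ≃ₘ⟮IT, IT⟯ Torus) :
    Prop where
  annulus : IsOrientedAnnulus A
  on_annulus : ∃ χ : ℝ → ℝ, ContDiff ℝ ∞ χ ∧ (∀ t ≤ 0, χ t = 0) ∧ (∀ t, 1 ≤ t → χ t = 1) ∧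
    ∀ z t, δ (A (z, t)) = A (z * circ (χ t), t)
  off_annulus : ∀ q ∉ range A, δ q = q

/-- `δ` is a right-handed Dehn twist of the oriented torus about some nonseparating (equivalently,
essential) simple closed curve. -/
def IsRightHandedDehnTwist (δ : Torus ≃ₘ⟮IT, IT⟯ Torus) : Prop :=
  ∃ A, IsRightHandedDehnTwistAlong A δ ∧ IsConnected (range fun z : Circle => A (z, 1 / 2))ᶜ

/-! ### Complex line bundles over the torus and the standard model -/

section LineBundle

/-- The model with corners of the total space of a complex line bundle over the torus. -/
abbrev IL := IT.prod 𝓘(ℝ, ℂ)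

/-- The half cylinder `S¹ × ℝ_{≥ 0}`, a manifold with boundary. -/
abbrev HalfCylinder : Type := Circle × EuclideanHalfSpace 1

/-- The product smooth structure on the half cylinder. -/
abbrev IC := (𝓡 1).prod (𝓡∂ 1)

/-- The point `s ≥ 0` of the half line. -/
def halfLinePoint (s : ℝ) (hs : 0 ≤ s) : EuclideanHalfSpace 1 :=
  ⟨EuclideanSpace.single 0 s, by simpa using hs⟩

/-- The inclusion of the boundary circle `S¹ × {0}`. -/
def boundaryCircle (z : Circle) : HalfCylinder := (z, halfLinePoint 0 le_rfl)

variable (L : Torus → Type*) [∀ q, AddCommGroup (L q)] [∀ q, Module ℂ (L q)]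
  [∀ q, TopologicalSpace (L q)] [TopologicalSpace (TotalSpace ℂ L)] [FiberBundle ℂ L]

/-- A smooth Hermitian metric on the complex line bundle `L`. By polarization it is smooth if and
only if its quadratic form is a smooth function on the total space. -/
structure HermitianMetric where
  inner : ∀ q, L q →ₗ⋆[ℂ] L q →ₗ[ℂ] ℂ
  conj_symm : ∀ q u w, starRingEnd ℂ (inner q u w) = inner q w u
  pos : ∀ q u, u ≠ 0 → 0 < (inner q u u).re
  smooth : ContMDiff IL 𝓘(ℝ, ℝ) ∞ fun v : TotalSpace ℂ L => (inner v.proj v.2 v.2).re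

/-- `∇` is `ℂ`-linear, that is, a connection on the complex line bundle `L` and not only on the
underlying real bundle. -/
def IsComplexConnection [∀ q, IsTopologicalAddGroup (L q)] [∀ q, ContinuousSMul ℝ (L q)]
    (D : CovariantDerivative IT ℂ L) : Prop :=
  ∀ (σ : ∀ q, L q), ContMDiff IT IL ∞ (fun q => TotalSpace.mk' ℂ q (σ q)) →
    ∀ q (u : TangentSpace IT q),
      D (fun q' => Complex.I • σ q') q u = Complex.I • D σ q u

/-- `Ω = F(∂₁, ∂₂)`, where `F` is the curvature of the connection `∇`. As `∂₁` and `∂₂` commute,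
`F(∂₁, ∂₂) σ = ∇₁ ∇₂ σ - ∇₂ ∇₁ σ`. -/
def IsCurvature [∀ q, IsTopologicalAddGroup (L q)] [∀ q, ContinuousSMul ℝ (L q)]
    (D : CovariantDerivative IT ℂ L) (Ω : Torus → ℂ) : Prop :=
  ∀ (σ : ∀ q, L q), ContMDiff IT IL ∞ (fun q => TotalSpace.mk' ℂ q (σ q)) → ∀ q,
    D (fun q' => D σ q' (torusField₂ q')) q (torusField₁ q) -
      D (fun q' => D σ q' (torusField₁ q')) q (torusField₂ q) = Ω q • σ q

/-- The first Chern class of `L` is `n ∈ ℤ = H²(T²; ℤ)`, for the orientation of the torus given by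
`(∂₁, ∂₂)`: some smooth connection `∇` on `L` (equivalently, every one) satisfies
`(i / 2π) ∫_{T²} F_∇ = n`. -/
def HasFirstChernClass [∀ q, IsTopologicalAddGroup (L q)] [∀ q, ContinuousSMul ℝ (L q)]
    [VectorBundle ℝ ℂ L] (n : ℤ) : Prop :=
  ∃ (D : CovariantDerivative IT ℂ L) (Ω : Torus → ℂ),
    CovariantDerivative.ContMDiffCovariantDerivative D ∞ ∧ IsComplexConnection L D ∧ IsCurvature L D Ω ∧
    (Complex.I / (2 * Real.pi)) *
      (∫ x in (0 : ℝ)..1, ∫ y in (0 : ℝ)..1, Ω (circ x, circ y)) = n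

variable {L}

/-- The fibrewise radial distance `r`. -/
def HermitianMetric.radius (h : HermitianMetric L) (v : TotalSpace ℂ L) : ℝ :=
  Real.sqrt (h.inner v.proj v.2 v.2).re

/-- The map `f(x) = (pr(p(x)), r²(x))` of the standard model. -/
def standardMap (h : HermitianMetric L) (v : TotalSpace ℂ L) : HalfCylinder :=
  (v.proj.1, halfLinePoint (h.radius v ^ 2) (sq_nonneg _))

/-- The circle `γ = S¹ × {ε}`, parametrized in the positive direction of `S¹`. -/
def gammaCircle (ε : ℝ) (hε : 0 < ε) (t : ℝ) : HalfCylinder := (circ t, halfLinePoint ε hε.le)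

/-- The vertical tangent vector at `v` given by the vector `w` of the fibre through `v`. -/
def verticalVector (v : TotalSpace ℂ L) (w : L v.proj) : TangentSpace IL v :=
  mfderiv 𝓘(ℝ, ℝ) IL (fun s : ℝ => TotalSpace.mk' ℂ v.proj (v.2 + s • w)) 0 (1 : ℝ)

/-- The orientation of `Tot(L)` given by the orientation `(∂₁, ∂₂)` of the base, followed by the
complex orientation `(w, iw)` of the fibres. -/
def IsPositiveFrame (v : TotalSpace ℂ L) (e : Fin 4 → TangentSpace IL v) : Prop :=
  ∃ (b : Module.Basis (Fin 4) ℝ (TangentSpace IL v)) (w : L v.proj),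
    mfderiv IL IT (TotalSpace.proj : TotalSpace ℂ L → Torus) v (b 0) = torusField₁ v.proj ∧
    mfderiv IL IT (TotalSpace.proj : TotalSpace ℂ L → Torus) v (b 1) = torusField₂ v.proj ∧
    b 2 = verticalVector v w ∧ b 3 = verticalVector v (Complex.I • w) ∧ 0 < b.det e

/-- The induced orientation of the fibres of `f`: the frame `(u, w)` of a fibre is positive if,
preceded by lifts of the positive frame `(∂_θ, ∂_s)` of `S¹ × ℝ_{≥ 0}`, it is a positive frame of
`Tot(L)`. -/
def IsPositiveFibreFrame (h : HermitianMetric L) (v : TotalSpace ℂ L)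
    (u w : TangentSpace IL v) : Prop :=
  ∃ e₁ e₂ : TangentSpace IL v,
    mfderiv IL IC (standardMap h) v e₁ =
      ((circleField v.proj.1 : EuclideanSpace ℝ (Fin 1)), (0 : EuclideanSpace ℝ (Fin 1))) ∧
    mfderiv IL IC (standardMap h) v e₂ =
      ((0 : EuclideanSpace ℝ (Fin 1)), EuclideanSpace.single (0 : Fin 1) (1 : ℝ)) ∧
    IsPositiveFrame v ![e₁, e₂, u, w]

/-- The mapping class `μ` of the oriented torus is the monodromy of the standard model around `γ`:
`f⁻¹(γ) → γ` is the mapping torus of a representative of `μ`, through an identification of the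
fibres with the torus that preserves orientations. -/
def IsMonodromy (h : HermitianMetric L) (ε : ℝ) (hε : 0 < ε) (μ : MappingClassGroup IT Torus) :
    Prop :=
  ∃ (φ : Torus ≃ₘ⟮IT, IT⟯ Torus) (H : ℝ × Torus → TotalSpace ℂ L),
    (φ : MappingClassGroup IT Torus) = μ ∧
    IsMappingTorus IT IL (standardMap h) (gammaCircle ε hε) φ H ∧
    ∀ t q, IsPositiveFibreFrame h (H (t, q))
      (mfderiv IT IL (fun q' => H (t, q')) q (torusField₁ q))
      (mfderiv IT IL (fun q' => H (t, q')) q (torusField₂ q))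

end LineBundle

end BoundaryFibration

end

open BoundaryFibration

/-!
The proof rests on a normal form of the line bundle. Pulled back to the universal cover `ℝ²` of the
torus, the bundle has a nowhere vanishing smooth section `S` with `S (x, y + 1) = S (x, y)` and
`S (x + 1, y) = e^{2πik σ(y)} S (x, y)`, where `σ` is a fixed smooth function with
`σ (y + 1) = σ(y) + 1` and `k` is an integer (`exists_quasiperiodic_frame`). It is built by gluing
local frames: two frames over a convex set differ by a function `exp g`, and multiplication by
`exp (χ g)`, for a cutoff function `χ`, interpolates between them, both to enlarge the domain of a
frame and to make it periodic in a given direction. In the frame `S`, a connection becomes a pair of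
functions `(A₁, A₂)` on the plane with curvature `∂₁A₂ - ∂₂A₁`, and the integral of the curvature
over the unit square is computed by the differences of the `Aᵢ` between opposite sides, which the
quasi-periodicity of `S` determines: it is `2πik`, so that `k = -c₁(L) = -n`
(`degree_eq_neg_chernClass`). Normalized, `S` becomes a unit section over the cylinder `ℝ × S¹` with
monodromy `y ↦ e^{-2πin σ(y)}` (`exists_unitFrame`).

That `f` is a boundary fibration then has two ingredients. Near the zero section, `r²` has the form
`G(x) |c|²` with `G > 0` in a local trivialization, so its normal Hessian is `2 G |c|²`, which is
positive definite. Away from it, and over an arc of the circle, a point is determined by its image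
under `f`, its phase with respect to `S`, and the second coordinate of its base point
(`IsUnitFrame.isFibrationOver`).

With phase and second coordinate as coordinates of the fibres, the preimage of `γ` is the mapping
torus of `(w, y) ↦ (w e^{-2πin σ(y)}, y)`, the `-n`-th power of a Dehn twist
(`IsUnitFrame.isMappingTorus`), which is right-handed because the fibres carry the orientation
`(∂_w, ∂_y)` (`IsUnitFrame.isPositiveFibreFrame_modelMap`). Any other identification of the preimage
of `γ` with a mapping torus, say of `φ`, differs from this one by a level-preserving bijection of
`ℝ × T²` with invertible derivatives, hence by a smooth family `ψ t` of diffeomorphisms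
(`IsUnitFrame.exists_levelPreserving`). The gluing conditions give
`φ = (ψ 0)⁻¹ ∘ twist^{-n} ∘ ψ 1`, and `ψ 1` is isotopic to `ψ 0`; so the class of `φ` is the `-n`-th
power of the class of the twist conjugated by `ψ 0`, which is again a right-handed Dehn twist since
`ψ 0` preserves orientations (`IsUnitFrame.exists_dehnTwist_of_isMonodromy`).
-/

noncomputable section

namespace BoundaryFibration

open Filter Topology

/-! ### Derivatives with values in the model space -/

section Dmap

variable {E H M E' H' M' E'' H'' M'' : Type*}
  [NormedAddCommGroup E] [NormedSpace ℝ E] [TopologicalSpace H]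
  [NormedAddCommGroup E'] [NormedSpace ℝ E'] [TopologicalSpace H']
  [NormedAddCommGroup E''] [NormedSpace ℝ E''] [TopologicalSpace H'']
  [TopologicalSpace M] [ChartedSpace H M] [TopologicalSpace M'] [ChartedSpace H' M']
  [TopologicalSpace M''] [ChartedSpace H'' M'']
  (I : ModelWithCorners ℝ E H) (I' : ModelWithCorners ℝ E' H') (I'' : ModelWithCorners ℝ E'' H'')

/-- The derivative `mfderiv I I' f x`, as a map between the model vector spaces. All tangent
spaces of a manifold are copies of its model space, so this only forgets the base points, which
allows rewriting them. -/
def dmap (f : M → M') (x : M) : E →L[ℝ] E' := mfderiv I I' f x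

variable {I I' I''}

lemma HasMFDerivAt.dmap_eq {f : M → M'} {x : M} {f' : E →L[ℝ] E'}
    (h : HasMFDerivAt I I' f x f') : dmap I I' f x = f' := h.mfderiv

lemma dmap_comp {g : M' → M''} {f : M → M'} (x : M)
    (hg : MDifferentiableAt I' I'' g (f x)) (hf : MDifferentiableAt I I' f x) :
    dmap I I'' (g ∘ f) x = (dmap I' I'' g (f x)).comp (dmap I I' f x) :=
  mfderiv_comp x hg hf

lemma dmap_comp_apply {g : M' → M''} {f : M → M'} (x : M)
    (hg : MDifferentiableAt I' I'' g (f x)) (hf : MDifferentiableAt I I' f x) (v : E) :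
    dmap I I'' (fun y => g (f y)) x v = dmap I' I'' g (f x) (dmap I I' f x v) :=
  congrArg (fun L : E →L[ℝ] E'' => L v) (dmap_comp x hg hf)

lemma dmap_congr {f g : M → M'} {x : M} (h : f =ᶠ[𝓝 x] g) : dmap I I' f x = dmap I I' g x :=
  h.mfderiv_eq

lemma dmap_id (x : M) : dmap I I (fun y : M => y) x = ContinuousLinearMap.id ℝ E := mfderiv_id

lemma dmap_const (c : M') (x : M) : dmap I I' (fun _ : M => c) x = 0 := mfderiv_const

lemma dmap_eq_fderiv (f : E → E') (x : E) : dmap 𝓘(ℝ, E) 𝓘(ℝ, E') f x = fderiv ℝ f x :=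
  mfderiv_eq_fderiv

lemma dmap_prodMk {f : M → M'} {g : M → M''} {x : M}
    (hf : MDifferentiableAt I I' f x) (hg : MDifferentiableAt I I'' g x) (v : E) :
    dmap I (I'.prod I'') (fun y => (f y, g y)) x v = (dmap I I' f x v, dmap I I'' g x v) := by
  have := (hf.hasMFDerivAt.prodMk hg.hasMFDerivAt).mfderiv
  exact congrArg (fun L : E →L[ℝ] E' × E'' => L v) this

end Dmap

/-! ### The circle -/

@[simp] lemma circ_zero : circ 0 = 1 := by simp [circ]

lemma circ_add (s t : ℝ) : circ (s + t) = circ s * circ t := by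
  simp [circ, mul_add, Circle.exp_add]

lemma circ_neg (t : ℝ) : circ (-t) = (circ t)⁻¹ := by
  simp [circ, Circle.exp_neg]

lemma circ_sub (s t : ℝ) : circ (s - t) = circ s * (circ t)⁻¹ := by
  rw [sub_eq_add_neg, circ_add, circ_neg]

@[simp] lemma circ_intCast (m : ℤ) : circ m = 1 := by
  rw [circ, Circle.exp_eq_one]
  exact ⟨m, by ring⟩

@[simp] lemma circ_one : circ 1 = 1 := by simpa using circ_intCast 1

lemma circ_add_one (t : ℝ) : circ (t + 1) = circ t := by simp [circ_add]

lemma circ_zsmul (m : ℤ) (t : ℝ) : circ (m * t) = circ t ^ m := by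
  rw [circ, circ, ← Circle.exp_zsmul]
  congr 1
  simp
  ring

lemma circ_eq_circ_iff {s t : ℝ} : circ s = circ t ↔ ∃ m : ℤ, s = t + m := by
  rw [circ, circ, Circle.exp_eq_exp]
  refine exists_congr fun m => ⟨fun h => ?_, fun h => by rw [h]; ring⟩
  have := Real.pi_pos
  field_simp at h
  linarith

lemma coe_circ (t : ℝ) : (circ t : ℂ) = Complex.exp (2 * Real.pi * t * Complex.I) := by
  simp [circ, Circle.coe_exp]

lemma contMDiff_circ : ContMDiff 𝓘(ℝ, ℝ) (𝓡 1) ∞ circ := by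
  have : ContMDiff 𝓘(ℝ, ℝ) 𝓘(ℝ, ℝ) ∞ fun t : ℝ => 2 * Real.pi * t :=
    (by fun_prop : ContDiff ℝ ∞ fun t : ℝ => 2 * Real.pi * t).contMDiff
  exact contMDiff_circleExp.comp this

lemma contMDiff_circle_coe : ContMDiff (𝓡 1) 𝓘(ℝ, ℂ) ∞ (fun z : Circle => (z : ℂ)) :=
  haveI : Fact (Module.finrank ℝ ℂ = 1 + 1) := finrank_real_complex_fact'
  contMDiff_coe_sphere (E := ℂ) (n := 1)

/-- The unit complex number `c / |c|`, for `c ≠ 0`. -/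
def phase (c : ℂ) : Circle := Circle.exp c.arg

lemma phase_mul_norm (c : ℂ) : (phase c : ℂ) * ‖c‖ = c := by
  rw [phase, Circle.coe_exp, mul_comm, Complex.norm_mul_exp_arg_mul_I]

lemma phase_mul_circle {r : ℝ} (hr : 0 < r) (z : Circle) : phase (r * z) = z := by
  ext
  have h := phase_mul_norm (r * z)
  have hr' : (r : ℂ) ≠ 0 := by exact_mod_cast hr.ne'
  simp only [norm_mul, Complex.norm_real, Circle.norm_coe, mul_one, Real.norm_eq_abs,
    abs_of_pos hr] at h
  rw [mul_comm] at h
  exact mul_left_cancel₀ hr' h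

lemma contMDiffAt_phase {c : ℂ} (hc : c ≠ 0) : ContMDiffAt 𝓘(ℝ, ℂ) (𝓡 1) ∞ phase c := by
  -- Near `c` the argument is smooth after the rotation that takes `c` to the positive axis.
  have h1 : ContDiffAt ℝ ∞ (fun w : ℂ => c.arg + (w / c).arg) c := by
    have h2 : ContDiffAt ℝ ∞ (fun w : ℂ => Complex.log (w / c)) c := by
      have h3 : ContDiffAt ℂ ∞ Complex.log (c / c) :=
        Complex.contDiffAt_log (by rw [div_self hc]; exact Complex.one_mem_slitPlane)
      have h3' : ContDiffAt ℝ ∞ (fun w : ℂ => w / c) c := contDiffAt_id.div_const c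
      exact ContDiffAt.comp (f := fun w : ℂ => w / c) c (h3.restrict_scalars ℝ) h3'
    have h4 : ContDiffAt ℝ ∞ (fun w : ℂ => (Complex.log (w / c)).im) c :=
      Complex.imCLM.contDiff.contDiffAt.comp c h2
    simpa [Complex.log_im] using contDiffAt_const.add h4
  have h5 := contMDiff_circleExp.contMDiffAt.comp c h1.contMDiffAt
  refine h5.congr_of_eventuallyEq ?_
  filter_upwards [isOpen_ne.mem_nhds hc] with w hw
  ext
  have hw' : ((‖w‖ : ℝ) : ℂ) ≠ 0 := by simpa using hw
  apply mul_right_cancel₀ hw'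
  rw [phase_mul_norm]
  have e1 := phase_mul_norm c
  have e2 := phase_mul_norm (w / c)
  simp only [phase, comp_apply, Circle.exp_add, Circle.coe_mul] at *
  have e3 : (‖w / c‖ : ℂ) * ‖c‖ = ‖w‖ := by
    rw [← Complex.ofReal_mul, norm_div, div_mul_cancel₀ _ (norm_ne_zero_iff.2 hc)]
  calc w = c * (w / c) := by field_simp
    _ = (↑(Circle.exp c.arg) * ↑‖c‖) * (↑(Circle.exp (w / c).arg) * ↑‖w / c‖) := by rw [e1, e2]
    _ = _ := by rw [← e3]; ring

/-- The branch of `t` as a function of `circ t` that takes values in `(t₀ - 1/2, t₀ + 1/2]`. -/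
def argLift (t₀ : ℝ) (z : Circle) : ℝ := t₀ + (z * (circ t₀)⁻¹ : Circle).1.arg / (2 * Real.pi)

lemma circ_argLift (t₀ : ℝ) (z : Circle) : circ (argLift t₀ z) = z := by
  rw [argLift, circ_add]
  have : circ ((z * (circ t₀)⁻¹ : Circle).1.arg / (2 * Real.pi)) = z * (circ t₀)⁻¹ := by
    rw [circ, mul_div_cancel₀ _ (by positivity : 2 * Real.pi ≠ 0)]
    exact Circle.exp_arg _
  rw [this]
  simp

lemma argLift_circ {t₀ t : ℝ} (h : |t - t₀| < 1 / 2) : argLift t₀ (circ t) = t := by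
  rw [argLift, ← circ_sub]
  have hp := Real.pi_pos
  have h' := abs_lt.1 h
  have : (circ (t - t₀)).1.arg = 2 * Real.pi * (t - t₀) :=
    Circle.arg_exp (by nlinarith) (by nlinarith)
  rw [this]
  field_simp
  ring

/-- The open arc on which `argLift t₀` is smooth, the complement of the point opposite
to `circ t₀`. -/
def arc (t₀ : ℝ) : Set Circle := {z | (z * (circ t₀)⁻¹ : Circle).1 ∈ Complex.slitPlane}

lemma isOpen_arc (t₀ : ℝ) : IsOpen (arc t₀) :=
  Complex.isOpen_slitPlane.preimage (by fun_prop)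

lemma circ_mem_arc (t₀ : ℝ) : circ t₀ ∈ arc t₀ := by simp [arc]

lemma contMDiffAt_argLift {t₀ : ℝ} {z : Circle} (hz : z ∈ arc t₀) :
    ContMDiffAt (𝓡 1) 𝓘(ℝ, ℝ) ∞ (argLift t₀) z := by
  have h1 : ContMDiffAt (𝓡 1) 𝓘(ℝ, ℂ) ∞ (fun w : Circle => (w : ℂ) * ((circ t₀)⁻¹ : Circle)) z :=
    ContMDiffAt.comp (g := fun w : ℂ => w * ((circ t₀)⁻¹ : Circle)) (I' := 𝓘(ℝ, ℂ)) z
      (by fun_prop : ContDiff ℝ ∞ fun w : ℂ => w * ((circ t₀)⁻¹ : Circle)).contMDiff.contMDiffAt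
      contMDiff_circle_coe.contMDiffAt
  have h2 : ContDiffAt ℝ ∞ (fun w : ℂ => t₀ + (Complex.log w).im / (2 * Real.pi))
      ((z * (circ t₀)⁻¹ : Circle) : ℂ) := by
    have h3 : ContDiffAt ℝ ∞ Complex.log ((z * (circ t₀)⁻¹ : Circle) : ℂ) :=
      (Complex.contDiffAt_log hz).restrict_scalars ℝ
    have h4 : ContDiffAt ℝ ∞ (fun w => (Complex.log w).im) ((z * (circ t₀)⁻¹ : Circle) : ℂ) :=
      Complex.imCLM.contDiff.contDiffAt.comp _ h3
    exact contDiffAt_const.add (h4.div_const _)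
  have h5 := ContMDiffAt.comp z (I' := 𝓘(ℝ, ℂ)) h2.contMDiffAt h1
  exact h5.congr_of_eventuallyEq (Eventually.of_forall fun w => by
    simp [argLift, Complex.log_im])

lemma exists_circ_eq (z : Circle) : ∃ t, circ t = z := ⟨argLift 0 z, circ_argLift 0 z⟩

/-! ### Invariant vector fields -/

lemma mdiff_circ (t : ℝ) : MDifferentiableAt 𝓘(ℝ, ℝ) (𝓡 1) circ t :=
  contMDiff_circ.mdifferentiableAt (by simp)

/-- The vector field `circleField`, with values in the model space. -/
def circleVec (z : Circle) : EuclideanSpace ℝ (Fin 1) := circleField z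

lemma circleVec_circ (t : ℝ) : circleVec (circ t) = dmap 𝓘(ℝ, ℝ) (𝓡 1) circ t 1 := by
  have h : (fun s : ℝ => circ t * circ s) = fun s => circ (t + s) := by
    ext s; simp [circ_add]
  have h2 : MDifferentiableAt 𝓘(ℝ, ℝ) 𝓘(ℝ, ℝ) (fun s : ℝ => t + s) 0 :=
    (by fun_prop : DifferentiableAt ℝ (fun s : ℝ => t + s) 0).mdifferentiableAt
  change dmap 𝓘(ℝ, ℝ) (𝓡 1) (fun s : ℝ => circ t * circ s) 0 1 = _
  rw [h, dmap_comp_apply (0 : ℝ) (mdiff_circ (t + 0)) h2, add_zero, dmap_eq_fderiv]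
  simp

lemma circleVec_ne_zero (z : Circle) : circleVec z ≠ 0 := by
  obtain ⟨t, rfl⟩ := exists_circ_eq z
  intro h0
  have h3 : (fun s => argLift t (circ s)) =ᶠ[𝓝 t] fun s => s := by
    filter_upwards [Metric.ball_mem_nhds t (by norm_num : (0 : ℝ) < 1 / 2)] with s hs
    exact argLift_circ (by simpa [Real.dist_eq] using hs)
  have h1 : MDifferentiableAt (𝓡 1) 𝓘(ℝ, ℝ) (argLift t) (circ t) :=
    (contMDiffAt_argLift (circ_mem_arc t)).mdifferentiableAt (by simp)
  have h4 := dmap_comp_apply t h1 (mdiff_circ t) 1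
  rw [dmap_congr h3, dmap_id, ← circleVec_circ, h0, map_zero] at h4
  simp at h4

lemma exists_smul_circleVec (z : Circle) (u : EuclideanSpace ℝ (Fin 1)) :
    ∃ a : ℝ, u = a • circleVec z := by
  have h := (finrank_eq_one_iff_of_nonzero' (K := ℝ) (V := EuclideanSpace ℝ (Fin 1)) _
    (circleVec_ne_zero z)).1 (by simp) u
  exact ⟨h.choose, h.choose_spec.symm⟩

lemma exists_torusField_comb (q : Torus) (u : TangentSpace IT q) :
    ∃ a b : ℝ, u = a • torusField₁ q + b • torusField₂ q := by
  obtain ⟨a, ha⟩ := exists_smul_circleVec q.1 u.1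
  obtain ⟨b, hb⟩ := exists_smul_circleVec q.2 u.2
  have key : ∀ (x y u v : EuclideanSpace ℝ (Fin 1)), u = a • x → v = b • y →
      (u, v) = a • (x, (0 : EuclideanSpace ℝ (Fin 1))) +
        b • ((0 : EuclideanSpace ℝ (Fin 1)), y) := by
    rintro x y _ _ rfl rfl; simp
  exact ⟨a, b, key _ _ _ _ ha hb⟩

lemma torusField_comb_eq_zero {q : Torus} {a b : ℝ}
    (h : a • torusField₁ q + b • torusField₂ q = 0) : a = 0 ∧ b = 0 := by
  have key : ∀ (x y : EuclideanSpace ℝ (Fin 1)), x ≠ 0 → y ≠ 0 →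
      a • (x, (0 : EuclideanSpace ℝ (Fin 1))) + b • ((0 : EuclideanSpace ℝ (Fin 1)), y) = 0 →
      a = 0 ∧ b = 0 := by
    intro x y hx hy h
    simpa [hx, hy] using h
  exact key _ _ (circleVec_ne_zero _) (circleVec_ne_zero _) h

/-! ### Scalar multiplication and quotients in a complex line bundle -/

section LineBundleAlgebra

variable {L : Torus → Type*} [∀ q, AddCommGroup (L q)] [∀ q, Module ℂ (L q)]

/-- Fibrewise multiplication by a complex number on the total space of a complex line bundle. -/
def scale (c : ℂ) (v : TotalSpace ℂ L) : TotalSpace ℂ L := ⟨v.proj, c • v.2⟩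

@[simp] lemma scale_proj (c : ℂ) (v : TotalSpace ℂ L) : (scale c v).proj = v.proj := rfl

@[simp] lemma scale_scale (c d : ℂ) (v : TotalSpace ℂ L) :
    scale c (scale d v) = scale (c * d) v :=
  congrArg (TotalSpace.mk v.proj) (smul_smul c d v.2)

@[simp] lemma scale_one (v : TotalSpace ℂ L) : scale 1 v = v := by simp [scale]

lemma scale_snd_ne_zero {c : ℂ} (hc : c ≠ 0) {v : TotalSpace ℂ L} (hv : v.2 ≠ 0) :
    (scale c v).2 ≠ 0 := smul_ne_zero hc hv

variable [∀ q, TopologicalSpace (L q)] [TopologicalSpace (TotalSpace ℂ L)] [FiberBundle ℂ L]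

/-- The fibre coordinate in the preferred trivialization at `q`. -/
def fibreCoord (q : Torus) (v : TotalSpace ℂ L) : ℂ := (trivializationAt ℂ L q v).2

/-- The quotient `w / v` of two vectors of the same fibre of a complex line bundle. -/
def ratio (v w : TotalSpace ℂ L) : ℂ := fibreCoord v.proj w / fibreCoord v.proj v

variable [VectorBundle ℂ ℂ L]

lemma fibreCoord_smul {q b : Torus} (hb : b ∈ (trivializationAt ℂ L q).baseSet) (c : ℂ) (u : L b) :
    fibreCoord q ⟨b, c • u⟩ = c * fibreCoord q ⟨b, u⟩ :=
  ((trivializationAt ℂ L q).linear ℂ hb).map_smul c u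

lemma fibreCoord_add {q b : Torus} (hb : b ∈ (trivializationAt ℂ L q).baseSet) (u w : L b) :
    fibreCoord q ⟨b, u + w⟩ = fibreCoord q ⟨b, u⟩ + fibreCoord q ⟨b, w⟩ :=
  ((trivializationAt ℂ L q).linear ℂ hb).map_add u w

omit [∀ q, AddCommGroup (L q)] [∀ q, Module ℂ (L q)] [VectorBundle ℂ ℂ L] in
lemma fibreCoord_injective {q b : Torus} (hb : b ∈ (trivializationAt ℂ L q).baseSet) :
    Injective fun u : L b => fibreCoord q ⟨b, u⟩ := by
  intro u w h
  have h1 : (trivializationAt ℂ L q) ⟨b, u⟩ = (trivializationAt ℂ L q) ⟨b, w⟩ := by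
    refine Prod.ext ?_ h
    rw [(trivializationAt ℂ L q).coe_fst' hb, (trivializationAt ℂ L q).coe_fst' hb]
  have h2 := (trivializationAt ℂ L q).injOn
    ((trivializationAt ℂ L q).mem_source.2 hb) ((trivializationAt ℂ L q).mem_source.2 hb) h1
  exact TotalSpace.mk_inj.1 h2

lemma fibreCoord_zero {q b : Torus} (hb : b ∈ (trivializationAt ℂ L q).baseSet) :
    fibreCoord q (⟨b, 0⟩ : TotalSpace ℂ L) = 0 := by
  simpa using fibreCoord_smul hb 0 (0 : L b)

lemma fibreCoord_ne_zero {q : Torus} {v : TotalSpace ℂ L}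
    (hb : v.proj ∈ (trivializationAt ℂ L q).baseSet) (hv : v.2 ≠ 0) : fibreCoord q v ≠ 0 := by
  intro h
  exact hv (fibreCoord_injective hb (h.trans (fibreCoord_zero hb).symm))

lemma exists_scale_eq {v w : TotalSpace ℂ L} (hv : v.2 ≠ 0) (h : w.proj = v.proj) :
    ∃ c : ℂ, scale c v = w := by
  obtain ⟨b, u⟩ := v
  obtain ⟨b', u'⟩ := w
  obtain rfl : b' = b := h
  have hb : b' ∈ (trivializationAt ℂ L b').baseSet := mem_baseSet_trivializationAt ..
  refine ⟨fibreCoord b' ⟨b', u'⟩ / fibreCoord b' ⟨b', u⟩, ?_⟩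
  have h0 := fibreCoord_ne_zero (v := ⟨b', u⟩) hb hv
  refine congrArg (TotalSpace.mk b') (fibreCoord_injective hb ?_)
  change fibreCoord b' ⟨b', _ • u⟩ = _
  rw [fibreCoord_smul hb, div_mul_cancel₀ _ h0]

lemma fibreCoord_div_eq {q : Torus} {v : TotalSpace ℂ L}
    (hb : v.proj ∈ (trivializationAt ℂ L q).baseSet) (hv : v.2 ≠ 0) (c : ℂ) :
    fibreCoord q (scale c v) / fibreCoord q v = c := by
  rw [scale, fibreCoord_smul hb, mul_div_assoc]
  exact (mul_right_eq_self₀ (a := c)).2 (.inl (div_self (fibreCoord_ne_zero hb hv)))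

lemma ratio_scale {v : TotalSpace ℂ L} (hv : v.2 ≠ 0) (c : ℂ) : ratio v (scale c v) = c :=
  fibreCoord_div_eq (mem_baseSet_trivializationAt ..) hv c

lemma scale_ratio {v w : TotalSpace ℂ L} (hv : v.2 ≠ 0) (h : w.proj = v.proj) :
    scale (ratio v w) v = w := by
  obtain ⟨c, rfl⟩ := exists_scale_eq hv h
  rw [ratio_scale hv]

lemma scale_injective {v : TotalSpace ℂ L} (hv : v.2 ≠ 0) : Injective fun c => scale c v :=
  fun c d h => by rw [← ratio_scale hv c, ← ratio_scale hv d]; exact congrArg (ratio v) h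

lemma ratio_ne_zero {v w : TotalSpace ℂ L} (hv : v.2 ≠ 0) (hw : w.2 ≠ 0) (h : w.proj = v.proj) :
    ratio v w ≠ 0 := by
  intro h0
  have h1 := scale_ratio hv h
  rw [h0] at h1
  rw [← h1] at hw
  exact hw (zero_smul ℂ v.2)

lemma ratio_eq_fibreCoord_div {q : Torus} {v w : TotalSpace ℂ L}
    (hb : v.proj ∈ (trivializationAt ℂ L q).baseSet) (hv : v.2 ≠ 0) (h : w.proj = v.proj) :
    ratio v w = fibreCoord q w / fibreCoord q v := by
  obtain ⟨c, rfl⟩ := exists_scale_eq hv h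
  rw [ratio_scale hv, fibreCoord_div_eq hb hv]

variable [VectorBundle ℝ ℂ L] [ContMDiffVectorBundle ∞ ℂ L IT]
  {E H M : Type*} [NormedAddCommGroup E] [NormedSpace ℝ E] [TopologicalSpace H]
  [TopologicalSpace M] [ChartedSpace H M] {I : ModelWithCorners ℝ E H}

omit [VectorBundle ℂ ℂ L] in
lemma contMDiffAt_fibreCoord {q : Torus} {v : TotalSpace ℂ L}
    (hb : v.proj ∈ (trivializationAt ℂ L q).baseSet) :
    ContMDiffAt IL 𝓘(ℝ, ℂ) ∞ (fibreCoord q) v := by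
  have h := (trivializationAt ℂ L q).contMDiffOn (n := ∞) (IB := IT)
  exact (h.contMDiffAt (((trivializationAt ℂ L q).open_source).mem_nhds
    ((trivializationAt ℂ L q).mem_source.2 hb))).snd

omit [VectorBundle ℂ ℂ L] in
lemma contMDiffAt_totalSpace_iff {f : M → TotalSpace ℂ L} {x : M} {q : Torus}
    (hb : (f x).proj ∈ (trivializationAt ℂ L q).baseSet) :
    ContMDiffAt I IL ∞ f x ↔ ContMDiffAt I IT ∞ (fun y => (f y).proj) x ∧
      ContMDiffAt I 𝓘(ℝ, ℂ) ∞ (fun y => fibreCoord q (f y)) x :=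
  (trivializationAt ℂ L q).contMDiffAt_iff ((trivializationAt ℂ L q).mem_source.2 hb)

lemma ContMDiffAt.scale {f : M → TotalSpace ℂ L} {c : M → ℂ} {x : M}
    (hc : ContMDiffAt I 𝓘(ℝ, ℂ) ∞ c x) (hf : ContMDiffAt I IL ∞ f x) :
    ContMDiffAt I IL ∞ (fun y => scale (c y) (f y)) x := by
  have hb : (f x).proj ∈ (trivializationAt ℂ L (f x).proj).baseSet :=
    mem_baseSet_trivializationAt ..
  rw [contMDiffAt_totalSpace_iff (q := (f x).proj) hb] at hf
  refine (contMDiffAt_totalSpace_iff (f := fun y => BoundaryFibration.scale (c y) (f y))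
    (q := (f x).proj) hb).2 ⟨hf.1, (ContMDiffAt.comp (g := fun p : ℂ × ℂ => p.1 * p.2)
    (I' := 𝓘(ℝ, ℂ × ℂ)) x
    (by fun_prop : ContDiff ℝ ∞ fun p : ℂ × ℂ => p.1 * p.2).contMDiff.contMDiffAt
    (hc.prodMk_space hf.2)).congr_of_eventuallyEq ?_⟩
  have h1 := hf.1.continuousAt.preimage_mem_nhds
    ((trivializationAt ℂ L (f x).proj).open_baseSet.mem_nhds hb)
  filter_upwards [h1] with y hy
  exact fibreCoord_smul hy _ _

lemma ContMDiffAt.ratio {f g : M → TotalSpace ℂ L} {x : M}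
    (hf : ContMDiffAt I IL ∞ f x) (hg : ContMDiffAt I IL ∞ g x) (h0 : ∀ᶠ y in 𝓝 x, (f y).2 ≠ 0)
    (h : ∀ᶠ y in 𝓝 x, (g y).proj = (f y).proj) :
    ContMDiffAt I 𝓘(ℝ, ℂ) ∞ (fun y => ratio (f y) (g y)) x := by
  have hb : (f x).proj ∈ (trivializationAt ℂ L (f x).proj).baseSet :=
    mem_baseSet_trivializationAt ..
  rw [contMDiffAt_totalSpace_iff (q := (f x).proj) (by simpa [h.self_of_nhds] using hb)] at hg
  rw [contMDiffAt_totalSpace_iff (q := (f x).proj) hb] at hf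
  have h1 : ContDiffAt ℝ ∞ (fun p : ℂ × ℂ => p.2 / p.1)
      (fibreCoord (f x).proj (f x), fibreCoord (f x).proj (g x)) := by
    have : fibreCoord (f x).proj (f x) ≠ 0 := fibreCoord_ne_zero hb h0.self_of_nhds
    simp only [div_eq_mul_inv]
    exact contDiffAt_snd.mul (contDiffAt_fst.inv this)
  refine (ContMDiffAt.comp (g := fun p : ℂ × ℂ => p.2 / p.1) (I' := 𝓘(ℝ, ℂ × ℂ)) x
    h1.contMDiffAt (hf.2.prodMk_space hg.2)).congr_of_eventuallyEq ?_
  have h2 := hf.1.continuousAt.preimage_mem_nhds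
    ((trivializationAt ℂ L (f x).proj).open_baseSet.mem_nhds hb)
  filter_upwards [h2, h0, h] with y hy hy0 hyp
  exact ratio_eq_fibreCoord_div hy hy0 hyp

end LineBundleAlgebra

/-! ### Cutoff functions and logarithms -/

/-- A smooth step function, equal to `0` on `(-∞, 1/3]` and to `1` on `[2/3, ∞)`. -/
def step (t : ℝ) : ℝ := Real.smoothTransition (3 * t - 1)

lemma step_of_le {t : ℝ} (h : t ≤ 1 / 3) : step t = 0 :=
  Real.smoothTransition.zero_of_nonpos (by linarith)

lemma step_of_ge {t : ℝ} (h : 2 / 3 ≤ t) : step t = 1 :=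
  Real.smoothTransition.one_of_one_le (by linarith)

lemma contDiff_step : ContDiff ℝ ∞ step :=
  Real.smoothTransition.contDiff.comp (by fun_prop : ContDiff ℝ ∞ fun t : ℝ => 3 * t - 1)

/-- The smooth function that agrees with `step` on `[0, 1]` and satisfies
`staircase (t + 1) = staircase t + 1`. -/
def staircase (t : ℝ) : ℝ := ⌊t⌋ + step (Int.fract t)

lemma staircase_add_one (t : ℝ) : staircase (t + 1) = staircase t + 1 := by
  simp [staircase]; ring

lemma floor_eq_or {t : ℝ} {m : ℤ} (h1 : m - 1 / 3 < t) (h2 : t < m + 1) :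
    ⌊t⌋ = m ∨ (⌊t⌋ = m - 1 ∧ t < m) := by
  rcases le_or_gt (m : ℝ) t with h | h
  · exact .inl (Int.floor_eq_iff.2 ⟨h, h2⟩)
  · exact .inr ⟨Int.floor_eq_iff.2 ⟨by push_cast; linarith, by push_cast; linarith⟩, h⟩

lemma staircase_eq {t : ℝ} {m : ℤ} (h1 : m - 1 / 3 < t) (h2 : t < m + 1) :
    staircase t = m + step (t - m) := by
  rcases floor_eq_or h1 h2 with h | ⟨h, h'⟩
  · simp [staircase, Int.fract, h]
  · rw [staircase, Int.fract, h, step_of_ge (by push_cast; linarith),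
      step_of_le (t := t - m) (by linarith)]
    push_cast; ring

lemma contDiff_staircase : ContDiff ℝ ∞ staircase := by
  rw [contDiff_iff_contDiffAt]
  intro t
  have h1 : ContDiff ℝ ∞ fun s : ℝ => (⌊t⌋ : ℝ) + step (s - ⌊t⌋) :=
    contDiff_const.add (contDiff_step.comp (contDiff_id.sub contDiff_const))
  refine h1.contDiffAt.congr_of_eventuallyEq ?_
  filter_upwards [Ioo_mem_nhds (show (⌊t⌋ : ℝ) - 1 / 3 < t by linarith [Int.floor_le t])
    (Int.lt_floor_add_one t)] with s hs
  exact staircase_eq hs.1 hs.2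

lemma staircase_eq_step {t : ℝ} (h0 : 0 ≤ t) (h1 : t ≤ 1) : staircase t = step t := by
  rcases h1.eq_or_lt with rfl | h1
  · simp [staircase, step_of_ge (by norm_num : (2 : ℝ) / 3 ≤ 1),
      step_of_le (by norm_num : (0 : ℝ) ≤ 1 / 3)]
  · have : ⌊t⌋ = 0 := Int.floor_eq_zero_iff.2 ⟨h0, h1⟩
    simp [staircase, Int.fract, this]

/-- A smooth nonvanishing function on a convex open set has a smooth logarithm, because `exp` is a
covering map. -/
lemma exists_smooth_log {V : Type*} [NormedAddCommGroup V] [NormedSpace ℝ V]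
    {W : Set V} (hW : IsOpen W) (hc : Convex ℝ W) {u : V → ℂ}
    (hu : ∀ p ∈ W, ContDiffAt ℝ ∞ u p) (h0 : ∀ p ∈ W, u p ≠ 0) :
    ∃ g : V → ℂ, ∀ p ∈ W, ContDiffAt ℝ ∞ g p ∧ Complex.exp (g p) = u p := by
  classical
  rcases W.eq_empty_or_nonempty with rfl | ⟨p₀, hp₀⟩
  · exact ⟨0, by simp⟩
  have : ContractibleSpace W := hc.contractibleSpace ⟨p₀, hp₀⟩
  have : LocallyPathConnectedSpace W := hW.locallyPathConnectedSpace
  have huc : ContinuousOn u W := fun p hp => (hu p hp).continuousAt.continuousWithinAt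
  obtain ⟨F, ⟨-, hF⟩, -⟩ := Complex.isCoveringMapOn_exp.existsUnique_continuousMap_lifts
    (⟨fun p : W => u p, huc.domRestrict⟩ : C(W, ℂ)) (a₀ := ⟨p₀, hp₀⟩) (e₀ := Complex.log (u p₀))
    (Complex.exp_log (h0 _ hp₀)) (fun p => h0 _ p.2)
  have hF' : ∀ p : W, Complex.exp (F p) = u p := fun p => congrFun hF p
  let g : V → ℂ := fun p => if hp : p ∈ W then F ⟨p, hp⟩ else 0
  have hg : ∀ p (hp : p ∈ W), g p = F ⟨p, hp⟩ := fun p hp => dif_pos hp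
  have hge : ∀ p ∈ W, Complex.exp (g p) = u p := fun p hp => by rw [hg p hp, hF']
  have hgc : ContinuousOn g W := by
    rw [continuousOn_iff_continuous_domRestrict]
    convert F.continuous using 1
    ext p; exact hg p p.2
  refine ⟨g, fun p hp => ⟨?_, hge p hp⟩⟩
  -- Near `p`, the logarithm is `g p + log (u / u p)`, by continuity.
  have h1 : ContDiffAt ℝ ∞ (fun q => g p + Complex.log (u q / u p)) p := by
    have h3 : ContDiffAt ℂ ∞ Complex.log (u p / u p) :=
      Complex.contDiffAt_log (by rw [div_self (h0 p hp)]; exact Complex.one_mem_slitPlane)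
    have h3' : ContDiffAt ℝ ∞ (fun q => u q / u p) p := (hu p hp).div_const _
    exact contDiffAt_const.add
      (ContDiffAt.comp (f := fun q => u q / u p) p (h3.restrict_scalars ℝ) h3')
  refine h1.congr_of_eventuallyEq ?_
  have h4 : ContinuousAt (fun q => g q - g p) p :=
    (hgc.continuousAt (hW.mem_nhds hp)).sub continuousAt_const
  have h5 : ∀ᶠ q in 𝓝 p, ‖g q - g p‖ < Real.pi := by
    have : ∀ᶠ q in 𝓝 p, (g q - g p) ∈ Metric.ball (0 : ℂ) Real.pi :=
      h4.eventually_mem (by simpa using Metric.ball_mem_nhds (0 : ℂ) Real.pi_pos)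
    simpa using this
  filter_upwards [h5, hW.mem_nhds hp] with q hq hqW
  have h6 : u q / u p = Complex.exp (g q - g p) := by rw [Complex.exp_sub, hge q hqW, hge p hp]
  have h7 := (abs_le.1 (Complex.abs_im_le_norm (g q - g p)))
  rw [h6, Complex.log_exp (by linarith) (by linarith)]
  ring

/-! ### Frames over the universal cover of the torus -/

/-- The universal covering `ℝ² → T²`. -/
def cover (p : ℝ × ℝ) : Torus := (circ p.1, circ p.2)

lemma contMDiff_cover : ContMDiff 𝓘(ℝ, ℝ × ℝ) IT ∞ cover :=
  (contMDiff_circ.comp contDiff_fst.contMDiff).prodMk (contMDiff_circ.comp contDiff_snd.contMDiff)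

lemma exists_cover_eq (q : Torus) : ∃ p, cover p = q := by
  obtain ⟨x, hx⟩ := exists_circ_eq q.1
  obtain ⟨y, hy⟩ := exists_circ_eq q.2
  exact ⟨(x, y), Prod.ext hx hy⟩

section Frames

variable {L : Torus → Type*} [∀ q, AddCommGroup (L q)] [∀ q, Module ℂ (L q)]
  [∀ q, TopologicalSpace (L q)] [TopologicalSpace (TotalSpace ℂ L)] [FiberBundle ℂ L]

/-- `S` is a smooth frame, over the set `W`, of the pull-back of `L` to the universal cover of the
torus. It is encoded as a lift to `Tot(L)` of the covering map. -/
structure IsFrameOn (S : ℝ × ℝ → TotalSpace ℂ L) (W : Set (ℝ × ℝ)) : Prop where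
  smooth : ∀ p ∈ W, ContMDiffAt 𝓘(ℝ, ℝ × ℝ) IL ∞ S p
  proj : ∀ p ∈ W, (S p).proj = cover p
  ne_zero : ∀ p ∈ W, (S p).2 ≠ 0

omit [∀ q, Module ℂ (L q)] in
lemma IsFrameOn.mono {S : ℝ × ℝ → TotalSpace ℂ L} {W W' : Set (ℝ × ℝ)} (h : IsFrameOn S W)
    (hW : W' ⊆ W) : IsFrameOn S W' :=
  ⟨fun p hp => h.smooth p (hW hp), fun p hp => h.proj p (hW hp), fun p hp => h.ne_zero p (hW hp)⟩

variable [VectorBundle ℂ ℂ L] [VectorBundle ℝ ℂ L] [ContMDiffVectorBundle ∞ ℂ L IT]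

/-- Two frames over a convex open set differ by the exponential of a smooth function. -/
lemma exists_log_ratio {S₁ S₂ : ℝ × ℝ → TotalSpace ℂ L} {W : Set (ℝ × ℝ)} (h₁ : IsFrameOn S₁ W)
    (h₂ : IsFrameOn S₂ W) (hW : IsOpen W) (hc : Convex ℝ W) :
    ∃ g : ℝ × ℝ → ℂ, ∀ p ∈ W, ContDiffAt ℝ ∞ g p ∧ scale (Complex.exp (g p)) (S₁ p) = S₂ p := by
  obtain ⟨g, hg⟩ := exists_smooth_log hW hc (u := fun p => ratio (S₁ p) (S₂ p))
    (fun p hp => by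
      rw [← contMDiffAt_iff_contDiffAt]
      refine ContMDiffAt.ratio (h₁.smooth p hp) (h₂.smooth p hp) ?_ ?_
      · filter_upwards [hW.mem_nhds hp] with q hq using h₁.ne_zero q hq
      · filter_upwards [hW.mem_nhds hp] with q hq
        rw [h₁.proj q hq, h₂.proj q hq])
    (fun p hp => ratio_ne_zero (h₁.ne_zero p hp) (h₂.ne_zero p hp)
      (by rw [h₁.proj p hp, h₂.proj p hp]))
  refine ⟨g, fun p hp => ⟨(hg p hp).1, ?_⟩⟩
  rw [(hg p hp).2, scale_ratio (h₁.ne_zero p hp) (by rw [h₁.proj p hp, h₂.proj p hp])]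

lemma contMDiffAt_scale_exp {S : ℝ × ℝ → TotalSpace ℂ L} {p : ℝ × ℝ} {χ : ℝ × ℝ → ℝ}
    {g : ℝ × ℝ → ℂ} (hS : ContMDiffAt 𝓘(ℝ, ℝ × ℝ) IL ∞ S p) (hχ : ContDiffAt ℝ ∞ χ p)
    (hg : ContDiffAt ℝ ∞ g p) :
    ContMDiffAt 𝓘(ℝ, ℝ × ℝ) IL ∞ (fun q => scale (Complex.exp (χ q * g q)) (S q)) p := by
  refine ContMDiffAt.scale (ContDiffAt.contMDiffAt ?_) hS
  have : ContDiffAt ℝ ∞ (fun q => (χ q : ℂ)) p := Complex.ofRealCLM.contDiff.contDiffAt.comp p hχ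
  exact (this.mul hg).cexp

/-- Two frames over open sets with convex intersection can be glued, if the intersection separates
the union in the direction of a function `ℓ`. -/
lemma exists_frame_union {S₁ S₂ : ℝ × ℝ → TotalSpace ℂ L} {W₁ W₂ : Set (ℝ × ℝ)}
    (h₁ : IsFrameOn S₁ W₁) (h₂ : IsFrameOn S₂ W₂) (hW₁ : IsOpen W₁) (hW₂ : IsOpen W₂)
    (hc : Convex ℝ (W₁ ∩ W₂)) {ℓ : ℝ × ℝ → ℝ} (hℓ : ContDiff ℝ ∞ ℓ) {a b : ℝ} (hab : a < b)
    (hb : ∀ p ∈ W₁ ∪ W₂, ℓ p < b → p ∈ W₁) (ha : ∀ p ∈ W₁ ∪ W₂, a < ℓ p → p ∈ W₂) :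
    ∃ S : ℝ × ℝ → TotalSpace ℂ L, IsFrameOn S (W₁ ∪ W₂) := by
  classical
  obtain ⟨g, hg⟩ := exists_log_ratio (h₁.mono inter_subset_left) (h₂.mono inter_subset_right)
    (hW₁.inter hW₂) hc
  let χ : ℝ × ℝ → ℝ := fun p => step ((ℓ p - a) / (b - a))
  have hba : 0 < b - a := sub_pos.2 hab
  have hχ : ContDiff ℝ ∞ χ := contDiff_step.comp ((hℓ.sub contDiff_const).div_const _)
  have hχ0 : ∀ p, ℓ p ≤ a + (b - a) / 3 → χ p = 0 := fun p hp =>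
    step_of_le (by rw [div_le_div_iff₀ hba (by norm_num)]; linarith)
  have hχ1 : ∀ p, a + 2 * (b - a) / 3 ≤ ℓ p → χ p = 1 := fun p hp =>
    step_of_ge (by rw [div_le_div_iff₀ (by norm_num) hba]; linarith)
  let S : ℝ × ℝ → TotalSpace ℂ L := fun p =>
    if ℓ p < b then scale (Complex.exp (χ p * g p)) (S₁ p) else S₂ p
  have e1 : ∀ p, ℓ p < a + (b - a) / 3 → S p = S₁ p := fun p hp => by
    simp [S, hχ0 p hp.le, show ℓ p < b by linarith]
  have e2 : ∀ p ∈ W₁ ∪ W₂, a + 2 * (b - a) / 3 < ℓ p → S p = S₂ p := fun p hpW hp => by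
    by_cases h : ℓ p < b
    · have := hg p ⟨hb p hpW h, ha p hpW (by linarith)⟩
      simp [S, hχ1 p hp.le, h, this.2]
    · simp [S, h]
  have e3 : ∀ p, ℓ p < b → S p = scale (Complex.exp (χ p * g p)) (S₁ p) := fun p hp => if_pos hp
  have hWo := (hW₁.union hW₂)
  refine ⟨S, ?_, ?_, ?_⟩
  · intro p hp
    rcases lt_or_ge (ℓ p) (a + (b - a) / 3) with h | h
    · refine (h₁.smooth p (hb p hp (by linarith))).congr_of_eventuallyEq ?_
      filter_upwards [(isOpen_Iio.preimage hℓ.continuous).mem_nhds h] with q hq using e1 q hq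
    rcases lt_or_ge (a + 2 * (b - a) / 3) (ℓ p) with h' | h'
    · refine (h₂.smooth p (ha p hp (by linarith))).congr_of_eventuallyEq ?_
      filter_upwards [(isOpen_Ioi.preimage hℓ.continuous).mem_nhds h', hWo.mem_nhds hp]
        with q hq hqW
      exact e2 q hqW hq
    · have hp12 : p ∈ W₁ ∩ W₂ := ⟨hb p hp (by linarith), ha p hp (by linarith)⟩
      refine (contMDiffAt_scale_exp (h₁.smooth p hp12.1) hχ.contDiffAt
        (hg p hp12).1).congr_of_eventuallyEq ?_
      filter_upwards [(isOpen_Iio.preimage hℓ.continuous).mem_nhds (show ℓ p < b by linarith)]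
        with q hq using e3 q hq
  · intro p hp
    by_cases h : ℓ p < b
    · rw [e3 p h, scale_proj, h₁.proj p (hb p hp h)]
    · rw [e2 p hp (by linarith), h₂.proj p (ha p hp (by linarith))]
  · intro p hp
    by_cases h : ℓ p < b
    · rw [e3 p h]
      exact scale_snd_ne_zero (Complex.exp_ne_zero _) (h₁.ne_zero p (hb p hp h))
    · rw [e2 p hp (by linarith)]
      exact h₂.ne_zero p (ha p hp (by linarith))

/-- There are frames over all squares of a fixed small size, by compactness of the torus. -/
lemma exists_frame_ball : ∃ δ > 0, ∀ p : ℝ × ℝ, ∃ S : ℝ × ℝ → TotalSpace ℂ L,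
    IsFrameOn S (Metric.ball p δ) := by
  have hlocal : ∀ q : Torus, ∃ S : ℝ × ℝ → TotalSpace ℂ L,
      IsFrameOn S (cover ⁻¹' (trivializationAt ℂ L q).baseSet) := by
    intro q
    let e := trivializationAt ℂ L q
    have hmem : ∀ p, cover p ∈ e.baseSet → (cover p, (1 : ℂ)) ∈ e.target := fun p hp =>
      e.mem_target.2 hp
    refine ⟨fun p => e.toOpenPartialHomeomorph.symm (cover p, 1), fun p hp => ?_, fun p hp =>
      e.proj_symm_apply (hmem p hp), fun p hp h0 => ?_⟩
    · have h1 := (e.contMDiffOn_symm (n := ∞) (IB := IT)).contMDiffAt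
        (e.open_target.mem_nhds (hmem p hp))
      exact ContMDiffAt.comp (g := e.toOpenPartialHomeomorph.symm) p h1
        (contMDiff_cover.contMDiffAt.prodMk contMDiffAt_const)
    · have h1 : e (e.toOpenPartialHomeomorph.symm (cover p, 1)) = (cover p, 1) :=
        e.apply_symm_apply (hmem p hp)
      have h2 : fibreCoord q (e.toOpenPartialHomeomorph.symm (cover p, 1)) = 1 :=
        congrArg Prod.snd h1
      have h3 : (e.toOpenPartialHomeomorph.symm (cover p, 1)).proj ∈ e.baseSet := by
        rw [e.proj_symm_apply (hmem p hp)]; exact hp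
      have h4 := fibreCoord_zero (L := L) (q := q) h3
      have h5 : e.toOpenPartialHomeomorph.symm (cover p, 1) =
          ⟨(e.toOpenPartialHomeomorph.symm (cover p, 1)).proj, 0⟩ :=
        congrArg (TotalSpace.mk _) h0
      rw [← h5, h2] at h4
      exact one_ne_zero h4
  have hcover : Continuous cover := contMDiff_cover.continuous
  obtain ⟨δ, hδ, h⟩ := lebesgue_number_lemma_of_metric
    (c := fun q : Torus => cover ⁻¹' (trivializationAt ℂ L q).baseSet)
    ((isCompact_Icc (a := (0 : ℝ)) (b := 1)).prod (isCompact_Icc (a := (0 : ℝ)) (b := 1)))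
    (fun q => (trivializationAt ℂ L q).open_baseSet.preimage hcover)
    (fun p _ => mem_iUnion.2 ⟨cover p, mem_baseSet_trivializationAt ..⟩)
  refine ⟨δ, hδ, fun p => ?_⟩
  obtain ⟨q, hq⟩ := h (Int.fract p.1, Int.fract p.2)
    ⟨⟨Int.fract_nonneg _, (Int.fract_lt_one _).le⟩, ⟨Int.fract_nonneg _, (Int.fract_lt_one _).le⟩⟩
  obtain ⟨S, hS⟩ := hlocal q
  refine ⟨S, hS.mono fun p' hp' => ?_⟩
  have h1 : cover p' = cover (p' - ((⌊p.1⌋ : ℝ), (⌊p.2⌋ : ℝ))) := by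
    simp [cover, circ_sub]
  rw [mem_preimage, h1]
  refine hq ?_
  rw [Metric.mem_ball, dist_eq_norm] at hp' ⊢
  have h2 : p' - ((⌊p.1⌋ : ℝ), (⌊p.2⌋ : ℝ)) - (Int.fract p.1, Int.fract p.2) = p' - p := by
    ext <;> simp only [Prod.fst_sub, Prod.snd_sub, ← Int.self_sub_floor] <;> ring
  rwa [h2]

/-- Small squares are glued to thin horizontal strips, and these to a large square. -/
lemma exists_frame_square : ∃ S : ℝ × ℝ → TotalSpace ℂ L,
    IsFrameOn S (Ioo (-1) 2 ×ˢ Ioo (-1) 2) := by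
  obtain ⟨δ, hδ, hball⟩ := exists_frame_ball (L := L)
  have hrow : ∀ (n : ℕ) (y : ℝ), ∃ S : ℝ × ℝ → TotalSpace ℂ L,
      IsFrameOn S (Ioo (-1) (-1 + (n + 1) * δ) ×ˢ Ioo (y - δ) (y + δ)) := by
    intro n y
    induction n with
    | zero =>
      obtain ⟨S, hS⟩ := hball (-1, y)
      refine ⟨S, hS.mono fun p hp => ?_⟩
      rw [← ball_prod_same, Real.ball_eq_Ioo, Real.ball_eq_Ioo]
      simp only [mem_prod, mem_Ioo, CharP.cast_eq_zero] at hp ⊢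
      exact ⟨⟨by linarith [hp.1.1], by linarith [hp.1.2]⟩, hp.2⟩
    | succ n ih =>
      obtain ⟨S₁, h₁⟩ := ih
      obtain ⟨S₂, h₂⟩ := hball (-1 + (n + 1) * δ, y)
      rw [← ball_prod_same, Real.ball_eq_Ioo, Real.ball_eq_Ioo] at h₂
      have hn : 0 ≤ n * δ := by positivity
      obtain ⟨S, hS⟩ := exists_frame_union h₁ h₂ (isOpen_Ioo.prod isOpen_Ioo)
        (isOpen_Ioo.prod isOpen_Ioo) (by
          rw [prod_inter_prod, Ioo_inter_Ioo, Ioo_inter_Ioo]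
          exact (convex_Ioo _ _).prod (convex_Ioo _ _)) contDiff_fst
        (a := -1 + n * δ) (b := -1 + (n + 1) * δ) (by linarith)
        (by
          rintro p (hp | hp) h
          · exact hp
          · simp only [mem_prod, mem_Ioo] at hp ⊢
            exact ⟨⟨by linarith [hp.1.1], h⟩, hp.2⟩)
        (by
          rintro p (hp | hp) h
          · simp only [mem_prod, mem_Ioo] at hp ⊢
            exact ⟨⟨by linarith, by linarith [hp.1.2]⟩, hp.2⟩
          · exact hp)
      refine ⟨S, hS.mono fun p hp => ?_⟩
      simp only [mem_union, mem_prod, mem_Ioo] at hp ⊢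
      push_cast at hp
      rcases lt_or_ge p.1 (-1 + (n + 1) * δ) with h | h
      · exact .inl ⟨⟨hp.1.1, h⟩, hp.2⟩
      · exact .inr ⟨⟨by linarith, by linarith [hp.1.2]⟩, hp.2⟩
  obtain ⟨N, hN⟩ := exists_nat_gt (3 / δ)
  have hN' : 3 < N * δ := by rwa [div_lt_iff₀ hδ] at hN
  have hcol : ∀ n : ℕ, ∃ S : ℝ × ℝ → TotalSpace ℂ L,
      IsFrameOn S (Ioo (-1) 2 ×ˢ Ioo (-1) (-1 + (n + 1) * δ)) := by
    have hrow' : ∀ y, ∃ S : ℝ × ℝ → TotalSpace ℂ L,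
        IsFrameOn S (Ioo (-1) 2 ×ˢ Ioo (y - δ) (y + δ)) := fun y => by
      obtain ⟨S, hS⟩ := hrow N y
      exact ⟨S, hS.mono (prod_mono (Ioo_subset_Ioo_right (by linarith)) subset_rfl)⟩
    intro n
    induction n with
    | zero =>
      obtain ⟨S, hS⟩ := hrow' (-1)
      refine ⟨S, hS.mono (prod_mono subset_rfl fun y hy => ?_)⟩
      simp only [mem_Ioo, CharP.cast_eq_zero] at hy ⊢
      exact ⟨by linarith [hy.1], by linarith [hy.2]⟩
    | succ n ih =>
      obtain ⟨S₁, h₁⟩ := ih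
      obtain ⟨S₂, h₂⟩ := hrow' (-1 + (n + 1) * δ)
      have hn : 0 ≤ n * δ := by positivity
      obtain ⟨S, hS⟩ := exists_frame_union h₁ h₂ (isOpen_Ioo.prod isOpen_Ioo)
        (isOpen_Ioo.prod isOpen_Ioo) (by
          rw [prod_inter_prod, Ioo_inter_Ioo, Ioo_inter_Ioo]
          exact (convex_Ioo _ _).prod (convex_Ioo _ _)) contDiff_snd
        (a := -1 + n * δ) (b := -1 + (n + 1) * δ) (by linarith)
        (by
          rintro p (hp | hp) h
          · exact hp
          · simp only [mem_prod, mem_Ioo] at hp ⊢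
            exact ⟨hp.1, by linarith [hp.2.1], h⟩)
        (by
          rintro p (hp | hp) h
          · simp only [mem_prod, mem_Ioo] at hp ⊢
            exact ⟨hp.1, by linarith, by linarith [hp.2.2]⟩
          · exact hp)
      refine ⟨S, hS.mono fun p hp => ?_⟩
      simp only [mem_union, mem_prod, mem_Ioo] at hp ⊢
      push_cast at hp
      rcases lt_or_ge p.2 (-1 + (n + 1) * δ) with h | h
      · exact .inl ⟨hp.1, hp.2.1, h⟩
      · exact .inr ⟨hp.1, by linarith, by linarith [hp.2.2]⟩
  obtain ⟨S, hS⟩ := hcol N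
  exact ⟨S, hS.mono (prod_mono subset_rfl (Ioo_subset_Ioo_right (by linarith)))⟩

/-! ### Quasi-periodic frames -/

lemma cover_add_smul {e : ℝ × ℝ} (he : cover e = 1) (p : ℝ × ℝ) (m : ℤ) :
    cover (p + (m : ℝ) • e) = cover p := by
  have h1 : circ e.1 = 1 := congrArg Prod.fst he
  have h2 : circ e.2 = 1 := congrArg Prod.snd he
  simp [cover, circ_add, circ_zsmul, h1, h2]

/-- A frame over a strip can be modified to become periodic in a direction `e` transverse to the
strip: on the overlap of the strip with its translate, the translated frame is `exp g` times the
frame, and the factor `exp (step · g)` interpolates between the two. -/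
lemma exists_periodic_frame {e : ℝ × ℝ} (he : cover e = 1) {ℓ : (ℝ × ℝ) →L[ℝ] ℝ} (hℓ : ℓ e = 1)
    {K : Set (ℝ × ℝ)} (hK : IsOpen K) (hKc : Convex ℝ K) (hKe : ∀ p ∈ K, ∀ t : ℝ, p + t • e ∈ K)
    {S : ℝ × ℝ → TotalSpace ℂ L} (hS : IsFrameOn S (ℓ ⁻¹' Ioo (-1) 2 ∩ K)) :
    ∃ (g : ℝ × ℝ → ℂ) (S' : ℝ × ℝ → TotalSpace ℂ L),
      (∀ p ∈ ℓ ⁻¹' Ioo 0 2 ∩ K, ContDiffAt ℝ ∞ g p ∧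
        scale (Complex.exp (g p)) (S p) = S (p - e)) ∧
      IsFrameOn S' K ∧ ∀ p, S' p =
        scale (Complex.exp (step (Int.fract (ℓ p)) * g (p - (⌊ℓ p⌋ : ℝ) • e)))
          (S (p - (⌊ℓ p⌋ : ℝ) • e)) := by
  have hWo : IsOpen (ℓ ⁻¹' Ioo 0 2 ∩ K) := (isOpen_Ioo.preimage ℓ.continuous).inter hK
  have hWc : Convex ℝ (ℓ ⁻¹' Ioo 0 2 ∩ K) :=
    ((convex_Ioo 0 2).is_linear_preimage ℓ.toLinearMap.isLinear).inter hKc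
  have hsub : ℓ ⁻¹' Ioo 0 2 ∩ K ⊆ ℓ ⁻¹' Ioo (-1) 2 ∩ K :=
    inter_subset_inter_left _ (preimage_mono (Ioo_subset_Ioo_left (by norm_num)))
  have hmem : ∀ p ∈ ℓ ⁻¹' Ioo 0 2 ∩ K, p - e ∈ ℓ ⁻¹' Ioo (-1) 2 ∩ K := by
    rintro p ⟨⟨h1, h2⟩, h3⟩
    refine ⟨?_, by simpa [sub_eq_add_neg] using hKe p h3 (-1)⟩
    simp only [mem_preimage, map_sub, hℓ, mem_Ioo]
    constructor <;> linarith
  have hcov : ∀ p, cover (p - e) = cover p := fun p => by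
    simpa [sub_eq_add_neg] using cover_add_smul he p (-1)
  have hS2 : IsFrameOn (fun p => S (p - e)) (ℓ ⁻¹' Ioo 0 2 ∩ K) := by
    refine ⟨fun p hp => ?_, fun p hp => by rw [hS.proj _ (hmem p hp), hcov],
      fun p hp => hS.ne_zero _ (hmem p hp)⟩
    exact ContMDiffAt.comp (g := S) p (hS.smooth _ (hmem p hp))
      (by fun_prop : ContDiffAt ℝ ∞ (fun p : ℝ × ℝ => p - e) p).contMDiffAt
  obtain ⟨g, hg⟩ := exists_log_ratio (hS.mono hsub) hS2 hWo hWc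
  let S₁ : ℝ × ℝ → TotalSpace ℂ L := fun p => scale (Complex.exp (step (ℓ p) * g p)) (S p)
  have e0 : ∀ p, ℓ p ≤ 1 / 3 → S₁ p = S p := fun p hp => by simp [S₁, step_of_le hp]
  have hstep : ContDiff ℝ ∞ fun p => step (ℓ p) := contDiff_step.comp ℓ.contDiff
  have hS₁ : IsFrameOn S₁ (ℓ ⁻¹' Ioo (-1) 2 ∩ K) := by
    refine ⟨fun p hp => ?_, fun p hp => hS.proj p hp, fun p hp =>
      scale_snd_ne_zero (Complex.exp_ne_zero _) (hS.ne_zero p hp)⟩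
    rcases lt_or_ge (ℓ p) (1 / 3) with h | h
    · refine (hS.smooth p hp).congr_of_eventuallyEq ?_
      filter_upwards [(isOpen_Iio.preimage ℓ.continuous).mem_nhds h]
        with q hq using e0 q (le_of_lt hq)
    · exact contMDiffAt_scale_exp (hS.smooth p hp) hstep.contDiffAt
        (hg p ⟨⟨by linarith, hp.1.2⟩, hp.2⟩).1
  -- `S₁` is periodic where both `p` and `p - e` lie in the strip.
  have hper : ∀ p ∈ K, 2 / 3 < ℓ p → ℓ p < 4 / 3 → S₁ p = S₁ (p - e) := fun p hpK h1 h2 => by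
    rw [e0 (p - e) (by rw [map_sub, hℓ]; linarith), ← (hg p ⟨⟨by linarith, by linarith⟩, hpK⟩).2]
    simp [S₁, step_of_ge h1.le]
  let S' : ℝ × ℝ → TotalSpace ℂ L := fun p => S₁ (p - (⌊ℓ p⌋ : ℝ) • e)
  have hK' : ∀ p ∈ K, ∀ m : ℤ, p - (m : ℝ) • e ∈ K := fun p hp m => by
    simpa [sub_eq_add_neg] using hKe p hp (-m)
  have hS' : ∀ (m : ℤ) (p), p ∈ K → m - 1 / 3 < ℓ p → ℓ p < m + 1 →
      S' p = S₁ (p - (m : ℝ) • e) := by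
    intro m p hp h1 h2
    rcases floor_eq_or h1 h2 with h | ⟨h, h'⟩
    · simp only [S', h]
    · have h3 : p - ((m - 1 : ℤ) : ℝ) • e - e = p - (m : ℝ) • e := by
        push_cast; module
      have h4 : ℓ (p - ((m - 1 : ℤ) : ℝ) • e) = ℓ p - m + 1 := by
        simp [hℓ]; ring
      simp only [S', h]
      rw [hper _ (hK' p hp _) (by rw [h4]; linarith) (by rw [h4]; linarith), h3]
  have hstrip : ∀ p ∈ K, p - (⌊ℓ p⌋ : ℝ) • e ∈ ℓ ⁻¹' Ioo (-1) 2 ∩ K := fun p hp => by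
    refine ⟨?_, hK' p hp _⟩
    have h1 := Int.floor_le (ℓ p)
    have h2 := Int.lt_floor_add_one (ℓ p)
    simp only [mem_preimage, map_sub, map_smul, hℓ, smul_eq_mul, mul_one, mem_Ioo]
    constructor <;> linarith
  refine ⟨g, S', hg, ⟨fun p hp => ?_, fun p hp => ?_, fun p hp => hS₁.ne_zero _ (hstrip p hp)⟩,
    fun p => ?_⟩
  · have h1 : ContMDiffAt 𝓘(ℝ, ℝ × ℝ) IL ∞ (fun q => S₁ (q - (⌊ℓ p⌋ : ℝ) • e)) p :=
      ContMDiffAt.comp (g := S₁) p (hS₁.smooth _ (hstrip p hp))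
        (by fun_prop : ContDiffAt ℝ ∞ (fun q : ℝ × ℝ => q - (⌊ℓ p⌋ : ℝ) • e) p).contMDiffAt
    refine h1.congr_of_eventuallyEq ?_
    have h2 := Int.floor_le (ℓ p)
    have h3 := Int.lt_floor_add_one (ℓ p)
    filter_upwards [(isOpen_Ioo.preimage ℓ.continuous).mem_nhds
      (show ℓ p ∈ Ioo ((⌊ℓ p⌋ : ℝ) - 1 / 3) (⌊ℓ p⌋ + 1) from ⟨by linarith, h3⟩),
      hK.mem_nhds hp] with q hq hqK
    exact hS' _ q hqK hq.1 hq.2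
  · rw [hS₁.proj _ (hstrip p hp)]
    simpa [sub_eq_add_neg] using cover_add_smul he p (-⌊ℓ p⌋)
  · simp [S', S₁, hℓ]

/-- The normal form of a complex line bundle over the torus: it has a frame over `ℝ²` that is
periodic in the second variable, and is multiplied by the loop `y ↦ e^{2πik·staircase(y)}` under
translation by one in the first variable. -/
lemma exists_quasiperiodic_frame : ∃ (k : ℤ) (S : ℝ × ℝ → TotalSpace ℂ L),
    IsFrameOn S univ ∧ (∀ x y, S (x, y + 1) = S (x, y)) ∧
    ∀ x y, S (x + 1, y) = scale (circ (k * staircase y)) (S (x, y)) := by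
  obtain ⟨S₀, h₀⟩ := exists_frame_square (L := L)
  have hc1 : cover (1, 0) = 1 := by simp [cover]
  have hc2 : cover (0, 1) = 1 := by simp [cover]
  obtain ⟨g₁, S₁, -, hS₁, hS₁'⟩ := exists_periodic_frame (K := Prod.snd ⁻¹' Ioo (-1) 2)
    (ℓ := ContinuousLinearMap.fst ℝ ℝ ℝ) hc1 rfl
    (isOpen_Ioo.preimage continuous_snd)
    ((convex_Ioo _ _).is_linear_preimage (LinearMap.snd ℝ ℝ ℝ).isLinear)
    (fun p hp t => by simpa using hp) (S := S₀) (h₀.mono fun p hp => hp)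
  have hp1 : ∀ p, S₁ (p + (1, 0)) = S₁ p := fun p => by
    have : p + (1, 0) - ((⌊p.1⌋ + 1 : ℝ)) • ((1, 0) : ℝ × ℝ) =
        p - (⌊p.1⌋ : ℝ) • ((1, 0) : ℝ × ℝ) := by
      module
    rw [hS₁', hS₁' p]
    simp only [ContinuousLinearMap.coe_fst', Prod.fst_add, Int.floor_add_one, Int.fract_add_one,
      Int.cast_add, Int.cast_one, this]
  obtain ⟨g, S, hg, hS, hS'⟩ := exists_periodic_frame (K := univ)
    (ℓ := ContinuousLinearMap.snd ℝ ℝ ℝ) hc2 rfl isOpen_univ convex_univ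
    (fun _ _ _ => trivial) (S := S₁) (hS₁.mono fun p hp => hp.1)
  have hmem : ∀ p : ℝ × ℝ, p.2 ∈ Ioo (0 : ℝ) 2 →
      p ∈ (ContinuousLinearMap.snd ℝ ℝ ℝ) ⁻¹' Ioo 0 2 ∩ univ := fun p hp => ⟨hp, trivial⟩
  -- The logarithm `g` changes by a constant multiple of `2πi` under translation by `(1, 0)`.
  have hk : ∃ k : ℤ, ∀ p : ℝ × ℝ, p.2 ∈ Ioo (0 : ℝ) 2 →
      g (p + (1, 0)) - g p = 2 * Real.pi * Complex.I * k := by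
    have hd : ∀ p : ℝ × ℝ, p.2 ∈ Ioo (0 : ℝ) 2 → ∃ m : ℤ,
        g (p + (1, 0)) - g p = 2 * Real.pi * Complex.I * m := fun p hp => by
      have h1 := (hg p (hmem p hp)).2
      have h2 := (hg (p + (1, 0)) (hmem _ (by simpa using hp))).2
      rw [hp1, show p + (1, 0) - (0, 1) = (p - (0, 1)) + (1, 0) by module, hp1, ← h1] at h2
      have h3 := scale_injective (hS₁.ne_zero p ⟨by linarith [hp.1], hp.2⟩) h2
      obtain ⟨m, hm⟩ := Complex.exp_eq_exp_iff_exists_int.1 h3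
      exact ⟨m, by rw [hm]; ring⟩
    have hcont : ContinuousOn (fun p => g (p + (1, 0)) - g p) {p | p.2 ∈ Ioo (0 : ℝ) 2} := by
      intro p hp
      have c1 := ((hg p (hmem p hp)).1).continuousAt
      have c2 := ((hg (p + (1, 0)) (hmem _ (by simpa using hp))).1).continuousAt
      exact ((ContinuousAt.comp (g := g) (f := fun p => p + (1, 0)) c2 (by fun_prop)).sub
        c1).continuousWithinAt
    have hconn : IsPreconnected {p : ℝ × ℝ | p.2 ∈ Ioo (0 : ℝ) 2} :=
      ((convex_Ioo (0 : ℝ) 2).is_linear_preimage (LinearMap.snd ℝ ℝ ℝ).isLinear).isPreconnected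
    let T : Set ℂ := (AddSubgroup.zmultiples (2 * Real.pi * Complex.I) : Set ℂ)
    have : DiscreteTopology T := NormedSpace.discreteTopology_zmultiples _
    have hT : MapsTo (fun p => g (p + (1, 0)) - g p) {p | p.2 ∈ Ioo (0 : ℝ) 2} T := fun p hp => by
      obtain ⟨m, hm⟩ := hd p hp
      exact ⟨m, by simp [hm]; ring⟩
    obtain ⟨k, hk⟩ := hd (0, 1) ⟨by norm_num, by norm_num⟩
    exact ⟨k, fun p hp => (hconn.constant_of_mapsTo ⟨this⟩ hcont hT hp
      (show ((0 : ℝ), (1 : ℝ)) ∈ {p : ℝ × ℝ | p.2 ∈ Ioo (0 : ℝ) 2} from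
        ⟨by norm_num, by norm_num⟩)).trans hk⟩
  obtain ⟨k, hk⟩ := hk
  refine ⟨k, S, hS, fun x y => ?_, fun x y => ?_⟩
  · have : ((x, y + 1) : ℝ × ℝ) - ((⌊y⌋ + 1 : ℝ)) • ((0, 1) : ℝ × ℝ) =
        (x, y) - (⌊y⌋ : ℝ) • ((0, 1) : ℝ × ℝ) := by
      ext <;> simp
    rw [hS', hS' (x, y)]
    simp only [ContinuousLinearMap.coe_snd', Int.floor_add_one, Int.cast_add, Int.cast_one, this,
      Int.fract_add_one]
  · have h1 : ((x + 1, y) : ℝ × ℝ) - (⌊y⌋ : ℝ) • ((0, 1) : ℝ × ℝ) =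
        ((x, y) - (⌊y⌋ : ℝ) • ((0, 1) : ℝ × ℝ)) + (1, 0) := by
      ext <;> simp
    have hexp : (circ (k * staircase y) : ℂ) =
        Complex.exp (step (Int.fract y) * (2 * Real.pi * Complex.I * k)) := by
      rw [staircase, mul_add, circ_add, ← Int.cast_mul, circ_intCast, one_mul, coe_circ]
      congr 1; push_cast; ring
    rw [hS', hS' (x, y)]
    simp only [ContinuousLinearMap.coe_snd', h1, hp1, scale_scale, hexp, ← Complex.exp_add]
    congr 2
    rcases (Int.fract_nonneg y).eq_or_lt with h0 | h0
    · simp [← h0, step_of_le (show (0 : ℝ) ≤ 1 / 3 by norm_num)]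
    · have h2 := hk ((x, y) - (⌊y⌋ : ℝ) • ((0, 1) : ℝ × ℝ)) (by
        have : ((x, y) - (⌊y⌋ : ℝ) • ((0, 1) : ℝ × ℝ)).2 = Int.fract y := by simp
        rw [this]
        exact ⟨h0, (Int.fract_lt_one y).trans (by norm_num)⟩)
      rw [← h2]; ring

end Frames

/-! ### The coordinate vector fields -/

section Descent

variable {E H M : Type*} [NormedAddCommGroup E] [NormedSpace ℝ E] [TopologicalSpace H]
  [TopologicalSpace M] [ChartedSpace H M] {I : ModelWithCorners ℝ E H}

/-- The branch at `p₀` of the inverse of the universal covering of the torus. -/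
def coverLift (p₀ : ℝ × ℝ) (q : Torus) : ℝ × ℝ := (argLift p₀.1 q.1, argLift p₀.2 q.2)

lemma cover_coverLift (p₀ : ℝ × ℝ) (q : Torus) : cover (coverLift p₀ q) = q := by
  simp [cover, coverLift, circ_argLift]

lemma contMDiffAt_coverLift (p : ℝ × ℝ) :
    ContMDiffAt IT 𝓘(ℝ, ℝ × ℝ) ∞ (coverLift p) (cover p) := by
  have h1 : ContMDiffAt IT 𝓘(ℝ, ℝ) ∞ (fun q : Torus => argLift p.1 q.1) (cover p) :=
    ContMDiffAt.comp (g := argLift p.1) (cover p) (contMDiffAt_argLift (circ_mem_arc p.1))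
      contMDiffAt_fst
  have h2 : ContMDiffAt IT 𝓘(ℝ, ℝ) ∞ (fun q : Torus => argLift p.2 q.2) (cover p) :=
    ContMDiffAt.comp (g := argLift p.2) (cover p) (contMDiffAt_argLift (circ_mem_arc p.2))
      contMDiffAt_snd
  exact h1.prodMk_space h2

lemma contMDiff_of_comp_cover {f : Torus → M}
    (h : ContMDiff 𝓘(ℝ, ℝ × ℝ) I ∞ (fun p => f (cover p))) : ContMDiff IT I ∞ f := by
  intro q
  obtain ⟨p, rfl⟩ := exists_cover_eq q
  have h1 := ContMDiffAt.comp (g := fun p => f (cover p)) (cover p)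
    (h (coverLift p (cover p))) (contMDiffAt_coverLift p)
  refine h1.congr_of_eventuallyEq (Eventually.of_forall fun q => ?_)
  simp [cover_coverLift]

end Descent

lemma mdiff_cover (p : ℝ × ℝ) : MDifferentiableAt 𝓘(ℝ, ℝ × ℝ) IT cover p :=
  contMDiff_cover.mdifferentiableAt (by simp)

lemma dmap_cover (p v : ℝ × ℝ) : dmap 𝓘(ℝ, ℝ × ℝ) IT cover p v =
    (v.1 • circleVec (circ p.1), v.2 • circleVec (circ p.2)) := by
  have h1 : ∀ t : ℝ, ∀ v : ℝ, dmap 𝓘(ℝ, ℝ) (𝓡 1) circ t v = v • circleVec (circ t) := by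
    intro t v
    rw [circleVec_circ, ← map_smul, smul_eq_mul, mul_one]
  have hf : MDifferentiableAt 𝓘(ℝ, ℝ × ℝ) 𝓘(ℝ, ℝ) (Prod.fst : ℝ × ℝ → ℝ) p :=
    differentiableAt_fst.mdifferentiableAt
  have hs : MDifferentiableAt 𝓘(ℝ, ℝ × ℝ) 𝓘(ℝ, ℝ) (Prod.snd : ℝ × ℝ → ℝ) p :=
    differentiableAt_snd.mdifferentiableAt
  have h2 := dmap_prodMk (f := fun p : ℝ × ℝ => circ p.1) (g := fun p : ℝ × ℝ => circ p.2)
    (I := 𝓘(ℝ, ℝ × ℝ)) (x := p) ((mdiff_circ p.1).comp p hf) ((mdiff_circ p.2).comp p hs) v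
  refine h2.trans ?_
  rw [dmap_comp_apply p (mdiff_circ p.1) hf, dmap_comp_apply p (mdiff_circ p.2) hs, h1, h1,
    dmap_eq_fderiv, dmap_eq_fderiv, fderiv_fst, fderiv_snd]
  rfl

lemma dmap_cover_left (p : ℝ × ℝ) :
    dmap 𝓘(ℝ, ℝ × ℝ) IT cover p (1, 0) = torusField₁ (cover p) := by
  rw [dmap_cover]
  refine Prod.ext (one_smul _ _) (zero_smul _ _)

lemma dmap_cover_right (p : ℝ × ℝ) :
    dmap 𝓘(ℝ, ℝ × ℝ) IT cover p (0, 1) = torusField₂ (cover p) := by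
  rw [dmap_cover]
  refine Prod.ext (zero_smul _ _) (one_smul _ _)

/-- A vector field on the torus that is covered by a constant vector field is smooth. -/
lemma contMDiff_of_dmap_cover {X : ∀ q : Torus, TangentSpace IT q} {e : ℝ × ℝ}
    (hX : ∀ p, dmap 𝓘(ℝ, ℝ × ℝ) IT cover p e = X (cover p)) :
    ContMDiff IT IT.tangent ∞ (fun q => (⟨q, X q⟩ : TangentBundle IT Torus)) := by
  apply contMDiff_of_comp_cover
  have h1 : ContMDiff 𝓘(ℝ, ℝ × ℝ) 𝓘(ℝ, ℝ × ℝ).tangent ∞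
      (fun p => (⟨p, e⟩ : TangentBundle 𝓘(ℝ, ℝ × ℝ) (ℝ × ℝ))) := fun p =>
    contMDiffAt_vectorSpace_iff_contDiffAt.2 contDiffAt_const
  have h2 := (contMDiff_cover.contMDiff_tangentMap (m := ∞) (by simp)).comp h1
  convert h2 using 1
  funext p
  exact congrArg (TotalSpace.mk (cover p)) (hX p).symm

/-! ### The connection form of a frame -/

section Connection

variable {L : Torus → Type*} [∀ q, AddCommGroup (L q)] [∀ q, Module ℂ (L q)]
  [∀ q, TopologicalSpace (L q)] [TopologicalSpace (TotalSpace ℂ L)] [FiberBundle ℂ L]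

/-- The coefficient of a section of `L`, pulled back to `ℝ²`, with respect to a frame. -/
def coef (S : ℝ × ℝ → TotalSpace ℂ L) (σ : ∀ q, L q) (p : ℝ × ℝ) : ℂ :=
  ratio (S p) ⟨cover p, σ (cover p)⟩

omit [∀ q, Module ℂ (L q)] in
lemma IsFrameOn.exists_eq_mk {S : ℝ × ℝ → TotalSpace ℂ L} (hS : IsFrameOn S univ) (p : ℝ × ℝ) :
    ∃ s : L (cover p), S p = ⟨cover p, s⟩ ∧ s ≠ 0 := by
  have key : ∀ v : TotalSpace ℂ L, v.proj = cover p → v.2 ≠ 0 →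
      ∃ s : L (cover p), v = ⟨cover p, s⟩ ∧ s ≠ 0 := by
    rintro ⟨b, u⟩ h1 h2
    obtain rfl : b = cover p := h1
    exact ⟨u, rfl, h2⟩
  exact key _ (hS.proj p trivial) (hS.ne_zero p trivial)

/-- Smoothness of a section of `L`. -/
def IsSmoothSection (σ : ∀ q, L q) : Prop := ContMDiff IT IL ∞ fun q => TotalSpace.mk' ℂ q (σ q)

variable [VectorBundle ℂ ℂ L]

lemma IsFrameOn.scale_coef {S : ℝ × ℝ → TotalSpace ℂ L} (hS : IsFrameOn S univ) (σ : ∀ q, L q)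
    (p : ℝ × ℝ) : scale (coef S σ p) (S p) = ⟨cover p, σ (cover p)⟩ :=
  scale_ratio (hS.ne_zero p trivial) (hS.proj p trivial).symm

lemma IsFrameOn.coef_smul {S : ℝ × ℝ → TotalSpace ℂ L} (hS : IsFrameOn S univ) (σ : ∀ q, L q)
    {p : ℝ × ℝ} {s : L (cover p)} (hs : S p = ⟨cover p, s⟩) : coef S σ p • s = σ (cover p) := by
  have := hS.scale_coef σ p
  rw [hs] at this
  exact TotalSpace.mk_inj.1 this

lemma coef_eq {S : ℝ × ℝ → TotalSpace ℂ L} {σ : ∀ q, L q}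
    {p : ℝ × ℝ} {s : L (cover p)} (hs : S p = ⟨cover p, s⟩) (hs0 : s ≠ 0) {c : ℂ}
    (h : c • s = σ (cover p)) : coef S σ p = c := by
  rw [coef, ← h, hs]
  exact ratio_scale (v := ⟨cover p, s⟩) hs0 c

variable [VectorBundle ℝ ℂ L] [ContMDiffVectorBundle ∞ ℂ L IT]

lemma IsFrameOn.contDiff_coef {S : ℝ × ℝ → TotalSpace ℂ L} (hS : IsFrameOn S univ) {σ : ∀ q, L q}
    (hσ : IsSmoothSection σ) : ContDiff ℝ ∞ (coef S σ) := by
  rw [← contMDiff_iff_contDiff]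
  intro p
  exact ContMDiffAt.ratio (hS.smooth p trivial)
    (ContMDiffAt.comp (g := fun q => TotalSpace.mk' ℂ q (σ q)) p (hσ _) (contMDiff_cover p))
    (Eventually.of_forall fun p => hS.ne_zero p trivial)
    (Eventually.of_forall fun p => (hS.proj p trivial).symm)

/-- There is a global smooth section that does not vanish at a given point. -/
lemma exists_section_ne_zero (q : Torus) : ∃ σ : ∀ q, L q, IsSmoothSection σ ∧ σ q ≠ 0 := by
  let e := trivializationAt ℂ L q
  have hq : q ∈ e.baseSet := mem_baseSet_trivializationAt ..
  obtain ⟨u, hu⟩ : ∃ u : L q, u ≠ 0 := by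
    refine ⟨e.symm q 1, fun h => ?_⟩
    have h1 := e.apply_mk_symm hq (1 : ℂ)
    rw [h] at h1
    have h2 := fibreCoord_zero (L := L) (q := q) hq
    exact one_ne_zero ((congrArg Prod.snd h1).symm.trans h2)
  obtain ⟨s, hs, hσ⟩ := FiberBundle.exists_contMDiffOn_extend (k := ∞) IT ℂ u
  obtain ⟨ψ, -, hψ⟩ := (SmoothBumpFunction.nhds_basis_tsupport (I := IT) q).mem_iff.1
    (interior_mem_nhds.2 hs)
  refine ⟨(ψ : Torus → ℝ) • FiberBundle.extend ℂ u, ?_, ?_⟩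
  · exact ContMDiffOn.smul_section_of_tsupport (ψ.contMDiff.contMDiffOn) isOpen_interior hψ
      (hσ.mono interior_subset)
  · simpa [ψ.eq_one] using hu

variable [∀ q, IsTopologicalAddGroup (L q)] [∀ q, ContinuousSMul ℝ (L q)]

omit [VectorBundle ℂ ℂ L] [ContMDiffVectorBundle ∞ ℂ L IT] in
/-- The covariant derivative of a smooth section along a smooth vector field is smooth. -/
lemma isSmoothSection_covariantDerivative {D : CovariantDerivative IT ℂ L}
    (hD : CovariantDerivative.ContMDiffCovariantDerivative D ∞)
    {X : ∀ q : Torus, TangentSpace IT q}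
    (hX : ContMDiff IT IT.tangent ∞ (fun q => (⟨q, X q⟩ : TangentBundle IT Torus)))
    {σ : ∀ q, L q} (hσ : IsSmoothSection σ) : IsSmoothSection fun q => D σ q (X q) := by
  have h1 := hD.contMDiff.contMDiff (σ := σ) (by simpa using hσ.contMDiffOn)
  rw [contMDiffOn_univ] at h1
  exact ContMDiff.clm_bundle_apply (b := fun q : Torus => q) (ϕ := fun q => D σ q)
    (v := fun q => X q) h1 hX

omit [VectorBundle ℂ ℂ L] [ContMDiffVectorBundle ∞ ℂ L IT] in
/-- The Leibniz rule for a complex-valued function `f`. -/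
lemma covariantDerivative_complex_smul {D : CovariantDerivative IT ℂ L}
    (hI : IsComplexConnection L D) {σ τ : ∀ q, L q} (hσ : IsSmoothSection σ)
    (hIσ : IsSmoothSection fun q => Complex.I • σ q)
    {f : Torus → ℂ} {q : Torus} (hτ : MDifferentiableAt IT IL (fun q => TotalSpace.mk' ℂ q (τ q)) q)
    (hf : MDifferentiableAt IT 𝓘(ℝ, ℂ) f q) (h : ∀ᶠ q' in 𝓝 q, τ q' = f q' • σ q')
    (u : TangentSpace IT q) :
    D τ q u = f q • D σ q u + (dmap IT 𝓘(ℝ, ℂ) f q u) • σ q := by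
  have hre : MDifferentiableAt IT 𝓘(ℝ, ℝ) (fun q => (f q).re) q :=
    (Complex.reCLM.differentiableAt.mdifferentiableAt).comp q hf
  have him : MDifferentiableAt IT 𝓘(ℝ, ℝ) (fun q => (f q).im) q :=
    (Complex.imCLM.differentiableAt.mdifferentiableAt).comp q hf
  have hσ' : MDifferentiableAt IT IL (fun q => TotalSpace.mk' ℂ q (σ q)) q :=
    hσ.mdifferentiableAt (by simp)
  have hIσ' : MDifferentiableAt IT IL (fun q => TotalSpace.mk' ℂ q (Complex.I • σ q)) q :=
    hIσ.mdifferentiableAt (by simp)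
  let τ' : ∀ q, L q := (fun q => (f q).re) • σ + (fun q => (f q).im) • (fun q => Complex.I • σ q)
  have hττ' : ∀ᶠ q' in 𝓝 q, τ q' = τ' q' := by
    filter_upwards [h] with q' hq'
    rw [hq']
    simp only [τ', Pi.add_apply, Pi.smul_apply']
    conv_lhs => rw [← Complex.re_add_im (f q'), add_smul, mul_smul, Complex.coe_smul,
      Complex.coe_smul]
  have h1 := hre.smul_section hσ'
  have h2 := him.smul_section hIσ'
  have hτ' : MDifferentiableAt IT IL (fun q => TotalSpace.mk' ℂ q (τ' q)) q :=
    mdifferentiableAt_add_section (I := IT) (F := ℂ) h1 h2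
  have hcov := D.isCovariantDerivativeOnUniv
  rw [hcov.congr_of_eventuallyEq hτ hτ' univ_mem hττ', hcov.add h1 h2, hcov.leibniz hσ' hre,
    hcov.leibniz hIσ' him]
  have e1 : mvfderiv IT (fun q => (f q).re) q u = (dmap IT 𝓘(ℝ, ℂ) f q u).re := by
    have := dmap_comp_apply (g := fun z : ℂ => z.re) q
      (Complex.reCLM.differentiableAt.mdifferentiableAt) hf u
    refine this.trans ?_
    rw [dmap_eq_fderiv]
    exact congrArg (fun T : ℂ →L[ℝ] ℝ => T (dmap IT 𝓘(ℝ, ℂ) f q u)) Complex.reCLM.fderiv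
  have e2 : mvfderiv IT (fun q => (f q).im) q u = (dmap IT 𝓘(ℝ, ℂ) f q u).im := by
    have := dmap_comp_apply (g := fun z : ℂ => z.im) q
      (Complex.imCLM.differentiableAt.mdifferentiableAt) hf u
    refine this.trans ?_
    rw [dmap_eq_fderiv]
    exact congrArg (fun T : ℂ →L[ℝ] ℝ => T (dmap IT 𝓘(ℝ, ℂ) f q u)) Complex.imCLM.fderiv
  simp only [add_apply, smul_apply,
    ContinuousLinearMap.smulRight_apply, e1, e2, hI σ hσ q u]
  conv_rhs => rw [← Complex.re_add_im (f q), ← Complex.re_add_im (dmap IT 𝓘(ℝ, ℂ) f q u),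
    add_smul, mul_smul, Complex.coe_smul, Complex.coe_smul, add_smul, mul_smul, Complex.coe_smul,
    Complex.coe_smul]
  abel

end Connection

section Connection

variable {L : Torus → Type*} [∀ q, AddCommGroup (L q)] [∀ q, Module ℂ (L q)]
  [∀ q, TopologicalSpace (L q)] [TopologicalSpace (TotalSpace ℂ L)] [FiberBundle ℂ L]
  [VectorBundle ℂ ℂ L] [VectorBundle ℝ ℂ L] [ContMDiffVectorBundle ∞ ℂ L IT]
  [∀ q, IsTopologicalAddGroup (L q)] [∀ q, ContinuousSMul ℝ (L q)]

omit [∀ q, IsTopologicalAddGroup (L q)] [∀ q, ContinuousSMul ℝ (L q)] in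
lemma IsSmoothSection.I_smul {σ : ∀ q, L q} (hσ : IsSmoothSection σ) :
    IsSmoothSection fun q => Complex.I • σ q := fun q =>
  ContMDiffAt.scale (f := fun q => TotalSpace.mk' ℂ q (σ q)) (c := fun _ => Complex.I)
    contMDiffAt_const (hσ q)

/-- The difference of the covariant derivative and the partial derivative of the coefficient is, as
a function of the section `τ`, multiplication by a number. It is read off from a section `σ` that
does not vanish at the point. -/
lemma coef_covariantDerivative_of_ne_zero {D : CovariantDerivative IT ℂ L}
    (hI : IsComplexConnection L D) {X : ∀ q : Torus, TangentSpace IT q} {e : ℝ × ℝ}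
    (hX : ∀ p, dmap 𝓘(ℝ, ℝ × ℝ) IT cover p e = X (cover p))
    {S : ℝ × ℝ → TotalSpace ℂ L} (hS : IsFrameOn S univ) {σ τ : ∀ q, L q}
    (hσ : IsSmoothSection σ) (hτ : IsSmoothSection τ) {p : ℝ × ℝ} (h0 : coef S σ p ≠ 0) :
    coef S (fun q => D τ q (X q)) p = fderiv ℝ (coef S τ) p e +
      (coef S (fun q => D σ q (X q)) p - fderiv ℝ (coef S σ) p e) / coef S σ p * coef S τ p := by
  let σT : Torus → TotalSpace ℂ L := fun q => TotalSpace.mk' ℂ q (σ q)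
  let τT : Torus → TotalSpace ℂ L := fun q => TotalSpace.mk' ℂ q (τ q)
  -- Near `cover p`, the section `τ` is the multiple of `σ` by the function `f`.
  let f : Torus → ℂ := fun q => ratio (σT q) (τT q)
  obtain ⟨s, hs, hs0⟩ := hS.exists_eq_mk p
  have hσp : σ (cover p) ≠ 0 := by
    rw [← hS.coef_smul σ hs]
    exact smul_ne_zero h0 hs0
  have hne : ∀ᶠ q in 𝓝 (cover p), σ q ≠ 0 := by
    have hb : cover p ∈ (trivializationAt ℂ L (cover p)).baseSet := mem_baseSet_trivializationAt ..
    have h1 := (contMDiffAt_totalSpace_iff (f := σT) (q := cover p) hb).1 (hσ (cover p))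
    have h2 : fibreCoord (cover p) (σT (cover p)) ≠ 0 := fibreCoord_ne_zero hb hσp
    filter_upwards [h1.2.continuousAt.eventually_ne h2,
      (trivializationAt ℂ L (cover p)).open_baseSet.mem_nhds hb] with q hq hqb h
    apply hq
    change fibreCoord (cover p) ⟨q, σ q⟩ = 0
    rw [h]
    exact fibreCoord_zero hqb
  have hf : ContMDiffAt IT 𝓘(ℝ, ℂ) ∞ f (cover p) :=
    ContMDiffAt.ratio (hσ _) (hτ _) hne (Eventually.of_forall fun _ => rfl)
  have hτσ : ∀ᶠ q in 𝓝 (cover p), τ q = f q • σ q := by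
    filter_upwards [hne] with q hq
    exact (TotalSpace.mk_inj.1 (scale_ratio (v := σT q) (w := τT q) hq rfl)).symm
  have h1 := covariantDerivative_complex_smul hI hσ hσ.I_smul (hτ.mdifferentiableAt (by simp))
    (hf.mdifferentiableAt (by simp)) hτσ (X (cover p))
  have h2 : coef S (fun q => D τ q (X q)) p = f (cover p) * coef S (fun q => D σ q (X q)) p +
      dmap IT 𝓘(ℝ, ℂ) f (cover p) (X (cover p)) * coef S σ p := by
    refine coef_eq hs hs0 ?_
    rw [h1, add_smul, mul_smul, mul_smul, hS.coef_smul _ hs, hS.coef_smul _ hs]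
  have h3 : ∀ᶠ p' in 𝓝 p, coef S τ p' = f (cover p') * coef S σ p' := by
    have hc : Tendsto cover (𝓝 p) (𝓝 (cover p)) := contMDiff_cover.continuous.continuousAt
    filter_upwards [hc.eventually hτσ] with p' hp'
    obtain ⟨s', hs', hs0'⟩ := hS.exists_eq_mk p'
    refine coef_eq hs' hs0' ?_
    rw [mul_smul, hS.coef_smul _ hs', hp']
  have hfc : ContDiffAt ℝ ∞ (fun p => f (cover p)) p := by
    rw [← contMDiffAt_iff_contDiffAt]
    exact ContMDiffAt.comp p hf (contMDiff_cover p)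
  have h4 : fderiv ℝ (fun p => f (cover p)) p e = dmap IT 𝓘(ℝ, ℂ) f (cover p) (X (cover p)) := by
    rw [← dmap_eq_fderiv, dmap_comp_apply p (hf.mdifferentiableAt (by simp)) (mdiff_cover p), hX]
  have h5 : fderiv ℝ (coef S τ) p e =
      f (cover p) * fderiv ℝ (coef S σ) p e + fderiv ℝ (fun p => f (cover p)) p e * coef S σ p := by
    rw [Filter.EventuallyEq.fderiv_eq h3, fderiv_fun_mul (hfc.differentiableAt (by simp))
      ((hS.contDiff_coef hσ).differentiable (by simp) p)]
    simp only [add_apply, smul_apply, smul_eq_mul]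
    ring
  rw [h2, h5, h4, h3.self_of_nhds]
  field_simp
  ring

/-- The connection form of a frame in the direction of an invariant vector field. -/
lemma exists_connectionForm {D : CovariantDerivative IT ℂ L}
    (hD : CovariantDerivative.ContMDiffCovariantDerivative D ∞)
    (hI : IsComplexConnection L D) {X : ∀ q : Torus, TangentSpace IT q} {e : ℝ × ℝ}
    (hX : ∀ p, dmap 𝓘(ℝ, ℝ × ℝ) IT cover p e = X (cover p))
    {S : ℝ × ℝ → TotalSpace ℂ L} (hS : IsFrameOn S univ) :
    ∃ A : ℝ × ℝ → ℂ, ContDiff ℝ ∞ A ∧ ∀ σ : ∀ q, L q, IsSmoothSection σ → ∀ p,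
      coef S (fun q => D σ q (X q)) p = fderiv ℝ (coef S σ) p e + A p * coef S σ p := by
  have hex : ∀ p, ∃ σ : ∀ q, L q, IsSmoothSection σ ∧ coef S σ p ≠ 0 := fun p => by
    obtain ⟨σ, hσ, h0⟩ := exists_section_ne_zero (L := L) (cover p)
    refine ⟨σ, hσ, fun h => h0 ?_⟩
    obtain ⟨s, hs, -⟩ := hS.exists_eq_mk p
    rw [← hS.coef_smul σ hs, h, zero_smul]
  choose σ hσ h0 using hex
  let B : (∀ q, L q) → ℝ × ℝ → ℂ := fun τ p =>
    (coef S (fun q => D τ q (X q)) p - fderiv ℝ (coef S τ) p e) / coef S τ p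
  -- The quotient `B τ` does not depend on the section `τ`.
  have hB : ∀ τ, IsSmoothSection τ → ∀ p, coef S τ p ≠ 0 → B (σ p) p = B τ p := fun τ hτ p hp => by
    have := coef_covariantDerivative_of_ne_zero hI hX hS (hσ p) hτ (h0 p)
    change B (σ p) p = (coef S (fun q => D τ q (X q)) p - fderiv ℝ (coef S τ) p e) / coef S τ p
    rw [this]
    simp only [B]
    field_simp
    ring
  refine ⟨fun p => B (σ p) p, ?_, fun τ hτ p =>
    coef_covariantDerivative_of_ne_zero hI hX hS (hσ p) hτ (h0 p)⟩
  rw [contDiff_iff_contDiffAt]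
  intro p
  have hg := hS.contDiff_coef (hσ p)
  have hDg := hS.contDiff_coef
    (isSmoothSection_covariantDerivative hD (contMDiff_of_dmap_cover hX) (hσ p))
  have hdg : ContDiff ℝ ∞ fun p' => fderiv ℝ (coef S (σ p)) p' e :=
    (hg.fderiv_right (m := ∞) (by simp)).clm_apply contDiff_const
  have h1 : ContDiffAt ℝ ∞ (B (σ p)) p := by
    simp only [B, div_eq_mul_inv]
    exact (hDg.sub hdg).contDiffAt.mul (hg.contDiffAt.inv (h0 p))
  refine h1.congr_of_eventuallyEq ?_
  filter_upwards [hg.continuous.continuousAt.eventually_ne (h0 p)] with p' hp'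
  exact hB _ (hσ p) p' hp'

/-- The curvature in terms of the connection form. -/
lemma curvature_eq {D : CovariantDerivative IT ℂ L}
    (hD : CovariantDerivative.ContMDiffCovariantDerivative D ∞) {Ω : Torus → ℂ}
    (hΩ : IsCurvature L D Ω) {S : ℝ × ℝ → TotalSpace ℂ L} (hS : IsFrameOn S univ)
    {A₁ A₂ : ℝ × ℝ → ℂ} (hA₁ : ContDiff ℝ ∞ A₁) (hA₂ : ContDiff ℝ ∞ A₂)
    (h₁ : ∀ σ : ∀ q, L q, IsSmoothSection σ → ∀ p, coef S (fun q => D σ q (torusField₁ q)) p =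
      fderiv ℝ (coef S σ) p (1, 0) + A₁ p * coef S σ p)
    (h₂ : ∀ σ : ∀ q, L q, IsSmoothSection σ → ∀ p, coef S (fun q => D σ q (torusField₂ q)) p =
      fderiv ℝ (coef S σ) p (0, 1) + A₂ p * coef S σ p) (p : ℝ × ℝ) :
    Ω (cover p) = fderiv ℝ A₂ p (1, 0) - fderiv ℝ A₁ p (0, 1) := by
  obtain ⟨σ, hσ, h0⟩ := exists_section_ne_zero (L := L) (cover p)
  obtain ⟨s, hs, hs0⟩ := hS.exists_eq_mk p
  have hg0 : coef S σ p ≠ 0 := fun h => h0 (by rw [← hS.coef_smul σ hs, h, zero_smul])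
  have hσ₁ := isSmoothSection_covariantDerivative hD
    (contMDiff_of_dmap_cover (X := torusField₁) dmap_cover_left) hσ
  have hσ₂ := isSmoothSection_covariantDerivative hD
    (contMDiff_of_dmap_cover (X := torusField₂) dmap_cover_right) hσ
  have h3 : coef S (fun q => D (fun q' => D σ q' (torusField₂ q')) q (torusField₁ q)) p -
      coef S (fun q => D (fun q' => D σ q' (torusField₁ q')) q (torusField₂ q)) p =
      Ω (cover p) * coef S σ p := by
    have h4 := hΩ σ hσ (cover p)
    have h5 : ∀ a b c : ℂ, a • s - b • s = c • s → a - b = c := fun a b c h => by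
      rw [← sub_smul] at h
      exact smul_left_injective ℂ hs0 h
    refine h5 _ _ _ ?_
    rw [mul_smul, hS.coef_smul _ hs, hS.coef_smul _ hs, hS.coef_smul _ hs]
    exact h4
  have hg := hS.contDiff_coef hσ
  have hdg : ∀ e : ℝ × ℝ, ContDiff ℝ ∞ fun p' => fderiv ℝ (coef S σ) p' e := fun e =>
    (hg.fderiv_right (m := ∞) (by simp)).clm_apply contDiff_const
  have hexp : ∀ (A : ℝ × ℝ → ℂ) (e e' : ℝ × ℝ), ContDiff ℝ ∞ A →
      fderiv ℝ (fun p => fderiv ℝ (coef S σ) p e + A p * coef S σ p) p e' =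
      fderiv ℝ (fderiv ℝ (coef S σ)) p e' e + fderiv ℝ A p e' * coef S σ p +
        A p * fderiv ℝ (coef S σ) p e' := by
    intro A e e' hA
    have d1 : DifferentiableAt ℝ (fderiv ℝ (coef S σ)) p :=
      (hg.fderiv_right (m := ∞) (by simp)).differentiable (by simp) p
    have d2 := hA.differentiable (by simp) p
    have d3 := hg.differentiable (by simp) p
    rw [fderiv_fun_add ((hdg e).differentiable (by simp) p) (d2.fun_mul d3), fderiv_fun_mul d2 d3,
      fderiv_clm_apply d1 (differentiableAt_const e)]
    simp
    ring
  have hsymm : fderiv ℝ (fderiv ℝ (coef S σ)) p (1, 0) (0, 1) =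
      fderiv ℝ (fderiv ℝ (coef S σ)) p (0, 1) (1, 0) :=
    (hg.contDiffAt.isSymmSndFDerivAt (by
      rw [minSmoothness_of_isRCLikeNormedField]; exact WithTop.coe_le_coe.2 le_top)) _ _
  rw [h₁ _ hσ₂, h₂ _ hσ₁, funext (h₁ σ hσ), funext (h₂ σ hσ), hexp _ _ _ hA₁, hexp _ _ _ hA₂,
    hsymm] at h3
  apply mul_right_cancel₀ hg0
  rw [← h3]
  ring

omit [∀ q, IsTopologicalAddGroup (L q)] [∀ q, ContinuousSMul ℝ (L q)] [VectorBundle ℝ ℂ L]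
  [ContMDiffVectorBundle ∞ ℂ L IT] in
/-- The transformation of coefficients under a deck transformation. -/
lemma IsFrameOn.coef_translate {S : ℝ × ℝ → TotalSpace ℂ L} (hS : IsFrameOn S univ)
    {e : ℝ × ℝ} (he : cover e = 1) {p : ℝ × ℝ} {c : ℂ} (h : S (p + e) = scale c (S p))
    (σ : ∀ q, L q) : coef S σ p = c * coef S σ (p + e) := by
  have h1 := hS.scale_coef σ (p + e)
  have hc : cover (p + e) = cover p := by simpa using cover_add_smul he p 1
  rw [h, scale_scale, mul_comm, hc] at h1
  rw [coef, ← h1, ratio_scale (hS.ne_zero p trivial)]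

/-- The transformation of the connection form under a deck transformation that multiplies the
frame by the function `c`. -/
lemma connectionForm_translate {D : CovariantDerivative IT ℂ L}
    {X : ∀ q : Torus, TangentSpace IT q} {u : ℝ × ℝ}
    {S : ℝ × ℝ → TotalSpace ℂ L} (hS : IsFrameOn S univ) {A : ℝ × ℝ → ℂ}
    (hA : ∀ σ : ∀ q, L q, IsSmoothSection σ → ∀ p, coef S (fun q => D σ q (X q)) p =
      fderiv ℝ (coef S σ) p u + A p * coef S σ p)
    {e : ℝ × ℝ} (he : cover e = 1) {c : ℝ × ℝ → ℂ} (hc : ContDiff ℝ ∞ c) (hc0 : ∀ p, c p ≠ 0)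
    (h : ∀ p, S (p + e) = scale (c p) (S p)) (p : ℝ × ℝ) :
    A (p + e) = A p + fderiv ℝ c p u / c p := by
  obtain ⟨σ, hσ, h0⟩ := exists_section_ne_zero (L := L) (cover p)
  have hg0 : coef S σ p ≠ 0 := fun h => h0 (by
    obtain ⟨s, hs, hs0⟩ := hS.exists_eq_mk p
    rw [← hS.coef_smul σ hs, h, zero_smul])
  have hg := hS.contDiff_coef hσ
  have h1 := hS.coef_translate he (h p) (fun q => D σ q (X q))
  have h2 : coef S σ = fun p => c p * coef S σ (p + e) :=
    funext fun p => hS.coef_translate he (h p) σ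
  have h3 : fderiv ℝ (coef S σ) p u =
      c p * fderiv ℝ (coef S σ) (p + e) u + fderiv ℝ c p u * coef S σ (p + e) := by
    have hg' : DifferentiableAt ℝ (fun p => coef S σ (p + e)) p :=
      ((hg.differentiable (by simp)).comp (by fun_prop : Differentiable ℝ fun p => p + e)) p
    conv_lhs => rw [h2]
    rw [fderiv_fun_mul (hc.differentiable (by simp) p) hg', fderiv_comp_add_right]
    simp only [add_apply, smul_apply, smul_eq_mul]
    ring
  have h4 := hS.coef_translate he (h p) σ
  rw [hA σ hσ, hA σ hσ, h3, h4] at h1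
  have h5 : coef S σ (p + e) ≠ 0 := fun h => hg0 (by rw [h4, h, mul_zero])
  have h6 := hc0 p
  have h7 : coef S σ (p + e) * (A (p + e) * c p) =
      coef S σ (p + e) * (A p * c p + fderiv ℝ c p u) := by linear_combination -h1
  field_simp
  linear_combination mul_left_cancel₀ h5 h7

/-! ### The degree of a quasi-periodic frame -/

/-- The Chern number is minus the degree of the transition function of a quasi-periodic frame:
by Stokes' theorem on the unit square, the integral of the curvature is the change of the
connection form between opposite sides. -/
lemma degree_eq_neg_chernClass {n k : ℤ} (hL : HasFirstChernClass L n)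
    {S : ℝ × ℝ → TotalSpace ℂ L} (hS : IsFrameOn S univ) (h2 : ∀ x y, S (x, y + 1) = S (x, y))
    (h1 : ∀ x y, S (x + 1, y) = scale (circ (k * staircase y)) (S (x, y))) : k = -n := by
  obtain ⟨D, Ω, hD, hI, hΩ, hint⟩ := hL
  obtain ⟨A₁, hA₁, hD₁⟩ := exists_connectionForm hD hI (X := torusField₁) dmap_cover_left hS
  obtain ⟨A₂, hA₂, hD₂⟩ := exists_connectionForm hD hI (X := torusField₂) dmap_cover_right hS
  have hcurv := curvature_eq hD hΩ hS hA₁ hA₂ hD₁ hD₂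
  have per₁ : ∀ x, A₁ (x, 1) = A₁ (x, 0) := fun x => by
    have := connectionForm_translate hS hD₁ (e := (0, 1)) (by simp [cover]) (c := fun _ => 1)
      contDiff_const (fun _ => one_ne_zero) (fun p => by
        have : p + (0, 1) = (p.1, p.2 + 1) := by ext <;> simp
        rw [this, h2, scale_one]) (x, 0)
    simpa using this
  let c : ℝ × ℝ → ℂ := fun p => Complex.exp (2 * Real.pi * Complex.I * k * (staircase p.2 : ℝ))
  have hst : ∀ y, HasDerivAt (fun y => (staircase y : ℂ)) (deriv staircase y : ℝ) y := fun y =>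
    ((contDiff_staircase.differentiable (by simp)) y).hasDerivAt.ofReal_comp
  have hst' : ContDiff ℝ ∞ fun p : ℝ × ℝ => (staircase p.2 : ℂ) :=
    Complex.ofRealCLM.contDiff.comp (contDiff_staircase.comp contDiff_snd)
  have hc : ContDiff ℝ ∞ c := (contDiff_const.mul hst').cexp
  have per₂ : ∀ y, A₂ (1, y) - A₂ (0, y) =
      2 * Real.pi * Complex.I * k * (deriv staircase y : ℝ) := by
    intro y
    have h3 := connectionForm_translate hS hD₂ (e := (1, 0)) (by simp [cover]) hc
      (fun _ => Complex.exp_ne_zero _) (fun p => by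
        have : p + (1, 0) = (p.1 + 1, p.2) := by ext <;> simp
        rw [this, h1, coe_circ]
        congr 2
        push_cast; ring) (0, y)
    have h4 : fderiv ℝ c (0, y) (0, 1) =
        (2 * Real.pi * Complex.I * k * (deriv staircase y : ℝ)) * c (0, y) := by
      have h5 : HasDerivAt (fun t : ℝ => c (0, t))
          ((2 * Real.pi * Complex.I * k * (deriv staircase y : ℝ)) * c (0, y)) y := by
        have := ((hst y).const_mul (2 * Real.pi * Complex.I * k)).cexp
        exact this.congr_deriv (mul_comm _ _)
      have h6 : HasDerivAt (fun t : ℝ => c (0, t)) (fderiv ℝ c (0, y) (0, 1)) y := by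
        have h7 : HasDerivAt (fun t : ℝ => ((0 : ℝ), t)) ((0 : ℝ), (1 : ℝ)) y :=
          (hasDerivAt_const y (0 : ℝ)).prodMk (hasDerivAt_id y)
        exact HasFDerivAt.comp_hasDerivAt y
          ((hc.differentiable (by simp)) (0, y)).hasFDerivAt h7
      exact h6.unique h5
    rw [h4, mul_div_cancel_right₀ _ (Complex.exp_ne_zero _)] at h3
    simp only [Prod.mk_add_mk, zero_add, add_zero] at h3
    rw [h3]; ring
  have hd : ∀ {A : ℝ × ℝ → ℂ}, ContDiff ℝ ∞ A → ∀ u, Continuous fun p => fderiv ℝ A p u :=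
    fun hA u => ((hA.fderiv_right (m := ∞) (by simp)).clm_apply contDiff_const).continuous
  have hx : ∀ x y, HasDerivAt (fun t : ℝ => A₂ (t, y)) (fderiv ℝ A₂ (x, y) (1, 0)) x := by
    intro x y
    have h7 : HasDerivAt (fun t : ℝ => (t, y)) ((1 : ℝ), (0 : ℝ)) x :=
      (hasDerivAt_id x).prodMk (hasDerivAt_const x y)
    exact HasFDerivAt.comp_hasDerivAt x ((hA₂.differentiable (by simp)) (x, y)).hasFDerivAt h7
  have hy : ∀ x y, HasDerivAt (fun t : ℝ => A₁ (x, t)) (fderiv ℝ A₁ (x, y) (0, 1)) y := by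
    intro x y
    have h7 : HasDerivAt (fun t : ℝ => (x, t)) ((0 : ℝ), (1 : ℝ)) y :=
      (hasDerivAt_const y x).prodMk (hasDerivAt_id y)
    exact HasFDerivAt.comp_hasDerivAt y ((hA₁.differentiable (by simp)) (x, y)).hasFDerivAt h7
  have hI1 : ∀ x : ℝ, ∫ y in (0 : ℝ)..1, fderiv ℝ A₁ (x, y) (0, 1) = 0 := fun x => by
    rw [intervalIntegral.integral_eq_sub_of_hasDerivAt (fun y _ => hy x y)
      (((hd hA₁ (0, 1)).comp (by fun_prop : Continuous fun y : ℝ => (x, y))).intervalIntegrable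
        _ _),
      per₁, sub_self]
  have hI2 : ∀ y : ℝ, ∫ x in (0 : ℝ)..1, fderiv ℝ A₂ (x, y) (1, 0) =
      2 * Real.pi * Complex.I * k * (deriv staircase y : ℝ) := fun y => by
    rw [intervalIntegral.integral_eq_sub_of_hasDerivAt (fun x _ => hx x y)
      (((hd hA₂ (1, 0)).comp (by fun_prop : Continuous fun x : ℝ => (x, y))).intervalIntegrable
        _ _),
      per₂]
  have hI3 : ∫ y in (0 : ℝ)..1, ((deriv staircase y : ℝ) : ℂ) = 1 := by
    have hcont : Continuous fun y => ((deriv staircase y : ℝ) : ℂ) :=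
      Complex.continuous_ofReal.comp (contDiff_staircase.continuous_deriv (by simp))
    rw [intervalIntegral.integral_eq_sub_of_hasDerivAt (fun y _ => hst y)
      (hcont.intervalIntegrable _ _)]
    have := staircase_add_one 0
    rw [zero_add] at this
    rw [this]; push_cast; ring
  have hΩI : ∫ x in (0 : ℝ)..1, ∫ y in (0 : ℝ)..1, Ω (circ x, circ y) =
      2 * Real.pi * Complex.I * k := by
    have e1 : ∀ x : ℝ, ∫ y in (0 : ℝ)..1, Ω (circ x, circ y) =
        ∫ y in (0 : ℝ)..1, fderiv ℝ A₂ (x, y) (1, 0) := fun x => by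
      have : ∀ y, Ω (circ x, circ y) =
        fderiv ℝ A₂ (x, y) (1, 0) - fderiv ℝ A₁ (x, y) (0, 1) := fun y => hcurv (x, y)
      simp_rw [this]
      have i2 : IntervalIntegrable (fun y => fderiv ℝ A₂ (x, y) (1, 0)) MeasureTheory.volume 0 1 :=
        ((hd hA₂ (1, 0)).comp (by fun_prop : Continuous fun y : ℝ => (x, y))).intervalIntegrable _ _
      have i1 : IntervalIntegrable (fun y => fderiv ℝ A₁ (x, y) (0, 1)) MeasureTheory.volume 0 1 :=
        ((hd hA₁ (0, 1)).comp (by fun_prop : Continuous fun y : ℝ => (x, y))).intervalIntegrable _ _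
      rw [intervalIntegral.integral_sub i2 i1, hI1, sub_zero]
    simp_rw [e1]
    rw [MeasureTheory.intervalIntegral_intervalIntegral_swap]
    · simp_rw [hI2]
      rw [intervalIntegral.integral_const_mul, hI3, mul_one]
    · have hK : IsCompact (uIcc (0 : ℝ) 1 ×ˢ uIcc (0 : ℝ) 1) := isCompact_uIcc.prod isCompact_uIcc
      exact ((hd hA₂ (1, 0)).continuousOn.integrableOn_compact hK).mono_set
        (prod_mono uIoc_subset_uIcc uIoc_subset_uIcc)
  rw [hΩI] at hint
  have hpi : (Real.pi : ℂ) ≠ 0 := by exact_mod_cast Real.pi_ne_zero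
  have h9 : Complex.I / (2 * Real.pi) * (2 * Real.pi * Complex.I * k) = -(k : ℂ) := by
    field_simp
    rw [Complex.I_sq]
    ring
  rw [h9] at hint
  have h10 : (-k : ℤ) = n := by exact_mod_cast hint
  omega

end Connection

/-! ### Descending periodic functions to the circle -/

/-- The function on the circle induced by a `1`-periodic function on the line. -/
def descend {X : Type*} (f : ℝ → X) (z : Circle) : X := f (argLift 0 z)

lemma descend_eq {X : Type*} {f : ℝ → X} (hf : Periodic f 1) {t : ℝ} {z : Circle}
    (h : circ t = z) : descend f z = f t := by
  obtain ⟨m, hm⟩ := circ_eq_circ_iff.1 ((circ_argLift 0 z).trans h.symm)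
  have := hf.int_mul m t
  rw [mul_one] at this
  rw [descend, hm, this]

lemma descend_circ {X : Type*} {f : ℝ → X} (hf : Periodic f 1) (t : ℝ) :
    descend f (circ t) = f t := descend_eq hf rfl

lemma periodic_circ_staircase : Periodic (fun y => circ (staircase y)) 1 := fun y => by
  simp only [staircase_add_one, circ_add_one]

/-- The smooth self-map of the circle induced by `staircase`. -/
def circStaircase (z : Circle) : Circle := descend (fun y => circ (staircase y)) z

lemma circStaircase_circ (y : ℝ) : circStaircase (circ y) = circ (staircase y) :=
  descend_circ periodic_circ_staircase y

lemma contMDiff_circStaircase : ContMDiff (𝓡 1) (𝓡 1) ∞ circStaircase := fun z => by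
  obtain ⟨t, rfl⟩ := exists_circ_eq z
  have : circStaircase = fun w => circ (staircase (argLift t w)) :=
    funext fun w => descend_eq periodic_circ_staircase (circ_argLift t w)
  rw [this]
  have h1 : ContMDiffAt (𝓡 1) 𝓘(ℝ, ℝ) ∞ (fun w => staircase (argLift t w)) (circ t) :=
    contDiff_staircase.contMDiff.contMDiffAt.comp _ (contMDiffAt_argLift (circ_mem_arc t))
  exact contMDiff_circ.contMDiffAt.comp _ h1

/-! ### The radius -/

section Radius

variable {L : Torus → Type*} [∀ q, AddCommGroup (L q)] [∀ q, Module ℂ (L q)]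
  [∀ q, TopologicalSpace (L q)] [TopologicalSpace (TotalSpace ℂ L)] [FiberBundle ℂ L]
  (h : HermitianMetric L)

lemma inner_self_nonneg (v : TotalSpace ℂ L) : 0 ≤ (h.inner v.proj v.2 v.2).re := by
  by_cases hv : v.2 = 0
  · simp [hv]
  · exact (h.pos _ _ hv).le

lemma radius_sq (v : TotalSpace ℂ L) : h.radius v ^ 2 = (h.inner v.proj v.2 v.2).re :=
  Real.sq_sqrt (inner_self_nonneg h v)

lemma radius_nonneg (v : TotalSpace ℂ L) : 0 ≤ h.radius v := Real.sqrt_nonneg _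

lemma radius_eq_zero_iff {v : TotalSpace ℂ L} : h.radius v = 0 ↔ v.2 = 0 := by
  refine ⟨fun h0 => ?_, fun h0 => by simp [HermitianMetric.radius, h0]⟩
  by_contra hv
  have h1 := h.pos _ _ hv
  rw [← radius_sq h, h0] at h1
  simp at h1

lemma radius_pos {v : TotalSpace ℂ L} (hv : v.2 ≠ 0) : 0 < h.radius v :=
  (radius_nonneg h v).lt_of_ne fun h0 => hv ((radius_eq_zero_iff h).1 h0.symm)

lemma radius_scale (c : ℂ) (v : TotalSpace ℂ L) : h.radius (scale c v) = ‖c‖ * h.radius v := by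
  have : (h.inner v.proj (c • v.2) (c • v.2)).re = ‖c‖ ^ 2 * (h.inner v.proj v.2 v.2).re := by
    have h1 : h.inner v.proj (c • v.2) = starRingEnd ℂ c • h.inner v.proj v.2 :=
      LinearMap.map_smulₛₗ _ c v.2
    rw [h1, LinearMap.smul_apply, map_smul, smul_smul, smul_eq_mul,
      ← Complex.normSq_eq_conj_mul_self, Complex.normSq_eq_norm_sq, Complex.re_ofReal_mul]
  change Real.sqrt (h.inner v.proj (c • v.2) (c • v.2)).re = _
  rw [this, Real.sqrt_mul (sq_nonneg _), Real.sqrt_sq (norm_nonneg _)]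
  rfl

lemma contMDiff_radius_sq : ContMDiff IL 𝓘(ℝ, ℝ) ∞ fun v => h.radius v ^ 2 := by
  have := h.smooth
  simp_rw [← radius_sq h] at this
  exact this

lemma contMDiffAt_radius {v : TotalSpace ℂ L} (hv : v.2 ≠ 0) :
    ContMDiffAt IL 𝓘(ℝ, ℝ) ∞ h.radius v := by
  have h1 : ContDiffAt ℝ ∞ Real.sqrt (h.radius v ^ 2) :=
    Real.contDiffAt_sqrt (pow_ne_zero 2 (radius_pos h hv).ne')
  have h2 : h.radius = fun v => Real.sqrt (h.radius v ^ 2) :=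
    funext fun v => (Real.sqrt_sq (radius_nonneg h v)).symm
  rw [h2]
  exact ContMDiffAt.comp (g := Real.sqrt) v h1.contMDiffAt (contMDiff_radius_sq h v)

end Radius

/-! ### Unit frames -/

section UnitFrame

variable {L : Torus → Type*} [∀ q, AddCommGroup (L q)] [∀ q, Module ℂ (L q)]
  [∀ q, TopologicalSpace (L q)] [TopologicalSpace (TotalSpace ℂ L)] [FiberBundle ℂ L]

/-- A smooth unit section of the pull-back of `L` to the cylinder `ℝ × S¹` under
`(t, z) ↦ (circ t, z)`, with monodromy `circStaircase ^ (-n)` under `t ↦ t + 1`. -/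
structure IsUnitFrame (h : HermitianMetric L) (n : ℤ) (S : ℝ × Circle → TotalSpace ℂ L) : Prop where
  smooth : ContMDiff (𝓘(ℝ, ℝ).prod (𝓡 1)) IL ∞ S
  proj : ∀ t z, (S (t, z)).proj = (circ t, z)
  radius : ∀ p, h.radius (S p) = 1
  translate : ∀ t z, S (t + 1, z) = scale ((circStaircase z ^ (-n) : Circle) : ℂ) (S (t, z))

lemma IsUnitFrame.ne_zero {h : HermitianMetric L} {n : ℤ} {S : ℝ × Circle → TotalSpace ℂ L}
    (hS : IsUnitFrame h n S) (p : ℝ × Circle) : (S p).2 ≠ 0 := fun h0 => by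
  have := hS.radius p
  rw [(radius_eq_zero_iff h).2 h0] at this
  exact zero_ne_one this

variable [∀ q, IsTopologicalAddGroup (L q)] [∀ q, ContinuousSMul ℝ (L q)]
  [VectorBundle ℂ ℂ L] [VectorBundle ℝ ℂ L] [ContMDiffVectorBundle ∞ ℂ L IT]

/-- A quasi-periodic frame over the plane, normalized to length one, descends to the cylinder. -/
theorem exists_unitFrame {n : ℤ} (hL : HasFirstChernClass L n) (h : HermitianMetric L) :
    ∃ S, IsUnitFrame h n S := by
  obtain ⟨k, S, hS, h2, h1⟩ := exists_quasiperiodic_frame (L := L)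
  obtain rfl := degree_eq_neg_chernClass hL hS h2 h1
  let N : ℝ × ℝ → TotalSpace ℂ L := fun p => scale ((h.radius (S p))⁻¹ : ℝ) (S p)
  have hNs : ∀ p, ContMDiffAt 𝓘(ℝ, ℝ × ℝ) IL ∞ N p := fun p => by
    have h0 := hS.ne_zero p (mem_univ _)
    have h3 := hS.smooth p (mem_univ _)
    have h4 : ContMDiffAt 𝓘(ℝ, ℝ × ℝ) 𝓘(ℝ, ℝ) ∞ (fun p => h.radius (S p)) p :=
      ContMDiffAt.comp (g := h.radius) p (contMDiffAt_radius h h0) h3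
    have h5 : ContDiffAt ℝ ∞ (fun r : ℝ => ((r⁻¹ : ℝ) : ℂ)) (h.radius (S p)) :=
      Complex.ofRealCLM.contDiff.contDiffAt.comp _ (contDiffAt_inv ℝ (radius_pos h h0).ne')
    exact ContMDiffAt.scale (ContMDiffAt.comp (g := fun r : ℝ => ((r⁻¹ : ℝ) : ℂ)) p
      h5.contMDiffAt h4) h3
  have hNper : ∀ x, Periodic (fun y => N (x, y)) 1 := fun x y => by simp only [N, h2]
  refine ⟨fun p => descend (fun y => N (p.1, y)) p.2, fun p => ?_, fun t z => ?_, fun p => ?_,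
    fun t z => ?_⟩
  · obtain ⟨x, z⟩ := p
    obtain ⟨y, rfl⟩ := exists_circ_eq z
    have : (fun p : ℝ × Circle => descend (fun y => N (p.1, y)) p.2) =
        fun p => N (p.1, argLift y p.2) :=
      funext fun p => descend_eq (hNper p.1) (circ_argLift y p.2)
    rw [this]
    have h3 : ContMDiffAt (𝓘(ℝ, ℝ).prod (𝓡 1)) 𝓘(ℝ, ℝ) ∞ (fun p : ℝ × Circle => argLift y p.2)
        (x, circ y) :=
      ContMDiffAt.comp (g := argLift y) (x, circ y) (contMDiffAt_argLift (circ_mem_arc y))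
        contMDiffAt_snd
    have h4 : ContMDiffAt (𝓘(ℝ, ℝ).prod (𝓡 1)) 𝓘(ℝ, ℝ × ℝ) ∞
        (fun p : ℝ × Circle => (p.1, argLift y p.2)) (x, circ y) :=
      contMDiffAt_fst.prodMk_space h3
    exact ContMDiffAt.comp (g := N) (x, circ y) (hNs _) h4
  · obtain ⟨y, rfl⟩ := exists_circ_eq z
    simp only [descend_circ (hNper t)]
    exact hS.proj (t, y) (mem_univ _)
  · have h0 := radius_pos h (hS.ne_zero (p.1, argLift 0 p.2) (mem_univ _))
    simp only [descend, N, radius_scale, Complex.norm_real, norm_inv, Real.norm_eq_abs,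
      abs_of_pos h0]
    exact inv_mul_cancel₀ h0.ne'
  · obtain ⟨y, rfl⟩ := exists_circ_eq z
    simp only [descend_circ (hNper _), circStaircase_circ, ← circ_zsmul, N]
    rw [h1, radius_scale, Circle.norm_coe, one_mul, scale_scale, scale_scale, mul_comm]

end UnitFrame

/-! ### The half line and the half cylinder -/

section HalfLine

/-- The coordinate `s` of a point of the half line. -/
def halfLineCoord (s : EuclideanHalfSpace 1) : ℝ := s.1 0

@[simp] lemma halfLineCoord_halfLinePoint (s : ℝ) (hs : 0 ≤ s) :
    halfLineCoord (halfLinePoint s hs) = s := by simp [halfLineCoord, halfLinePoint]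

lemma halfLineCoord_nonneg (s : EuclideanHalfSpace 1) : 0 ≤ halfLineCoord s := s.2

lemma halfLineCoord_injective : Injective halfLineCoord := fun s t h => by
  apply Subtype.ext
  ext i
  rw [Subsingleton.elim i 0]
  exact h

lemma contMDiff_halfLineCoord : ContMDiff (𝓡∂ 1) 𝓘(ℝ, ℝ) ∞ halfLineCoord := by
  have h1 : ContMDiff (𝓡∂ 1) 𝓘(ℝ, EuclideanSpace ℝ (Fin 1)) ∞ ⇑(𝓡∂ 1) :=
    ModelWithCorners.contMDiff _
  have h2 : ContDiff ℝ ∞ fun u : EuclideanSpace ℝ (Fin 1) => u 0 := by fun_prop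
  exact h2.contMDiff.comp h1

lemma dmap_halfLineCoord (s : EuclideanHalfSpace 1) (u : EuclideanSpace ℝ (Fin 1)) :
    dmap (𝓡∂ 1) 𝓘(ℝ, ℝ) halfLineCoord s u = u 0 := by
  have h2 : HasFDerivAt (fun u : EuclideanSpace ℝ (Fin 1) => u 0)
      (EuclideanSpace.proj (𝕜 := ℝ) (0 : Fin 1)) s.1 :=
    (EuclideanSpace.proj (𝕜 := ℝ) (0 : Fin 1)).hasFDerivAt
  have h : HasMFDerivAt (𝓡∂ 1) 𝓘(ℝ, ℝ) halfLineCoord s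
      (EuclideanSpace.proj (𝕜 := ℝ) (0 : Fin 1)) := by
    refine ⟨contMDiff_halfLineCoord.continuous.continuousAt, ?_⟩
    refine HasFDerivWithinAt.congr' (h2.hasFDerivWithinAt (s := range (𝓡∂ 1)))
      (fun x hx => ?_) ⟨s, rfl⟩
    obtain ⟨t, rfl⟩ := hx
    simp only [writtenInExtChartAt, mfld_simps]
    rfl
  rw [h.dmap_eq]
  rfl

variable {E H M : Type*} [NormedAddCommGroup E] [NormedSpace ℝ E] [TopologicalSpace H]
  [TopologicalSpace M] [ChartedSpace H M] {I : ModelWithCorners ℝ E H}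

lemma contMDiffAt_halfLinePoint {g : M → ℝ} {x : M} (hg : ContMDiffAt I 𝓘(ℝ, ℝ) ∞ g x)
    (h0 : ∀ y, 0 ≤ g y) :
    ContMDiffAt I (𝓡∂ 1) ∞ (fun y => halfLinePoint (g y) (h0 y)) x := by
  have h1 : ContDiff ℝ ∞ fun s : ℝ => (EuclideanSpace.single 0 s : EuclideanSpace ℝ (Fin 1)) := by
    have : (fun s : ℝ => (EuclideanSpace.single 0 s : EuclideanSpace ℝ (Fin 1))) =
        fun s => s • EuclideanSpace.single 0 1 := by
      funext s
      ext i
      simp [Subsingleton.elim i 0]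
    rw [this]
    fun_prop
  have h2 : ContMDiffAt I 𝓘(ℝ, EuclideanSpace ℝ (Fin 1)) ∞
      (fun y => (EuclideanSpace.single 0 (g y) : EuclideanSpace ℝ (Fin 1))) x :=
    ContMDiffAt.comp (g := fun s : ℝ => (EuclideanSpace.single 0 s : EuclideanSpace ℝ (Fin 1))) x
      h1.contMDiff.contMDiffAt hg
  rw [contMDiffAt_iff_target]
  exact ⟨Topology.IsInducing.subtypeVal.continuousAt_iff.2 h2.continuousAt, h2⟩

end HalfLine

lemma mem_range_boundaryCircle {y : HalfCylinder} :
    y ∈ range boundaryCircle ↔ halfLineCoord y.2 = 0 := by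
  constructor
  · rintro ⟨z, rfl⟩; simp [boundaryCircle]
  · intro h
    refine ⟨y.1, Prod.ext rfl (halfLineCoord_injective ?_)⟩
    rw [h]; simp [boundaryCircle]

lemma isSmoothEmbedding_boundaryCircle : IsSmoothEmbedding (𝓡 1) IC ∞ boundaryCircle := by
  have hc : Continuous boundaryCircle := by unfold boundaryCircle; fun_prop
  refine ⟨IsImmersionOfComplement.isImmersion (F := EuclideanSpace ℝ (Fin 1)) fun z => ?_, ?_⟩
  · refine IsImmersionAtOfComplement.mk_of_continuousAt hc.continuousAt
      (ContinuousLinearEquiv.refl ℝ _) (chartAt _ z) (chartAt _ (boundaryCircle z))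
      (mem_chart_source _ z) (mem_chart_source _ _) (IsManifold.chart_mem_maximalAtlas z)
      (IsManifold.chart_mem_maximalAtlas _) fun x hx => ?_
    refine Prod.ext ?_ ?_
    · exact (extChartAt (𝓡 1) z).right_inv hx
    · change (EuclideanSpace.single 0 0 : EuclideanSpace ℝ (Fin 1)) = 0
      simp
  · exact Topology.IsEmbedding.of_leftInverse (f := Prod.fst) (fun _ => rfl) continuous_fst hc

lemma isDefiningFunctionOn_halfLineCoord :
    IsDefiningFunctionOn IC (range boundaryCircle) univ fun y => halfLineCoord y.2 where
  isOpen := isOpen_univ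
  smooth := (contMDiff_halfLineCoord.comp contMDiff_snd).contMDiffOn
  zero_iff := fun y _ => mem_range_boundaryCircle.symm
  regular := fun y _ h0 => by
    have h1 : dmap IC 𝓘(ℝ, ℝ) (fun y => halfLineCoord y.2) y
        ((0 : EuclideanSpace ℝ (Fin 1)), EuclideanSpace.single (0 : Fin 1) (1 : ℝ)) = 0 := by
      rw [dmap, h0]; rfl
    rw [dmap_comp_apply y (contMDiff_halfLineCoord.mdifferentiable (by simp) _)
      mdifferentiableAt_snd, dmap_halfLineCoord, dmap, mfderiv_snd] at h1
    exact one_ne_zero ((PiLp.single_apply 2 ℝ (0 : Fin 1) (1 : ℝ) 0).symm.trans h1)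

/-! ### Tangent vectors of the total space -/

section Tangent

variable {L : Torus → Type*} [∀ q, TopologicalSpace (L q)] [TopologicalSpace (TotalSpace ℂ L)]
  [FiberBundle ℂ L]

lemma extChartAt_apply (v w : TotalSpace ℂ L) :
    extChartAt IL v w = (extChartAt IT v.proj (trivializationAt ℂ L v.proj w).1,
      fibreCoord v.proj w) := by
  rw [FiberBundle.extChartAt]; rfl

lemma extChartAt_symm_proj (v : TotalSpace ℂ L) {p} (hp : p ∈ (extChartAt IL v).target) :
    ((extChartAt IL v).symm p).proj ∈ (trivializationAt ℂ L v.proj).baseSet ∧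
      extChartAt IT v.proj ((extChartAt IL v).symm p).proj = p.1 ∧
      fibreCoord v.proj ((extChartAt IL v).symm p) = p.2 ∧
      ((extChartAt IL v).symm p).proj ∈ (extChartAt IT v.proj).source := by
  have h0 : ∀ w ∈ (extChartAt IL v).source, w.proj ∈ (trivializationAt ℂ L v.proj).baseSet ∧
      w.proj ∈ (extChartAt IT v.proj).source := by
    intro w hw
    rw [FiberBundle.extChartAt, PartialEquiv.trans_source] at hw
    have hw' := (trivializationAt ℂ L v.proj).mem_source.1 hw.1
    refine ⟨hw', ?_⟩
    have := hw.2.1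
    rwa [OpenPartialHomeomorph.coe_toPartialEquiv, Trivialization.coe_coe,
      (trivializationAt ℂ L v.proj).coe_fst' hw'] at this
  have h2 := (extChartAt IL v).right_inv hp
  obtain ⟨h3, h4⟩ := h0 _ ((extChartAt IL v).map_target hp)
  rw [extChartAt_apply, (trivializationAt ℂ L v.proj).coe_fst' h3] at h2
  exact ⟨h3, congrArg Prod.fst h2, congrArg Prod.snd h2, h4⟩

lemma prod_mem_extChartAt_target (v : TotalSpace ℂ L) (c : ℂ) :
    (extChartAt IT v.proj v.proj, c) ∈ (extChartAt IL v).target := by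
  have h := mem_extChartAt_target (I := IL) v
  rw [FiberBundle.extChartAt_target] at h ⊢
  rw [extChartAt_apply, (trivializationAt ℂ L v.proj).coe_fst'
    (mem_baseSet_trivializationAt ..)] at h
  exact ⟨h.1, mem_univ _⟩

lemma extChartAt_self_eq (v : TotalSpace ℂ L) :
    extChartAt IL v v = (extChartAt IT v.proj v.proj, fibreCoord v.proj v) := by
  rw [extChartAt_apply, (trivializationAt ℂ L v.proj).coe_fst' (mem_baseSet_trivializationAt ..)]

/-- The tangent spaces of the total space are products of a tangent space of the base and the
model fibre; the projection to the base is the derivative of the bundle projection. -/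
lemma dmap_proj (v : TotalSpace ℂ L) :
    dmap IL IT (TotalSpace.proj : TotalSpace ℂ L → Torus) v = ContinuousLinearMap.fst ℝ _ _ := by
  refine HasMFDerivAt.dmap_eq ⟨(FiberBundle.continuous_proj ℂ L).continuousAt, ?_⟩
  refine (hasFDerivAt_fst.hasFDerivWithinAt (s := range IL)).congr_of_eventuallyEq
    (Filter.Eventually.filter_mono nhdsWithin_le_nhds ?_) ?_
  · filter_upwards [extChartAt_target_mem_nhds (I := IL) v] with p hp
    exact (extChartAt_symm_proj v hp).2.1
  · exact (extChartAt_symm_proj v (mem_extChartAt_target v)).2.1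

variable [∀ q, AddCommGroup (L q)] [∀ q, Module ℂ (L q)] [VectorBundle ℂ ℂ L] [VectorBundle ℝ ℂ L]
  [ContMDiffVectorBundle ∞ ℂ L IT]

omit [VectorBundle ℂ ℂ L] in
/-- The projection of a tangent space of the total space to the model fibre is the derivative of
the fibre coordinate. -/
lemma dmap_fibreCoord (v : TotalSpace ℂ L) :
    dmap IL 𝓘(ℝ, ℂ) (fibreCoord v.proj) v = ContinuousLinearMap.snd ℝ _ _ := by
  refine HasMFDerivAt.dmap_eq
    ⟨(contMDiffAt_fibreCoord (mem_baseSet_trivializationAt ..)).continuousAt, ?_⟩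
  refine (hasFDerivAt_snd.hasFDerivWithinAt (s := range IL)).congr_of_eventuallyEq
    (Filter.Eventually.filter_mono nhdsWithin_le_nhds ?_) ?_
  · filter_upwards [extChartAt_target_mem_nhds (I := IL) v] with p hp
    exact (extChartAt_symm_proj v hp).2.2.1
  · exact (extChartAt_symm_proj v (mem_extChartAt_target v)).2.2.1

section

variable {E H M : Type*} [NormedAddCommGroup E] [NormedSpace ℝ E] [TopologicalSpace H]
  [TopologicalSpace M] [ChartedSpace H M] {I : ModelWithCorners ℝ E H}

omit [VectorBundle ℂ ℂ L] in
lemma dmap_totalSpace {f : M → TotalSpace ℂ L} {x : M} (hf : MDifferentiableAt I IL f x) (u : E) :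
    dmap I IL f x u = (dmap I IT (fun y => (f y).proj) x u,
      dmap I 𝓘(ℝ, ℂ) (fun y => fibreCoord (f x).proj (f y)) x u) := by
  have h1 : MDifferentiableAt IL IT (TotalSpace.proj : TotalSpace ℂ L → Torus) (f x) :=
    (Bundle.contMDiff_proj L (n := 1)).mdifferentiable one_ne_zero _
  have h2 : MDifferentiableAt IL 𝓘(ℝ, ℂ) (fibreCoord (f x).proj) (f x) :=
    (contMDiffAt_fibreCoord (mem_baseSet_trivializationAt ..)).mdifferentiableAt (by simp)
  rw [dmap_comp_apply x h1 hf, dmap_comp_apply x h2 hf, dmap_proj, dmap_fibreCoord]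
  rfl

end

lemma dmap_zeroSection (q : Torus) (u : EuclideanSpace ℝ (Fin 1) × EuclideanSpace ℝ (Fin 1)) :
    dmap IT IL (zeroSection ℂ L) q u = (u, 0) := by
  have h1 : (fun y => fibreCoord q (zeroSection ℂ L y)) =ᶠ[𝓝 q] fun _ => 0 := by
    filter_upwards [(trivializationAt ℂ L q).open_baseSet.mem_nhds
      (mem_baseSet_trivializationAt ..)] with y hy
    exact fibreCoord_zero hy
  have hz : ContMDiffAt IT IL 1 (zeroSection ℂ L) q := Bundle.contMDiffAt_zeroSection ℝ L
  rw [dmap_totalSpace (hz.mdifferentiableAt one_ne_zero)]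
  change (dmap IT IT (fun y => y) q u,
    dmap IT 𝓘(ℝ, ℂ) (fun y => fibreCoord q (zeroSection ℂ L y)) q u) = _
  rw [dmap_id, dmap_congr h1, dmap_const]
  rfl

lemma isSmoothEmbedding_zeroSection : IsSmoothEmbedding IT IL ∞ (zeroSection ℂ L) := by
  have hc : Continuous (zeroSection ℂ L) :=
    (Bundle.contMDiff_zeroSection ℝ L : ContMDiff IT IL ∞ _).continuous
  refine ⟨IsImmersionOfComplement.isImmersion (F := ℂ) fun q => ?_, ?_⟩
  · have hO := (trivializationAt ℂ L q).open_baseSet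
    have hq : q ∈ (trivializationAt ℂ L q).baseSet := mem_baseSet_trivializationAt ..
    -- The chart of the base is restricted to the domain of the trivialization.
    refine IsImmersionAtOfComplement.mk_of_continuousAt hc.continuousAt
      (ContinuousLinearEquiv.refl ℝ _) ((chartAt _ q).restr (trivializationAt ℂ L q).baseSet)
      (chartAt _ (zeroSection ℂ L q)) ?_ (mem_chart_source _ _)
      (restr_mem_maximalAtlas _ (IsManifold.chart_mem_maximalAtlas q) hO)
      (IsManifold.chart_mem_maximalAtlas _) fun x hx => ?_
    · rw [OpenPartialHomeomorph.restr_source' _ _ hO]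
      exact ⟨mem_chart_source _ q, hq⟩
    · have h1 := ((chartAt _ q).restr (trivializationAt ℂ L q).baseSet |>.extend IT).map_target hx
      have h2 := ((chartAt _ q).restr (trivializationAt ℂ L q).baseSet |>.extend IT).right_inv hx
      rw [OpenPartialHomeomorph.extend_source, OpenPartialHomeomorph.restr_source' _ _ hO] at h1
      change extChartAt IL (zeroSection ℂ L q) (zeroSection ℂ L _) = (x, 0)
      rw [extChartAt_apply]
      refine Prod.ext ?_ (fibreCoord_zero h1.2)
      exact (congrArg (extChartAt IT q) ((trivializationAt ℂ L q).coe_fst'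
        (x := zeroSection ℂ L _) h1.2)).trans h2
  · exact Topology.IsEmbedding.of_leftInverse (f := TotalSpace.proj) (fun _ => rfl)
      (FiberBundle.continuous_proj ℂ L) hc

end Tangent

/-! ### The normal Hessian -/

/-- The second derivative of `G(x) |c|²` at a point of the zero section. -/
lemma iteratedFDeriv_two_mul_norm_sq {E : Type*} [NormedAddCommGroup E] [NormedSpace ℝ E]
    {G : E → ℝ} {x₀ : E} (hG : ContDiffAt ℝ ∞ G x₀) {F : E × ℂ → ℝ}
    (hF : F =ᶠ[𝓝 (x₀, 0)] fun p => G p.1 * ‖p.2‖ ^ 2) (v : E × ℂ) :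
    iteratedFDeriv ℝ 2 F (x₀, 0) ![v, v] = 2 * G x₀ * ‖v.2‖ ^ 2 := by
  have hF' : ContDiffAt ℝ ∞ F (x₀, 0) := by
    refine ContDiffAt.congr_of_eventuallyEq ?_ hF
    have h1 : ContDiffAt ℝ ∞ (fun p : E × ℂ => G p.1) (x₀, 0) :=
      ContDiffAt.comp (x₀, (0 : ℂ)) hG contDiffAt_fst
    exact h1.mul ((contDiff_norm_sq ℝ).contDiffAt.comp _ contDiffAt_snd)
  -- The derivative of `F` in the direction `v`, near the base point.
  have h1 : ∀ᶠ p in 𝓝 (x₀, (0 : ℂ)), fderiv ℝ F p v =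
      G p.1 * (2 * inner ℝ p.2 v.2) + ‖p.2‖ ^ 2 * fderiv ℝ G p.1 v.1 := by
    have h2 : ∀ᶠ x in 𝓝 x₀, DifferentiableAt ℝ G x :=
      ((hG.of_le (m := 1) (by simp)).eventually (by simp)).mono fun x hx =>
        hx.differentiableAt one_ne_zero
    filter_upwards [hF.eventuallyEq_nhds, continuousAt_fst.eventually h2] with p hp hp2
    rw [hp.fderiv_eq]
    have e1 : HasFDerivAt (fun p : E × ℂ => G p.1)
        ((fderiv ℝ G p.1).comp (ContinuousLinearMap.fst ℝ E ℂ)) p :=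
      HasFDerivAt.comp (g := G) p hp2.hasFDerivAt hasFDerivAt_fst
    have e2 : HasFDerivAt (fun p : E × ℂ => ‖p.2‖ ^ 2)
        ((2 • (innerSL ℝ p.2)).comp (ContinuousLinearMap.snd ℝ E ℂ)) p :=
      HasFDerivAt.comp (g := fun c : ℂ => ‖c‖ ^ 2) p
        (hasStrictFDerivAt_norm_sq p.2).hasFDerivAt hasFDerivAt_snd
    have e3 : HasFDerivAt (fun p : E × ℂ => G p.1 * ‖p.2‖ ^ 2) _ p := e1.mul e2
    rw [e3.fderiv]
    change G p.1 * (2 • inner ℝ p.2 v.2) + ‖p.2‖ ^ 2 * fderiv ℝ G p.1 v.1 = _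
    rw [nsmul_eq_mul, Nat.cast_ofNat]
  have h3 : HasFDerivAt (fderiv ℝ F) (fderiv ℝ (fderiv ℝ F) (x₀, 0)) (x₀, 0) :=
    ((hF'.fderiv_right (m := ∞) (by simp)).differentiableAt (by simp)).hasFDerivAt
  have h4 : HasDerivAt (fun t : ℝ => (x₀ + t • v.1, t • v.2)) v 0 := by
    have := ((hasDerivAt_id (0 : ℝ)).smul_const v).const_add (x₀, (0 : ℂ))
    rw [one_smul] at this
    refine this.congr_of_eventuallyEq (Eventually.of_forall fun t => ?_)
    ext <;> simp
  have h4' : (x₀ + (0 : ℝ) • v.1, (0 : ℝ) • v.2) = (x₀, (0 : ℂ)) := by simp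
  have h5 : HasDerivAt (fun t : ℝ => fderiv ℝ F (x₀ + t • v.1, t • v.2) v)
      (fderiv ℝ (fderiv ℝ F) (x₀, 0) v v) 0 := by
    have := HasFDerivAt.comp_hasDerivAt (0 : ℝ) (by rw [h4']; exact h3) h4
    exact ((ContinuousLinearMap.apply ℝ ℝ v).hasFDerivAt.comp_hasDerivAt (0 : ℝ) this)
  -- Along the line in the direction `v`, that derivative is `t` times a continuous function.
  let ψ : ℝ → ℝ := fun t => G (x₀ + t • v.1) * (2 * ‖v.2‖ ^ 2) +
    t * (‖v.2‖ ^ 2 * fderiv ℝ G (x₀ + t • v.1) v.1)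
  have hψ : ContinuousAt ψ 0 := by
    have c1 : ContinuousAt (fun t : ℝ => x₀ + t • v.1) 0 := by fun_prop
    have c1' : x₀ + (0 : ℝ) • v.1 = x₀ := by simp
    have c2 : ContinuousAt (fun t : ℝ => G (x₀ + t • v.1)) 0 :=
      ContinuousAt.comp (g := G) (by rw [c1']; exact hG.continuousAt) c1
    have c3 : ContinuousAt (fun t : ℝ => fderiv ℝ G (x₀ + t • v.1)) 0 :=
      ContinuousAt.comp (g := fderiv ℝ G)
        (by rw [c1']; exact (hG.fderiv_right (m := ∞) (by simp)).continuousAt) c1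
    exact (c2.mul continuousAt_const).add
      (continuousAt_id.mul (continuousAt_const.mul (c3.clm_apply continuousAt_const)))
  have h6 : HasDerivAt (fun t : ℝ => t * ψ t) (ψ 0) 0 := by
    rw [hasDerivAt_iff_tendsto_slope]
    refine (hψ.tendsto.mono_left nhdsWithin_le_nhds).congr' ?_
    filter_upwards [self_mem_nhdsWithin] with t ht
    have ht : t ≠ 0 := ht
    simp [slope, ht]
  have h7 : HasDerivAt (fun t : ℝ => fderiv ℝ F (x₀ + t • v.1, t • v.2) v) (ψ 0) 0 := by
    refine h6.congr_of_eventuallyEq ?_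
    rw [← h4'] at h1
    filter_upwards [h4.continuousAt.eventually h1] with t ht
    rw [ht, norm_smul, real_inner_smul_left, real_inner_self_eq_norm_sq, mul_pow,
      Real.norm_eq_abs, sq_abs]
    simp only [ψ]
    ring
  rw [iteratedFDeriv_two_apply]
  simp only [Matrix.cons_val_zero, Matrix.cons_val_one]
  rw [h5.unique h7]
  simp only [ψ, zero_smul, add_zero, zero_mul]
  ring

section StandardModel

variable {L : Torus → Type*} [∀ q, AddCommGroup (L q)] [∀ q, Module ℂ (L q)]
  [∀ q, TopologicalSpace (L q)] [TopologicalSpace (TotalSpace ℂ L)] [FiberBundle ℂ L]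
  [VectorBundle ℂ ℂ L] [VectorBundle ℝ ℂ L] [ContMDiffVectorBundle ∞ ℂ L IT]
  (h : HermitianMetric L)

omit [VectorBundle ℝ ℂ L] [ContMDiffVectorBundle ∞ ℂ L IT] in
lemma radius_sq_extChartAt_symm (q : Torus) :
    ((fun v => h.radius v ^ 2) ∘ (extChartAt IL (zeroSection ℂ L q)).symm)
      =ᶠ[𝓝 (extChartAt IT q q, 0)] fun p =>
        h.radius ((extChartAt IL (zeroSection ℂ L q)).symm (p.1, 1)) ^ 2 * ‖p.2‖ ^ 2 := by
  have h1 : ∀ᶠ p in 𝓝 (extChartAt IT q q, (0 : ℂ)),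
      p ∈ (extChartAt IL (zeroSection ℂ L q)).target :=
    (isOpen_extChartAt_target _).mem_nhds (prod_mem_extChartAt_target (zeroSection ℂ L q) 0)
  have h2 : ∀ᶠ p in 𝓝 (extChartAt IT q q, (0 : ℂ)),
      (p.1, (1 : ℂ)) ∈ (extChartAt IL (zeroSection ℂ L q)).target := by
    have hc : ContinuousAt (fun p : _ × ℂ => (p.1, (1 : ℂ))) (extChartAt IT q q, (0 : ℂ)) := by
      fun_prop
    exact hc.eventually ((isOpen_extChartAt_target _).mem_nhds
      (prod_mem_extChartAt_target (zeroSection ℂ L q) 1))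
  filter_upwards [h1, h2] with p hp hp'
  obtain ⟨a1, a2, a3, a4⟩ := extChartAt_symm_proj _ hp
  obtain ⟨b1, b2, b3, b4⟩ := extChartAt_symm_proj _ hp'
  have key : (extChartAt IL (zeroSection ℂ L q)).symm p =
      scale p.2 ((extChartAt IL (zeroSection ℂ L q)).symm (p.1, 1)) := by
    have hproj : ((extChartAt IL (zeroSection ℂ L q)).symm p).proj =
        ((extChartAt IL (zeroSection ℂ L q)).symm (p.1, 1)).proj :=
      (extChartAt IT q).injOn a4 b4 (a2.trans b2.symm)
    have hs : scale p.2 ((extChartAt IL (zeroSection ℂ L q)).symm (p.1, 1)) ∈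
      (trivializationAt ℂ L q).source := (trivializationAt ℂ L q).mem_source.2 b1
    refine (trivializationAt ℂ L q).injOn ((trivializationAt ℂ L q).mem_source.2 a1) hs ?_
    refine Prod.ext ?_ ?_
    · refine ((trivializationAt ℂ L q).coe_fst' a1).trans (hproj.trans ?_)
      exact ((trivializationAt ℂ L q).coe_fst (x := scale p.2 _) hs).symm
    · refine a3.trans ?_
      have := fibreCoord_smul b1 p.2 ((extChartAt IL (zeroSection ℂ L q)).symm (p.1, 1)).2
      exact ((this.trans (congrArg (p.2 * ·) b3)).trans (mul_one _)).symm
  rw [comp_apply, key, radius_scale]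
  ring

/-- The normal Hessian of `r²` along the zero section is twice the Hermitian metric, hence
positive definite. -/
lemma hessian_radius_sq_pos (q : Torus) (v : TangentSpace IL (zeroSection ℂ L q))
    (hv : v ∉ range (mfderiv IT IL (zeroSection ℂ L) q)) :
    0 < hessian IL (fun v => h.radius v ^ 2) (zeroSection ℂ L q) v v := by
  have hv2 : (v : (EuclideanSpace ℝ (Fin 1) × EuclideanSpace ℝ (Fin 1)) × ℂ).2 ≠ 0 := fun h0 =>
    hv ⟨v.1, (dmap_zeroSection q v.1).trans (Prod.ext rfl h0.symm)⟩
  let G : EuclideanSpace ℝ (Fin 1) × EuclideanSpace ℝ (Fin 1) → ℝ := fun x =>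
    h.radius ((extChartAt IL (zeroSection ℂ L q)).symm (x, 1)) ^ 2
  have hmem : (extChartAt IT q q, (1 : ℂ)) ∈ (extChartAt IL (zeroSection ℂ L q)).target :=
    prod_mem_extChartAt_target (zeroSection ℂ L q) 1
  have hG : ContDiffAt ℝ ∞ G (extChartAt IT q q) := by
    have h1 := ((contMDiffOn_extChartAt_symm (I := IL) (n := ∞) (zeroSection ℂ L q)).contMDiffAt
      ((isOpen_extChartAt_target _).mem_nhds hmem))
    have h2 : ContMDiffAt 𝓘(ℝ, EuclideanSpace ℝ (Fin 1) × EuclideanSpace ℝ (Fin 1))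
        𝓘(ℝ, (EuclideanSpace ℝ (Fin 1) × EuclideanSpace ℝ (Fin 1)) × ℂ) ∞
        (fun x => (x, (1 : ℂ))) (extChartAt IT q q) :=
      (contDiff_id.prodMk contDiff_const).contMDiff.contMDiffAt
    have h3 := ContMDiffAt.comp (extChartAt IT q q) h1 h2
    exact ((contMDiff_radius_sq h).contMDiffAt.comp (extChartAt IT q q) h3).contDiffAt
  have hpos : 0 < G (extChartAt IT q q) := by
    obtain ⟨b1, -, b3, -⟩ := extChartAt_symm_proj _ hmem
    refine pow_pos (radius_pos h fun h0 => ?_) 2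
    have h1 := fibreCoord_zero b1
    rw [← h0] at h1
    exact zero_ne_one (h1.symm.trans b3)
  have key := iteratedFDeriv_two_mul_norm_sq hG (radius_sq_extChartAt_symm h q) v
  have h0 : extChartAt IL (zeroSection ℂ L q) (zeroSection ℂ L q) = (extChartAt IT q q, 0) := by
    rw [extChartAt_self_eq]
    exact Prod.ext rfl (fibreCoord_zero (mem_baseSet_trivializationAt ..))
  rw [hessian, h0, ModelWithCorners.range_eq_univ, iteratedFDerivWithin_univ]
  refine lt_of_lt_of_eq ?_ key.symm
  have := norm_pos_iff.2 hv2
  positivity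

omit [VectorBundle ℂ ℂ L] [VectorBundle ℝ ℂ L] [ContMDiffVectorBundle ∞ ℂ L IT] in
lemma mfderiv_radius_sq_zeroSection (q : Torus) :
    mfderiv IL 𝓘(ℝ, ℝ) (fun v => h.radius v ^ 2) (zeroSection ℂ L q) = 0 := by
  have h1 : MDifferentiableAt IL 𝓘(ℝ, ℝ) (fun v => h.radius v ^ 2) (zeroSection ℂ L q) :=
    (contMDiff_radius_sq h).mdifferentiable (by simp) _
  refine h1.mfderiv.trans ?_
  rw [ModelWithCorners.range_eq_univ, fderivWithin_univ]
  refine IsLocalMin.fderiv_eq_zero (Eventually.of_forall fun p => ?_)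
  have : h.radius (zeroSection ℂ L q) = 0 := (radius_eq_zero_iff h).2 rfl
  simp only [writtenInExtChartAt, comp_apply, extChartAt_to_inv, this]
  simp
  exact sq_nonneg _

/-! ### The boundary fibration -/

omit [VectorBundle ℂ ℂ L] [VectorBundle ℝ ℂ L] [ContMDiffVectorBundle ∞ ℂ L IT] in
lemma contMDiff_standardMap : ContMDiff IL IC ∞ (standardMap h) := fun v =>
  ContMDiffAt.prodMk ((Bundle.contMDiff_proj L).contMDiffAt.fst)
    (contMDiffAt_halfLinePoint (contMDiff_radius_sq h v) fun v => sq_nonneg (h.radius v))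

omit [VectorBundle ℂ ℂ L] [VectorBundle ℝ ℂ L] [ContMDiffVectorBundle ∞ ℂ L IT] in
lemma standardMap_eq_iff {v : TotalSpace ℂ L} {y : HalfCylinder} :
    standardMap h v = y ↔ v.proj.1 = y.1 ∧ h.radius v ^ 2 = halfLineCoord y.2 := by
  rw [Prod.ext_iff, ← halfLineCoord_injective.eq_iff]
  simp [standardMap]

omit [VectorBundle ℂ ℂ L] [VectorBundle ℝ ℂ L] [ContMDiffVectorBundle ∞ ℂ L IT] in
lemma standardMap_preimage_boundary :
    standardMap h ⁻¹' range boundaryCircle = range (zeroSection ℂ L) := by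
  ext v
  rw [mem_preimage, mem_range_boundaryCircle]
  simp only [standardMap, halfLineCoord_halfLinePoint, pow_eq_zero_iff two_ne_zero,
    radius_eq_zero_iff]
  constructor
  · intro h0
    exact ⟨v.proj, by rw [← v.eta, h0]; rfl⟩
  · rintro ⟨q, rfl⟩; rfl

lemma isFibratingBoundaryMap_standardMap :
    IsFibratingBoundaryMap IL IC IT (𝓡 1) (standardMap h) (zeroSection ℂ L) boundaryCircle where
  smooth := contMDiff_standardMap h
  embedding_source := isSmoothEmbedding_zeroSection
  embedding_target := isSmoothEmbedding_boundaryCircle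
  hypersurface := by simp
  codim_ge_two := by simp
  preimage_eq := standardMap_preimage_boundary h
  normalHessian_definite := fun q => by
    have he : (fun y : HalfCylinder => halfLineCoord y.2) ∘ standardMap h =
        fun v => h.radius v ^ 2 := funext fun v => by simp [standardMap]
    refine ⟨univ, fun y => halfLineCoord y.2, mem_univ _, isDefiningFunctionOn_halfLineCoord,
      ?_, .inl fun v hv => ?_⟩
    · rw [he]; exact mfderiv_radius_sq_zeroSection h q
    · rw [he]; exact hessian_radius_sq_pos h q v hv
  submersive := by
    refine ⟨Prod.fst, contMDiff_fst, fun q => ?_, fun q => ?_⟩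
    · refine ((standardMap_eq_iff h).2 ⟨rfl, ?_⟩).symm
      have : h.radius (zeroSection ℂ L q) = 0 := (radius_eq_zero_iff h).2 rfl
      simp [boundaryCircle, this]
    · rw [mfderiv_fst]
      exact fun u => ⟨(u, 0), rfl⟩

variable {n : ℤ} {S : ℝ × Circle → TotalSpace ℂ L} {h}

/-- The coordinates of the point `v` in its fibre of the standard map with respect to the frame `S`:
the phase of `v` and the second coordinate of its base point. The first coordinate of the base point
is lifted to the line near `t₀`. -/
def fibrePhase (S : ℝ × Circle → TotalSpace ℂ L) (t₀ : ℝ) (v : TotalSpace ℂ L) : Torus :=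
  (phase (ratio (S (argLift t₀ v.proj.1, v.proj.2)) v), v.proj.2)

omit [VectorBundle ℝ ℂ L] [ContMDiffVectorBundle ∞ ℂ L IT] in
lemma IsUnitFrame.norm_ratio (hS : IsUnitFrame h n S) (t₀ : ℝ) (v : TotalSpace ℂ L) :
    ‖ratio (S (argLift t₀ v.proj.1, v.proj.2)) v‖ = h.radius v := by
  conv_rhs => rw [← scale_ratio (v := S (argLift t₀ v.proj.1, v.proj.2)) (w := v) (hS.ne_zero _)
    (by rw [hS.proj, circ_argLift]), radius_scale, hS.radius, mul_one]

omit [VectorBundle ℝ ℂ L] [ContMDiffVectorBundle ∞ ℂ L IT] in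
lemma IsUnitFrame.scale_fibrePhase (hS : IsUnitFrame h n S) (t₀ : ℝ) (v : TotalSpace ℂ L) :
    scale (h.radius v * (fibrePhase S t₀ v).1)
      (S (argLift t₀ v.proj.1, (fibrePhase S t₀ v).2)) = v := by
  rw [fibrePhase, ← hS.norm_ratio t₀ v, mul_comm, phase_mul_norm]
  exact scale_ratio (hS.ne_zero _) (by rw [hS.proj, circ_argLift])

omit [VectorBundle ℝ ℂ L] [ContMDiffVectorBundle ∞ ℂ L IT] in
lemma IsUnitFrame.fibrePhase_scale (hS : IsUnitFrame h n S) {t₀ t : ℝ}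
    (ht : argLift t₀ (circ t) = t) {r : ℝ} (hr : 0 < r) (q : Torus) :
    fibrePhase S t₀ (scale (r * q.1) (S (t, q.2))) = q := by
  rw [fibrePhase, scale_proj, hS.proj, ht, ratio_scale (hS.ne_zero _), phase_mul_circle hr]

lemma IsUnitFrame.contMDiffAt_fibrePhase (hS : IsUnitFrame h n S) {t₀ : ℝ} {v : TotalSpace ℂ L}
    (hv : v.proj.1 ∈ arc t₀) (h0 : v.2 ≠ 0) : ContMDiffAt IL IT ∞ (fibrePhase S t₀) v := by
  have hproj : ContMDiffAt IL IT ∞ (TotalSpace.proj : TotalSpace ℂ L → Torus) v :=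
    (Bundle.contMDiff_proj L).contMDiffAt
  have h1 : ContMDiffAt IL 𝓘(ℝ, ℝ) ∞ (fun v : TotalSpace ℂ L => argLift t₀ v.proj.1) v :=
    ContMDiffAt.comp (g := argLift t₀) v (contMDiffAt_argLift hv) hproj.fst
  have h2 : ContMDiffAt IL IL ∞ (fun v : TotalSpace ℂ L => S (argLift t₀ v.proj.1, v.proj.2)) v :=
    ContMDiffAt.comp (g := S) v hS.smooth.contMDiffAt (h1.prodMk hproj.snd)
  have h3 := ContMDiffAt.ratio h2 (contMDiffAt_id (x := v))
    (Eventually.of_forall fun w => hS.ne_zero _)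
    (Eventually.of_forall fun w => by rw [hS.proj, circ_argLift]; rfl)
  have h4 : ratio (S (argLift t₀ v.proj.1, v.proj.2)) v ≠ 0 := by
    rw [← norm_ne_zero_iff, hS.norm_ratio]
    exact (radius_pos h h0).ne'
  exact (ContMDiffAt.comp (g := phase)
    (f := fun v : TotalSpace ℂ L => ratio (S (argLift t₀ v.proj.1, v.proj.2)) v) v
    (contMDiffAt_phase h4) h3).prodMk hproj.snd

/-- Over an arc of the circle, a unit frame trivializes the complement of the zero section. -/
lemma IsUnitFrame.isFibrationOver (hS : IsUnitFrame h n S) :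
    IsFibrationOver IL IC (standardMap h) (range boundaryCircle)ᶜ := by
  intro y hy
  obtain ⟨t₀, ht₀⟩ := exists_circ_eq y.1
  have hy2 : 0 < halfLineCoord y.2 := (halfLineCoord_nonneg _).lt_of_ne
    fun h0 => hy (mem_range_boundaryCircle.2 h0.symm)
  let Ψ : HalfCylinder × Torus → TotalSpace ℂ L := fun p =>
    scale ((Real.sqrt (halfLineCoord p.1.2) : ℂ) * (p.2.1 : ℂ)) (S (argLift t₀ p.1.1, p.2.2))
  refine ⟨Prod.fst ⁻¹' arc t₀ ∩ {y | 0 < halfLineCoord y.2}, ?_, ⟨?_, hy2⟩, fun u hu hu' => ?_,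
    _, _, _, inferInstance, _, _, IT, inferInstance, Torus, _, _, inferInstance, inferInstance,
    fibrePhase S t₀, Ψ, fun v hv => ?_, fun p hp => ?_, fun v hv => ?_, fun u hu q => ?_⟩
  · exact ((isOpen_arc t₀).preimage continuous_fst).inter
      (isOpen_lt continuous_const (contMDiff_halfLineCoord.continuous.comp continuous_snd))
  · rw [mem_preimage, ← ht₀]; exact circ_mem_arc t₀
  · exact hu.2.ne' (mem_range_boundaryCircle.1 hu')
  · refine (hS.contMDiffAt_fibrePhase hv.1 fun h0 => ?_).contMDiffWithinAt
    have := hv.2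
    rw [mem_ofPred_eq, standardMap, halfLineCoord_halfLinePoint,
      (radius_eq_zero_iff h).2 h0] at this
    simp at this
  · have h1 : ContMDiffAt (IC.prod IT) 𝓘(ℝ, ℝ) ∞
        (fun p : HalfCylinder × Torus => argLift t₀ p.1.1) p :=
      ContMDiffAt.comp (g := argLift t₀) p (contMDiffAt_argLift hp.1.1) contMDiffAt_fst.fst
    have h2 : ContMDiffAt (IC.prod IT) IL ∞
        (fun p : HalfCylinder × Torus => S (argLift t₀ p.1.1, p.2.2)) p :=
      ContMDiffAt.comp (g := S) p hS.smooth.contMDiffAt (h1.prodMk contMDiffAt_snd.snd)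
    have h3 : ContMDiffAt (IC.prod IT) 𝓘(ℝ, ℝ) ∞
        (fun p : HalfCylinder × Torus => halfLineCoord p.1.2) p :=
      ContMDiffAt.comp (g := halfLineCoord) p contMDiff_halfLineCoord.contMDiffAt
        contMDiffAt_fst.snd
    have h4 : ContDiffAt ℝ ∞ (fun s : ℝ => ((Real.sqrt s : ℝ) : ℂ)) (halfLineCoord p.1.2) :=
      Complex.ofRealCLM.contDiff.contDiffAt.comp _ (Real.contDiffAt_sqrt hp.1.2.ne')
    have h5 : ContMDiffAt (IC.prod IT) 𝓘(ℝ, ℂ) ∞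
        (fun p : HalfCylinder × Torus => (p.2.1 : ℂ)) p :=
      ContMDiffAt.comp (g := fun z : Circle => (z : ℂ)) p contMDiff_circle_coe.contMDiffAt
        contMDiffAt_snd.fst
    have h6 : ContMDiffAt (IC.prod IT) 𝓘(ℝ, ℂ) ∞
        (fun p : HalfCylinder × Torus => ((Real.sqrt (halfLineCoord p.1.2) : ℝ) : ℂ)) p :=
      ContMDiffAt.comp (g := fun s : ℝ => ((Real.sqrt s : ℝ) : ℂ)) p h4.contMDiffAt h3
    have h7 : ContDiff ℝ ∞ fun c : ℂ × ℂ => c.1 * c.2 := contDiff_fst.mul contDiff_snd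
    exact (ContMDiffAt.scale (ContMDiffAt.comp (g := fun c : ℂ × ℂ => c.1 * c.2) p
      h7.contMDiff.contMDiffAt (h6.prodMk_space h5)) h2).contMDiffWithinAt
  · refine Eq.trans ?_ (hS.scale_fibrePhase t₀ v)
    simp only [Ψ, standardMap, halfLineCoord_halfLinePoint, Real.sqrt_sq (radius_nonneg h v)]
  · have hs : 0 < Real.sqrt (halfLineCoord u.2) := Real.sqrt_pos.2 hu.2
    refine ⟨(standardMap_eq_iff h).2 ⟨?_, ?_⟩, hS.fibrePhase_scale (by rw [circ_argLift]) hs q⟩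
    · simp only [Ψ, scale_proj, hS.proj, circ_argLift]
    · simp only [Ψ, radius_scale, hS.radius, norm_mul, Circle.norm_coe, Complex.norm_real,
        mul_one, Real.norm_eq_abs, sq_abs]
      exact Real.sq_sqrt (halfLineCoord_nonneg _)

theorem IsUnitFrame.isBoundaryFibration (hS : IsUnitFrame h n S) :
    IsBoundaryFibration IL IC IT (𝓡 1) (standardMap h) (zeroSection ℂ L) boundaryCircle :=
  { isFibratingBoundaryMap_standardMap h with fibration := hS.isFibrationOver }

end StandardModel

/-! ### The twist of the torus -/

/-- The diffeomorphism `(w, y) ↦ (w · circStaircase y, y)` of the torus. -/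
def torusTwist : Torus ≃ₘ⟮IT, IT⟯ Torus where
  toFun q := (q.1 * circStaircase q.2, q.2)
  invFun q := (q.1 * (circStaircase q.2)⁻¹, q.2)
  left_inv q := by simp
  right_inv q := by simp
  contMDiff_toFun := (contMDiff_fst.mul (contMDiff_circStaircase.comp contMDiff_snd)).prodMk
    contMDiff_snd
  contMDiff_invFun := (contMDiff_fst.mul (contMDiff_circStaircase.comp contMDiff_snd).inv).prodMk
    contMDiff_snd

lemma torusTwist_apply (q : Torus) : torusTwist q = (q.1 * circStaircase q.2, q.2) := rfl

lemma torusTwist_zpow_apply (m : ℤ) (q : Torus) :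
    (torusTwist ^ m) q = (q.1 * circStaircase q.2 ^ m, q.2) := by
  have hmul : ∀ (φ ψ : Torus ≃ₘ⟮IT, IT⟯ Torus) q, (φ * ψ) q = φ (ψ q) := fun _ _ _ => rfl
  have hinv : ∀ q, (torusTwist⁻¹ : Torus ≃ₘ⟮IT, IT⟯ Torus) q = (q.1 * (circStaircase q.2)⁻¹, q.2) :=
    fun _ => rfl
  induction m generalizing q with
  | zero => rw [zpow_zero, zpow_zero, mul_one]; rfl
  | succ m ih => rw [zpow_add_one, hmul, ih, torusTwist_apply, zpow_add_one, mul_assoc,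
      mul_comm (circStaircase q.2)]
  | pred m ih => rw [zpow_sub_one, hmul, ih, hinv, zpow_sub_one, mul_assoc,
      mul_comm (circStaircase q.2)⁻¹]

/-! ### The mapping torus of the standard model -/

section MappingTorus

variable {L : Torus → Type*} [∀ q, AddCommGroup (L q)] [∀ q, Module ℂ (L q)]
  [∀ q, TopologicalSpace (L q)] [TopologicalSpace (TotalSpace ℂ L)] [FiberBundle ℂ L]
  [VectorBundle ℂ ℂ L] [VectorBundle ℝ ℂ L] [ContMDiffVectorBundle ∞ ℂ L IT]
  {h : HermitianMetric L} {n : ℤ} {S : ℝ × Circle → TotalSpace ℂ L} {ε : ℝ}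

/-- The fibre of the standard map over `γ(t)` is the circle bundle of radius `√ε` over a circle. It
is parametrized by the phase with respect to the frame `S` and by the point of the circle. -/
def modelMap (S : ℝ × Circle → TotalSpace ℂ L) (ε : ℝ) (p : ℝ × Torus) : TotalSpace ℂ L :=
  scale ((Real.sqrt ε : ℝ) * p.2.1) (S (p.1, p.2.2))

omit [VectorBundle ℂ ℂ L] [VectorBundle ℝ ℂ L] [ContMDiffVectorBundle ∞ ℂ L IT] in
lemma IsUnitFrame.proj_modelMap (hS : IsUnitFrame h n S) (t : ℝ) (q : Torus) :
    (modelMap S ε (t, q)).proj = (circ t, q.2) := hS.proj t q.2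

omit [VectorBundle ℂ ℂ L] [VectorBundle ℝ ℂ L] [ContMDiffVectorBundle ∞ ℂ L IT] in
lemma IsUnitFrame.radius_sq_modelMap (hS : IsUnitFrame h n S) (hε : 0 < ε) (p : ℝ × Torus) :
    h.radius (modelMap S ε p) ^ 2 = ε := by
  simp only [modelMap, radius_scale, hS.radius, norm_mul, Circle.norm_coe, Complex.norm_real,
    mul_one, Real.norm_eq_abs, sq_abs]
  exact Real.sq_sqrt hε.le

omit [VectorBundle ℂ ℂ L] [VectorBundle ℝ ℂ L] [ContMDiffVectorBundle ∞ ℂ L IT] in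
lemma IsUnitFrame.modelMap_snd_ne_zero (hS : IsUnitFrame h n S) (hε : 0 < ε) (p : ℝ × Torus) :
    (modelMap S ε p).2 ≠ 0 := fun h0 => by
  have := hS.radius_sq_modelMap hε p
  rw [(radius_eq_zero_iff h).2 h0] at this
  exact hε.ne (by simpa using this)

omit [VectorBundle ℂ ℂ L] [VectorBundle ℝ ℂ L] [ContMDiffVectorBundle ∞ ℂ L IT] in
lemma standardMap_eq_gammaCircle_iff {hε : 0 < ε} {v : TotalSpace ℂ L} {t : ℝ} :
    standardMap h v = gammaCircle ε hε t ↔ v.proj.1 = circ t ∧ h.radius v ^ 2 = ε := by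
  rw [standardMap_eq_iff, gammaCircle, halfLineCoord_halfLinePoint]

omit [VectorBundle ℂ ℂ L] [VectorBundle ℝ ℂ L] [ContMDiffVectorBundle ∞ ℂ L IT] in
lemma IsUnitFrame.standardMap_modelMap (hS : IsUnitFrame h n S) (hε : 0 < ε) (t : ℝ) (q : Torus) :
    standardMap h (modelMap S ε (t, q)) = gammaCircle ε hε t :=
  standardMap_eq_gammaCircle_iff.2 ⟨by rw [hS.proj_modelMap], hS.radius_sq_modelMap hε _⟩

lemma IsUnitFrame.contMDiff_modelMap (hS : IsUnitFrame h n S) :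
    ContMDiff (𝓘(ℝ, ℝ).prod IT) IL ∞ (modelMap S ε) := fun p => by
  have h1 : ContMDiffAt (𝓘(ℝ, ℝ).prod IT) IL ∞ (fun p : ℝ × Torus => S (p.1, p.2.2)) p :=
    ContMDiffAt.comp (g := S) p hS.smooth.contMDiffAt (contMDiffAt_fst.prodMk contMDiffAt_snd.snd)
  have h2 : ContMDiff (𝓡 1) 𝓘(ℝ, ℂ) ∞ fun z : Circle => (Real.sqrt ε : ℂ) * (z : ℂ) :=
    ContMDiff.comp (g := fun c : ℂ => (Real.sqrt ε : ℂ) * c) (I' := 𝓘(ℝ, ℂ))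
      (contDiff_const.mul contDiff_id).contMDiff contMDiff_circle_coe
  exact ContMDiffAt.scale (ContMDiffAt.comp (g := fun z : Circle => (Real.sqrt ε : ℂ) * (z : ℂ)) p
    h2.contMDiffAt contMDiffAt_snd.fst) h1

omit [VectorBundle ℝ ℂ L] [ContMDiffVectorBundle ∞ ℂ L IT] in
lemma IsUnitFrame.fibrePhase_modelMap (hS : IsUnitFrame h n S) (hε : 0 < ε) {t₀ t : ℝ}
    (ht : |t - t₀| < 1 / 2) (q : Torus) : fibrePhase S t₀ (modelMap S ε (t, q)) = q :=
  hS.fibrePhase_scale (argLift_circ ht) (Real.sqrt_pos.2 hε) q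

omit [VectorBundle ℝ ℂ L] [ContMDiffVectorBundle ∞ ℂ L IT] in
lemma IsUnitFrame.modelMap_fibrePhase (hS : IsUnitFrame h n S) {t₀ t : ℝ} (ht : |t - t₀| < 1 / 2)
    {v : TotalSpace ℂ L} (hv : v.proj.1 = circ t) (hr : h.radius v ^ 2 = ε) :
    modelMap S ε (t, fibrePhase S t₀ v) = v := by
  refine Eq.trans ?_ (hS.scale_fibrePhase t₀ v)
  rw [modelMap, ← hr, Real.sqrt_sq (radius_nonneg h v), hv, argLift_circ ht]

lemma IsUnitFrame.injective_dmap_modelMap (hS : IsUnitFrame h n S) (hε : 0 < ε) (p : ℝ × Torus) :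
    Injective (dmap (𝓘(ℝ, ℝ).prod IT) IL (modelMap S ε) p) := by
  obtain ⟨t, q⟩ := p
  -- A smooth local left inverse.
  let K : TotalSpace ℂ L → ℝ × Torus := fun v => (argLift t v.proj.1, fibrePhase S t v)
  have harc : (modelMap S ε (t, q)).proj.1 ∈ arc t := by
    rw [hS.proj_modelMap]; exact circ_mem_arc t
  have hK : ContMDiffAt IL (𝓘(ℝ, ℝ).prod IT) ∞ K (modelMap S ε (t, q)) := by
    have hproj : ContMDiffAt IL IT ∞ (TotalSpace.proj : TotalSpace ℂ L → Torus)
      (modelMap S ε (t, q)) := (Bundle.contMDiff_proj L).contMDiffAt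
    exact (ContMDiffAt.comp (g := argLift t) (modelMap S ε (t, q)) (contMDiffAt_argLift harc)
      hproj.fst).prodMk (hS.contMDiffAt_fibrePhase harc (hS.modelMap_snd_ne_zero hε _))
  have hKH : (fun p => K (modelMap S ε p)) =ᶠ[𝓝 (t, q)] fun p => p := by
    have h1 : ∀ᶠ p : ℝ × Torus in 𝓝 (t, q), |p.1 - t| < 1 / 2 := by
      have hc : Continuous fun p : ℝ × Torus => |p.1 - t| := by fun_prop
      exact (hc.tendsto (t, q)).eventually_lt_const (by simp)
    filter_upwards [h1] with p hp
    exact Prod.ext (by simp only [K, hS.proj_modelMap, argLift_circ hp])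
      (hS.fibrePhase_modelMap hε hp p.2)
  intro u u' huu
  have key := fun u => dmap_comp_apply (t, q) (hK.mdifferentiableAt (by simp))
    (hS.contMDiff_modelMap.mdifferentiable (by simp) (t, q)) u
  have h2 : ∀ u, dmap (𝓘(ℝ, ℝ).prod IT) (𝓘(ℝ, ℝ).prod IT) (fun p => K (modelMap S ε p))
      (t, q) u = u :=
    fun u => by rw [dmap_congr hKH, dmap_id]; rfl
  rw [← h2 u, ← h2 u', key, key, huu]

/-- The circle bundle of radius `√ε` is the mapping torus of a power of the twist. -/
lemma IsUnitFrame.isMappingTorus (hS : IsUnitFrame h n S) (hε : 0 < ε) :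
    IsMappingTorus IT IL (standardMap h) (gammaCircle ε hε) (torusTwist ^ (-n)) (modelMap S ε) where
  smooth := hS.contMDiff_modelMap
  immersive := hS.injective_dmap_modelMap hε
  injective := fun t q q' hq => by
    have ht : |t - t| < 1 / 2 := by simp
    have := congrArg (fibrePhase S t) hq
    simpa only [hS.fibrePhase_modelMap hε ht] using this
  range_eq := fun t => by
    ext v
    rw [mem_preimage, mem_singleton_iff]
    constructor
    · rintro ⟨q, rfl⟩; exact hS.standardMap_modelMap hε t q
    · intro hv
      rw [standardMap_eq_gammaCircle_iff] at hv
      exact ⟨fibrePhase S t v, hS.modelMap_fibrePhase (by simp) hv.1 hv.2⟩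
  glue := fun t q => by
    rw [torusTwist_zpow_apply, modelMap, modelMap, hS.translate, scale_scale, Circle.coe_mul,
      mul_assoc]

end MappingTorus

/-! ### Linear algebra of adapted frames -/

section LinearAlgebra

variable {V W B : Type*} [AddCommGroup V] [Module ℝ V] [AddCommGroup W] [Module ℝ W]
  [AddCommGroup B] [Module ℝ B]

lemma alternatingMap_adapted (g : V [⋀^Fin 4]→ₗ[ℝ] ℝ) (e : Module.Basis (Fin 4) ℝ V)
    (p p' q q' a b c d : ℝ) :
    g ![e 0 + p • e 2 + p' • e 3, e 1 + q • e 2 + q' • e 3, a • e 2 + b • e 3, c • e 2 + d • e 3] =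
      (a * d - b * c) * g e := by
  rw [AlternatingMap.eq_smul_basis_det e g, AlternatingMap.smul_apply, AlternatingMap.smul_apply,
    Module.Basis.det_self, Module.Basis.det_apply]
  have : e.toMatrix ![e 0 + p • e 2 + p' • e 3, e 1 + q • e 2 + q' • e 3, a • e 2 + b • e 3,
      c • e 2 + d • e 3] = !![1, 0, 0, 0; 0, 1, 0, 0; p, q, a, c; p', q', b, d] := by
    ext i j
    fin_cases i <;> fin_cases j <;> simp [Module.Basis.toMatrix_apply]
  rw [this]
  simp [Matrix.det_succ_row_zero, Fin.sum_univ_succ, Fin.succAbove]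
  ring

/-- Two vectors with the same image under a map that kills the last two vectors of a frame, and is
injective on the first two, differ by a combination of the last two. -/
lemma exists_eq_add_comb (e : Module.Basis (Fin 4) ℝ V) (f : V →ₗ[ℝ] W)
    (hf : ∀ x y : ℝ, x • f (e 0) + y • f (e 1) = 0 → x = 0 ∧ y = 0)
    (h2 : f (e 2) = 0) (h3 : f (e 3) = 0) {v v' : V} (hv : f v' = f v) :
    ∃ p q : ℝ, v' = v + p • e 2 + q • e 3 := by
  have h := e.sum_repr (v' - v)
  simp only [Fin.sum_univ_four] at h
  have h0 : f (v' - v) = 0 := by rw [map_sub, hv, sub_self]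
  rw [← h] at h0
  simp only [map_add, map_smul, h2, h3, smul_zero, add_zero] at h0
  obtain ⟨h4, h5⟩ := hf _ _ h0
  rw [h4, h5, zero_smul, zero_smul, zero_add, zero_add] at h
  exact ⟨_, _, by rw [add_assoc, h]; abel⟩

/-- The orientation of the kernel of `f` does not depend on the frame `e` whose first two vectors
lift a frame of `W`, and the orientation of `V` does not depend on the basis `b` whose first two
vectors lift a frame of `B` and whose last two vectors are a complex frame of a line. -/
lemma det_pos_of_adapted {b b' : Module.Basis (Fin 4) ℝ V} {ρ : V →ₗ[ℝ] B} {f : V →ₗ[ℝ] W}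
    (hρ : ∀ x y : ℝ, x • ρ (b 0) + y • ρ (b 1) = 0 → x = 0 ∧ y = 0)
    (hρ0 : ρ (b' 0) = ρ (b 0)) (hρ1 : ρ (b' 1) = ρ (b 1)) (hρ2 : ρ (b 2) = 0) (hρ3 : ρ (b 3) = 0)
    {α β : ℝ} (hb2 : b' 2 = α • b 2 + β • b 3) (hb3 : b' 3 = -β • b 2 + α • b 3)
    {e e' : Fin 4 → V} (he : 0 < b.det e) (he' : 0 < b'.det e')
    (hf : ∀ x y : ℝ, x • f (e 0) + y • f (e 1) = 0 → x = 0 ∧ y = 0)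
    (hf0 : f (e' 0) = f (e 0)) (hf1 : f (e' 1) = f (e 1)) (hf2 : f (e 2) = 0) (hf3 : f (e 3) = 0)
    {a₁ a₂ a₃ a₄ : ℝ} (h2 : e' 2 = a₁ • e 2 + a₂ • e 3) (h3 : e' 3 = a₃ • e 2 + a₄ • e 3) :
    0 < a₁ * a₄ - a₂ * a₃ := by
  have hunit : IsUnit (b.det e) := he.ne'.isUnit
  obtain ⟨hli, hsp⟩ := (Module.Basis.is_basis_iff_det b).2 hunit
  let E : Module.Basis (Fin 4) ℝ V := Module.Basis.mk hli hsp.ge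
  have hE : ⇑E = e := Module.Basis.coe_mk _ _
  have hEi : ∀ i, E i = e i := congrFun hE
  have four : ∀ u : Fin 4 → V, u = ![u 0, u 1, u 2, u 3] := fun u => by
    ext i; fin_cases i <;> rfl
  have k1 : b.det e' = (a₁ * a₄ - a₂ * a₃) * b.det e := by
    obtain ⟨p, q, hpq⟩ := exists_eq_add_comb E f (by simpa only [hEi] using hf)
      (by rw [hEi, hf2]) (by rw [hEi, hf3]) hf0
    obtain ⟨p', q', hpq'⟩ := exists_eq_add_comb E f (by simpa only [hEi] using hf)
      (by rw [hEi, hf2]) (by rw [hEi, hf3]) hf1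
    rw [four e', hpq, hpq', h2, h3, ← hEi, ← hEi, ← hEi, ← hEi, alternatingMap_adapted, hE]
  have k2 : b.det b' = α * α + β * β := by
    obtain ⟨p, q, hpq⟩ := exists_eq_add_comb b ρ hρ hρ2 hρ3 hρ0
    obtain ⟨p', q', hpq'⟩ := exists_eq_add_comb b ρ hρ hρ2 hρ3 hρ1
    rw [four b', hpq, hpq', hb2, hb3, alternatingMap_adapted, Module.Basis.det_self]
    ring
  have k3 : b.det e' = b.det b' * b'.det e' := by
    conv_lhs => rw [AlternatingMap.eq_smul_basis_det b' b.det]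
    rfl
  have k4 : b.det b' ≠ 0 := (Module.Basis.isUnit_det b b').ne_zero
  have k5 : 0 < b.det b' := lt_of_le_of_ne
    (by rw [k2]; exact add_nonneg (mul_self_nonneg _) (mul_self_nonneg _)) k4.symm
  rw [k1] at k3
  exact (pos_iff_pos_of_mul_pos (by rw [k3]; exact mul_pos k5 he')).2 he

end LinearAlgebra

/-! ### Orientations of the fibres -/

section Orientation

section

variable {E H M E' H' M' : Type*}
  [NormedAddCommGroup E] [NormedSpace ℝ E] [TopologicalSpace H]
  [NormedAddCommGroup E'] [NormedSpace ℝ E'] [TopologicalSpace H']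
  [TopologicalSpace M] [ChartedSpace H M] [TopologicalSpace M'] [ChartedSpace H' M']
  {I : ModelWithCorners ℝ E H} {I' : ModelWithCorners ℝ E' H'}

lemma dmap_fst (p : M × M') (u : E × E') : dmap (I.prod I') I Prod.fst p u = u.1 :=
  congrArg (fun l : E × E' →L[ℝ] E => l u) mfderiv_fst

lemma dmap_snd (p : M × M') (u : E × E') : dmap (I.prod I') I' Prod.snd p u = u.2 :=
  congrArg (fun l : E × E' →L[ℝ] E' => l u) mfderiv_snd

end

variable {L : Torus → Type*} [∀ q, AddCommGroup (L q)] [∀ q, Module ℂ (L q)]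
  [∀ q, TopologicalSpace (L q)] [TopologicalSpace (TotalSpace ℂ L)] [FiberBundle ℂ L]
  [VectorBundle ℂ ℂ L] [VectorBundle ℝ ℂ L] [ContMDiffVectorBundle ∞ ℂ L IT]
  {h : HermitianMetric L}

omit [VectorBundle ℂ ℂ L] [VectorBundle ℝ ℂ L] [ContMDiffVectorBundle ∞ ℂ L IT] in
lemma dmap_standardMap (v : TotalSpace ℂ L)
    (x : (EuclideanSpace ℝ (Fin 1) × EuclideanSpace ℝ (Fin 1)) × ℂ) :
    dmap IL IC (standardMap h) v x = (x.1.1, EuclideanSpace.single (0 : Fin 1)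
      (dmap IL 𝓘(ℝ, ℝ) (fun v => h.radius v ^ 2) v x)) := by
  have hd : MDifferentiableAt IL IC (standardMap h) v :=
    (contMDiff_standardMap h).mdifferentiable (by simp) v
  have hp : MDifferentiableAt IL IT (TotalSpace.proj : TotalSpace ℂ L → Torus) v :=
    (Bundle.contMDiff_proj L (n := 1)).mdifferentiable one_ne_zero _
  have h1 : dmap IL (𝓡 1) (fun v => (standardMap h v).1) v x =
      (dmap IL IC (standardMap h) v x).1 := by
    rw [dmap_comp_apply (I' := IC) (g := Prod.fst) v mdifferentiableAt_fst hd, dmap_fst]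
  have h2 : dmap IL (𝓡 1) (fun v : TotalSpace ℂ L => v.proj.1) v x = x.1.1 := by
    rw [dmap_comp_apply (g := Prod.fst) v mdifferentiableAt_fst hp, dmap_proj, dmap_fst]
    rfl
  have h3 : dmap IL 𝓘(ℝ, ℝ) (fun v => halfLineCoord (standardMap h v).2) v x =
      (dmap IL IC (standardMap h) v x).2 0 := by
    have h4 : dmap IL (𝓡∂ 1) (fun v => (standardMap h v).2) v x =
        (dmap IL IC (standardMap h) v x).2 := by
      rw [dmap_comp_apply (I' := IC) (g := Prod.snd) v mdifferentiableAt_snd hd, dmap_snd]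
    rw [dmap_comp_apply (f := fun v => (standardMap h v).2) v
      (contMDiff_halfLineCoord.mdifferentiable (by simp) _) (mdifferentiableAt_snd.comp v hd),
      h4, dmap_halfLineCoord]
  have h5 : (fun v => halfLineCoord (standardMap h v).2) = fun v => h.radius v ^ 2 :=
    funext fun v => by simp [standardMap]
  refine Prod.ext (h1.symm.trans h2) ?_
  rw [h5] at h3
  ext i
  rw [Subsingleton.elim i 0, ← h3]
  simp

omit [VectorBundle ℂ ℂ L] in
/-- A curve in a fibre of the line bundle has vertical velocity, given by the derivative of its
fibre coordinate. -/
lemma dmap_fibreCurve {b : Torus} {g : ℝ → L b} {s₀ : ℝ} {c : ℂ}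
    (hg : HasDerivAt (fun s => fibreCoord b ⟨b, g s⟩) c s₀)
    (hs : ContDiffAt ℝ ∞ (fun s => fibreCoord b ⟨b, g s⟩) s₀) :
    ContMDiffAt 𝓘(ℝ, ℝ) IL ∞ (fun s => (⟨b, g s⟩ : TotalSpace ℂ L)) s₀ ∧
    dmap 𝓘(ℝ, ℝ) IL (fun s => (⟨b, g s⟩ : TotalSpace ℂ L)) s₀ 1 =
      ((0 : EuclideanSpace ℝ (Fin 1) × EuclideanSpace ℝ (Fin 1)), c) := by
  have h1 : ContMDiffAt 𝓘(ℝ, ℝ) IL ∞ (fun s => (⟨b, g s⟩ : TotalSpace ℂ L)) s₀ :=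
    (contMDiffAt_totalSpace_iff (f := fun s => (⟨b, g s⟩ : TotalSpace ℂ L)) (q := b)
      (mem_baseSet_trivializationAt ..)).2 ⟨contMDiffAt_const, hs.contMDiffAt⟩
  refine ⟨h1, ?_⟩
  rw [dmap_totalSpace (h1.mdifferentiableAt (by simp))]
  refine Prod.ext ?_ ?_
  · change dmap 𝓘(ℝ, ℝ) IT (fun _ => b) s₀ 1 = 0
    rw [dmap_const]; rfl
  · change dmap 𝓘(ℝ, ℝ) 𝓘(ℝ, ℂ) (fun s => fibreCoord b ⟨b, g s⟩) s₀ 1 = c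
    rw [dmap_eq_fderiv]
    exact hg.deriv

lemma verticalVector_eq (v : TotalSpace ℂ L) (w : L v.proj) :
    verticalVector v w = ((0 : EuclideanSpace ℝ (Fin 1) × EuclideanSpace ℝ (Fin 1)),
      fibreCoord v.proj ⟨v.proj, w⟩) := by
  have hb : v.proj ∈ (trivializationAt ℂ L v.proj).baseSet := mem_baseSet_trivializationAt ..
  have h1 : (fun s : ℝ => fibreCoord v.proj (⟨v.proj, v.2 + s • w⟩ : TotalSpace ℂ L)) =
      fun s : ℝ => fibreCoord v.proj v + s * fibreCoord v.proj ⟨v.proj, w⟩ := funext fun s => by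
    rw [fibreCoord_add hb, ← Complex.coe_smul, fibreCoord_smul hb]
  have h2 : HasDerivAt (fun s : ℝ => fibreCoord v.proj v + s * fibreCoord v.proj ⟨v.proj, w⟩)
      (fibreCoord v.proj ⟨v.proj, w⟩) 0 := by
    have := ((Complex.ofRealCLM.hasDerivAt (x := (0 : ℝ))).mul_const
      (fibreCoord v.proj ⟨v.proj, w⟩)).const_add (fibreCoord v.proj v)
    simpa using this
  have h3 : ContDiff ℝ ∞ (fun s : ℝ => fibreCoord v.proj v + s * fibreCoord v.proj ⟨v.proj, w⟩) :=
    contDiff_const.add (Complex.ofRealCLM.contDiff.mul contDiff_const)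
  exact (dmap_fibreCurve (g := fun s : ℝ => v.2 + s • w) (by rw [h1]; exact h2)
    (by rw [h1]; exact h3.contDiffAt)).2

/-- Two positive frames of the tangent plane of a fibre differ by a matrix of positive
determinant. -/
lemma det_pos_of_isPositiveFibreFrame {v : TotalSpace ℂ L} {u w u' w' : TangentSpace IL v}
    (hu : mfderiv IL IC (standardMap h) v u = 0) (hw : mfderiv IL IC (standardMap h) v w = 0)
    (h1 : IsPositiveFibreFrame h v u w) (h2 : IsPositiveFibreFrame h v u' w') {a b c d : ℝ}
    (hu' : u' = a • u + b • w) (hw' : w' = c • u + d • w) : 0 < a * d - b * c := by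
  obtain ⟨e₁, e₂, he₁, he₂, B, x, hB0, hB1, hB2, hB3, hpos⟩ := h1
  obtain ⟨e₁', e₂', he₁', he₂', B', x', hB0', hB1', hB2', hB3', hpos'⟩ := h2
  have hb : v.proj ∈ (trivializationAt ℂ L v.proj).baseSet := mem_baseSet_trivializationAt ..
  let ζ : ℂ := fibreCoord v.proj ⟨v.proj, x⟩
  let ζ' : ℂ := fibreCoord v.proj ⟨v.proj, x'⟩
  have e2 : B 2 = ((0 : EuclideanSpace ℝ (Fin 1) × EuclideanSpace ℝ (Fin 1)), ζ) :=
    hB2.trans (verticalVector_eq v x)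
  have e3 : B 3 = ((0 : EuclideanSpace ℝ (Fin 1) × EuclideanSpace ℝ (Fin 1)), Complex.I * ζ) :=
    (hB3.trans (verticalVector_eq v _)).trans (Prod.ext rfl (fibreCoord_smul hb _ x))
  have e2' : B' 2 = ((0 : EuclideanSpace ℝ (Fin 1) × EuclideanSpace ℝ (Fin 1)), ζ') :=
    hB2'.trans (verticalVector_eq v x')
  have e3' : B' 3 = ((0 : EuclideanSpace ℝ (Fin 1) × EuclideanSpace ℝ (Fin 1)), Complex.I * ζ') :=
    (hB3'.trans (verticalVector_eq v _)).trans (Prod.ext rfl (fibreCoord_smul hb _ x'))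
  have hζ : ζ ≠ 0 := fun h0 => B.ne_zero 2 (by rw [e2, h0]; rfl)
  obtain ⟨l, hl⟩ : ∃ l : ℂ, ζ' = l * ζ := ⟨ζ' / ζ, (div_mul_cancel₀ _ hζ).symm⟩
  have hl' : l = l.re + l.im * Complex.I := (Complex.re_add_im l).symm
  have hρ : ∀ z : ℂ, mfderiv IL IT (TotalSpace.proj : TotalSpace ℂ L → Torus) v
      ((0 : EuclideanSpace ℝ (Fin 1) × EuclideanSpace ℝ (Fin 1)), z) = 0 := fun z =>
    congrArg (fun f : _ →L[ℝ] (EuclideanSpace ℝ (Fin 1) × EuclideanSpace ℝ (Fin 1)) =>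
      f ((0 : EuclideanSpace ℝ (Fin 1) × EuclideanSpace ℝ (Fin 1)), z)) (dmap_proj v)
  refine det_pos_of_adapted (b := B) (b' := B')
    (ρ := (mfderiv IL IT (TotalSpace.proj : TotalSpace ℂ L → Torus) v).toLinearMap)
    (f := (mfderiv IL IC (standardMap h) v).toLinearMap) (α := l.re) (β := l.im)
    (e := ![e₁, e₂, u, w]) (e' := ![e₁', e₂', u', w']) (fun y z hyz => ?_) (hB0'.trans hB0.symm)
    (hB1'.trans hB1.symm) ?_ ?_ ?_ ?_ hpos hpos' (fun y z hyz => ?_) (he₁'.trans he₁.symm)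
    (he₂'.trans he₂.symm) hu hw hu' hw'
  · have : y • torusField₁ v.proj + z • torusField₂ v.proj = 0 := by rw [← hB0, ← hB1]; exact hyz
    exact torusField_comb_eq_zero this
  · exact (congrArg _ e2).trans (hρ ζ)
  · exact (congrArg _ e3).trans (hρ _)
  · rw [e2', e2, e3, hl]
    refine Prod.ext ?_ ?_
    · change (0 : EuclideanSpace ℝ (Fin 1) × EuclideanSpace ℝ (Fin 1)) = l.re • 0 + l.im • 0
      simp
    · change l * ζ = l.re • ζ + l.im • (Complex.I * ζ)
      conv_lhs => rw [hl']
      rw [Complex.real_smul, Complex.real_smul]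
      ring
  · rw [e3', e2, e3, hl]
    refine Prod.ext ?_ ?_
    · change (0 : EuclideanSpace ℝ (Fin 1) × EuclideanSpace ℝ (Fin 1)) = -l.im • 0 + l.re • 0
      simp
    · change Complex.I * (l * ζ) = -l.im • ζ + l.re • (Complex.I * ζ)
      conv_lhs => rw [hl']
      rw [Complex.real_smul, Complex.real_smul]
      push_cast
      linear_combination (l.im : ℂ) * ζ * Complex.I_sq
  · have h0 : y • (circleVec v.proj.1, (0 : EuclideanSpace ℝ (Fin 1))) +
        z • ((0 : EuclideanSpace ℝ (Fin 1)), EuclideanSpace.single (0 : Fin 1) (1 : ℝ)) = 0 := by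
      refine Eq.trans ?_ hyz
      exact congrArg₂ (fun p q : EuclideanSpace ℝ (Fin 1) × EuclideanSpace ℝ (Fin 1) =>
        y • p + z • q) he₁.symm he₂.symm
    have h1 := congrArg Prod.fst h0
    have h2 := congrArg Prod.snd h0
    simp only [Prod.fst_add, Prod.snd_add, Prod.smul_fst, Prod.smul_snd, smul_zero, add_zero,
      zero_add, Prod.fst_zero, Prod.snd_zero] at h1 h2
    refine ⟨(smul_eq_zero.1 h1).resolve_right (circleVec_ne_zero _), ?_⟩
    have h3 := congrArg (fun p : EuclideanSpace ℝ (Fin 1) => p 0) h2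
    simpa using h3

end Orientation

/-! ### Orientation of the standard model -/

section ModelOrientation

/-- In the product coordinates of a tangent space of the total space, arbitrary lifts of a frame of
the base, followed by a complex frame of the fibre, form a basis. -/
lemma exists_adapted_basis {z y : EuclideanSpace ℝ (Fin 1)} (hz : z ≠ 0) (hy : y ≠ 0)
    (a a' : ℂ) {c : ℂ} (hc : c ≠ 0) :
    ∃ b : Module.Basis (Fin 4) ℝ ((EuclideanSpace ℝ (Fin 1) × EuclideanSpace ℝ (Fin 1)) × ℂ),
      b 0 = ((z, 0), a) ∧ b 1 = ((0, y), a') ∧ b 2 = (0, c) ∧ b 3 = (0, Complex.I * c) := by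
  let f : Fin 4 → (EuclideanSpace ℝ (Fin 1) × EuclideanSpace ℝ (Fin 1)) × ℂ :=
    ![((z, 0), a), ((0, y), a'), (0, c), (0, Complex.I * c)]
  have hli : LinearIndependent ℝ f := by
    rw [Fintype.linearIndependent_iff]
    intro g hg
    simp only [Fin.sum_univ_four, f, Matrix.cons_val] at hg
    have h1 := congrArg (fun p => p.1.1) hg
    have h2 := congrArg (fun p => p.1.2) hg
    have h3 := congrArg (fun p => p.2) hg
    simp only [Prod.smul_mk, Prod.mk_add_mk, smul_zero, add_zero, zero_add, Prod.fst_zero,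
      Prod.snd_zero] at h1 h2 h3
    have g0 : g 0 = 0 := (smul_eq_zero.1 (by simpa using h1)).resolve_right hz
    have g1 : g 1 = 0 := (smul_eq_zero.1 (by simpa using h2)).resolve_right hy
    rw [g0, g1, zero_smul, zero_smul, zero_add, zero_add, Complex.real_smul,
      Complex.real_smul] at h3
    have h4 : ((g 2 : ℂ) + g 3 * Complex.I) * c = 0 := by linear_combination h3
    have h5 := (mul_eq_zero.1 h4).resolve_right hc
    have g2 : g 2 = 0 := by simpa using congrArg Complex.re h5
    have g3 : g 3 = 0 := by simpa using congrArg Complex.im h5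
    intro i
    fin_cases i <;> assumption
  have hcard : Fintype.card (Fin 4) = Module.finrank ℝ
      ((EuclideanSpace ℝ (Fin 1) × EuclideanSpace ℝ (Fin 1)) × ℂ) := by simp
  refine ⟨basisOfLinearIndependentOfCardEqFinrank hli hcard, ?_, ?_, ?_, ?_⟩ <;>
    simp [f]

lemma det_adapted {V : Type*} [AddCommGroup V] [Module ℝ V] (b : Module.Basis (Fin 4) ℝ V) (k : ℝ) :
    b.det ![b 0, b 2, k • b 3, b 1] = k := by
  rw [Module.Basis.det_apply]
  have : b.toMatrix ![b 0, b 2, k • b 3, b 1] =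
      !![1, 0, 0, 0; 0, 0, 0, 1; 0, 1, 0, 0; 0, 0, k, 0] := by
    ext i j
    fin_cases i <;> fin_cases j <;> simp [Module.Basis.toMatrix_apply]
  rw [this]
  simp [Matrix.det_succ_row_zero, Fin.sum_univ_succ, Fin.succAbove]

variable {L : Torus → Type*} [∀ q, AddCommGroup (L q)] [∀ q, Module ℂ (L q)]
  [∀ q, TopologicalSpace (L q)] [TopologicalSpace (TotalSpace ℂ L)] [FiberBundle ℂ L]
  [VectorBundle ℂ ℂ L] [VectorBundle ℝ ℂ L] [ContMDiffVectorBundle ∞ ℂ L IT]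
  {h : HermitianMetric L} {n : ℤ} {S : ℝ × Circle → TotalSpace ℂ L} {ε : ℝ}

lemma dmap_scale_curve (v : TotalSpace ℂ L) {g : ℝ → ℂ} (hg : ContDiff ℝ ∞ g) {c : ℂ} {s₀ : ℝ}
    (hc : HasDerivAt g c s₀) :
    ContMDiffAt 𝓘(ℝ, ℝ) IL ∞ (fun s => scale (g s) v) s₀ ∧
    dmap 𝓘(ℝ, ℝ) IL (fun s => scale (g s) v) s₀ 1 =
      ((0 : EuclideanSpace ℝ (Fin 1) × EuclideanSpace ℝ (Fin 1)), c * fibreCoord v.proj v) := by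
  have h1 : (fun s => fibreCoord v.proj (⟨v.proj, g s • v.2⟩ : TotalSpace ℂ L)) =
      fun s => g s * fibreCoord v.proj v :=
    funext fun s => fibreCoord_smul (mem_baseSet_trivializationAt ..) _ _
  exact dmap_fibreCurve (b := v.proj) (g := fun s => g s • v.2)
    (by rw [h1]; exact hc.mul_const _) (by rw [h1]; exact (hg.mul contDiff_const).contDiffAt)

lemma hasDerivAt_coe_circ_zero :
    HasDerivAt (fun s => (circ s : ℂ)) (2 * Real.pi * Complex.I) 0 := by
  have h1 : HasDerivAt (fun s : ℝ => (2 * Real.pi * (s : ℂ) * Complex.I))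
      (2 * Real.pi * Complex.I) 0 := by
    have := ((Complex.ofRealCLM.hasDerivAt (x := (0 : ℝ))).const_mul (2 * Real.pi : ℂ)).mul_const
      Complex.I
    simpa using this
  have h2 := h1.cexp
  simp_rw [← coe_circ] at h2
  simpa using h2

lemma contDiff_coe_circ : ContDiff ℝ ∞ fun s => (circ s : ℂ) := by
  simp_rw [coe_circ]
  exact ((contDiff_const.mul Complex.ofRealCLM.contDiff).mul contDiff_const).cexp

lemma dmap_torusField₁ (q : Torus) :
    ContMDiffAt 𝓘(ℝ, ℝ) IT ∞ (fun s : ℝ => ((q.1 * circ s, q.2) : Torus)) 0 ∧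
    dmap 𝓘(ℝ, ℝ) IT (fun s : ℝ => ((q.1 * circ s, q.2) : Torus)) 0 1 = torusField₁ q := by
  have h1 : ContMDiffAt 𝓘(ℝ, ℝ) (𝓡 1) ∞ (fun s : ℝ => q.1 * circ s) 0 :=
    contMDiffAt_const.mul contMDiff_circ.contMDiffAt
  refine ⟨h1.prodMk contMDiffAt_const, ?_⟩
  rw [dmap_prodMk (h1.mdifferentiableAt (by simp)) mdifferentiableAt_const, dmap_const]
  rfl

/-- The parametrization of the fibres is orientation preserving. The lifts of `∂_θ` and `∂_s` are a
lift `b₀` of `∂₁` and the radial vector `b₂`. The derivative of the parametrization takes `∂₁` to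
`2πi v`, a positive multiple of the vector `b₃ = i b₂`, and takes `∂₂` to a lift `b₁` of `∂₂`. The
frame `(b₀, b₂, b₃, b₁)` is a cyclic permutation of the last three vectors of the positive frame
`(b₀, b₁, b₂, b₃)`, hence positive. -/
lemma IsUnitFrame.isPositiveFibreFrame_modelMap (hS : IsUnitFrame h n S) (hε : 0 < ε) (t : ℝ)
    (q : Torus) : IsPositiveFibreFrame h (modelMap S ε (t, q))
      (mfderiv IT IL (fun q' => modelMap S ε (t, q')) q (torusField₁ q))
      (mfderiv IT IL (fun q' => modelMap S ε (t, q')) q (torusField₂ q)) := by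
  have hv0 := hS.modelMap_snd_ne_zero hε (t, q)
  have hproj : (modelMap S ε (t, q)).proj = (circ t, q.2) := hS.proj_modelMap t q
  have hrad := hS.radius_sq_modelMap hε (t, q)
  let ζ : ℂ := fibreCoord (modelMap S ε (t, q)).proj (modelMap S ε (t, q))
  have hζ : ζ ≠ 0 := fibreCoord_ne_zero (mem_baseSet_trivializationAt ..) hv0
  have hε' : (ε : ℂ) ≠ 0 := by exact_mod_cast hε.ne'
  have hrs : ∀ v, MDifferentiableAt IL 𝓘(ℝ, ℝ) (fun v => h.radius v ^ 2) v :=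
    (contMDiff_radius_sq h).mdifferentiable (by simp)
  -- The fibre through the point.
  have hsm : ContMDiffAt IT IL ∞ (fun q' => modelMap S ε (t, q')) q :=
    ContMDiffAt.comp (g := modelMap S ε) q hS.contMDiff_modelMap.contMDiffAt
      (contMDiffAt_const.prodMk contMDiffAt_id)
  have hsm' := hsm.mdifferentiableAt (by simp)
  have hu : dmap IT IL (fun q' => modelMap S ε (t, q')) q (torusField₁ q) =
      ((0 : EuclideanSpace ℝ (Fin 1) × EuclideanSpace ℝ (Fin 1)), 2 * Real.pi * Complex.I * ζ) := by
    have e1 : (fun s : ℝ => modelMap S ε (t, ((q.1 * circ s, q.2) : Torus))) =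
        fun s => scale (circ s) (modelMap S ε (t, q)) := funext fun s => by
      rw [modelMap, modelMap, scale_scale, Circle.coe_mul]
      congr 1
      ring
    have e0 : ((q.1 * circ 0, q.2) : Torus) = q := by simp
    rw [← (dmap_torusField₁ q).2,
      ← (dmap_scale_curve _ contDiff_coe_circ hasDerivAt_coe_circ_zero).2,
      ← e1]
    have := dmap_comp_apply (g := fun q' => modelMap S ε (t, q')) (I'' := IL)
      (f := fun s : ℝ => ((q.1 * circ s, q.2) : Torus)) 0 (by rw [e0]; exact hsm')
      ((dmap_torusField₁ q).1.mdifferentiableAt (by simp)) 1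
    rw [e0] at this
    exact this.symm
  have hw : (dmap IT IL (fun q' => modelMap S ε (t, q')) q (torusField₂ q)).1 =
      ((0 : EuclideanSpace ℝ (Fin 1)), circleVec q.2) := by
    change (dmap IT IL (fun q' => modelMap S ε (t, q')) q
      ((0 : EuclideanSpace ℝ (Fin 1)), circleVec q.2)).1 = _
    rw [dmap_totalSpace hsm']
    have e1 : (fun q' => (modelMap S ε (t, q')).proj) = fun q' : Torus => (circ t, q'.2) :=
      funext fun q' => hS.proj_modelMap t q'
    rw [e1, dmap_prodMk mdifferentiableAt_const mdifferentiableAt_snd, dmap_const, dmap_snd]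
    rfl
  -- A lift of the first coordinate field of the half cylinder.
  have hcs : ContMDiffAt 𝓘(ℝ, ℝ) IL ∞ (fun s => modelMap S ε (s, q)) t :=
    ContMDiffAt.comp (g := modelMap S ε) t hS.contMDiff_modelMap.contMDiffAt
      (contMDiffAt_id.prodMk contMDiffAt_const)
  have hcs' := hcs.mdifferentiableAt (by simp)
  have he1 : (dmap 𝓘(ℝ, ℝ) IL (fun s => modelMap S ε (s, q)) t 1).1 =
      (circleVec (circ t), (0 : EuclideanSpace ℝ (Fin 1))) := by
    rw [dmap_totalSpace hcs']
    have e1 : (fun s => (modelMap S ε (s, q)).proj) = fun s => (circ s, q.2) :=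
      funext fun s => hS.proj_modelMap s q
    rw [e1, dmap_prodMk (mdiff_circ t) mdifferentiableAt_const, dmap_const, circleVec_circ]
    rfl
  have he1' : dmap IL 𝓘(ℝ, ℝ) (fun v => h.radius v ^ 2) (modelMap S ε (t, q))
      (dmap 𝓘(ℝ, ℝ) IL (fun s => modelMap S ε (s, q)) t 1) = 0 := by
    rw [← dmap_comp_apply (g := fun v => h.radius v ^ 2) t (hrs _) hcs']
    simp_rw [hS.radius_sq_modelMap hε]
    rw [dmap_const]; rfl
  -- The radial vector, lifting the second coordinate field.
  let g : ℝ → ℂ := fun s => 1 + s * (1 / (2 * ε))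
  have hg : ContDiff ℝ ∞ g := contDiff_const.add (Complex.ofRealCLM.contDiff.mul contDiff_const)
  have hg' : HasDerivAt g (1 / (2 * ε)) 0 := by
    have := ((Complex.ofRealCLM.hasDerivAt (x := (0 : ℝ))).mul_const (1 / (2 * ε) : ℂ)).const_add 1
    exact this.congr_deriv (by simp)
  have hg0 : scale (g 0) (modelMap S ε (t, q)) = modelMap S ε (t, q) := by simp [g]
  obtain ⟨hr1, hr2⟩ := dmap_scale_curve (modelMap S ε (t, q)) hg hg'
  have he2' : dmap IL 𝓘(ℝ, ℝ) (fun v => h.radius v ^ 2) (modelMap S ε (t, q))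
      ((0 : EuclideanSpace ℝ (Fin 1) × EuclideanSpace ℝ (Fin 1)), 1 / (2 * ε) * ζ) = 1 := by
    have e1 := dmap_comp_apply (g := fun v => h.radius v ^ 2) (I'' := 𝓘(ℝ, ℝ)) (0 : ℝ) (hrs _)
      (hr1.mdifferentiableAt (by simp)) 1
    rw [hr2, hg0] at e1
    rw [← e1, dmap_eq_fderiv]
    have e2 : (fun s => h.radius (scale (g s) (modelMap S ε (t, q))) ^ 2) =
        fun s => (1 + s * (1 / (2 * ε))) ^ 2 * ε := funext fun s => by
      have : g s = ((1 + s * (1 / (2 * ε)) : ℝ) : ℂ) := by simp only [g]; push_cast; ring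
      rw [radius_scale, mul_pow, hrad, this, Complex.norm_real, Real.norm_eq_abs, sq_abs]
    rw [e2]
    have e3 : HasDerivAt (fun s : ℝ => (1 + s * (1 / (2 * ε))) ^ 2 * ε) 1 0 := by
      have := ((((hasDerivAt_id (0 : ℝ)).mul_const (1 / (2 * ε))).const_add 1).pow 2).mul_const ε
      refine this.congr_deriv ?_
      simp
      field_simp
    exact e3.deriv
  -- The frame that exhibits the orientation.
  obtain ⟨b, hb0, hb1, hb2, hb3⟩ := exists_adapted_basis (circleVec_ne_zero (circ t))
    (circleVec_ne_zero q.2) (dmap 𝓘(ℝ, ℝ) IL (fun s => modelMap S ε (s, q)) t 1).2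
    (dmap IT IL (fun q' => modelMap S ε (t, q')) q (torusField₂ q)).2
    (c := 1 / (2 * ε) * ζ) (mul_ne_zero (by simp [hε']) hζ)
  have hb0' : b 0 = dmap 𝓘(ℝ, ℝ) IL (fun s => modelMap S ε (s, q)) t 1 :=
    hb0.trans (Prod.ext he1.symm rfl)
  have hb1' : b 1 = dmap IT IL (fun q' => modelMap S ε (t, q')) q (torusField₂ q) :=
    hb1.trans (Prod.ext hw.symm rfl)
  have hb3' : (4 * Real.pi * ε) • b 3 =
      dmap IT IL (fun q' => modelMap S ε (t, q')) q (torusField₁ q) := by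
    rw [hb3, hu]
    refine Prod.ext (smul_zero _) ?_
    rw [Prod.smul_mk, Complex.real_smul]
    push_cast
    field_simp
    ring
  have hbc : ∀ c : ℂ, fibreCoord (modelMap S ε (t, q)).proj
      ⟨(modelMap S ε (t, q)).proj, c • (modelMap S ε (t, q)).2⟩ = c * ζ := fun c =>
    fibreCoord_smul (mem_baseSet_trivializationAt ..) c _
  refine ⟨b 0, b 2, ?_, ?_, b, (1 / (2 * ε) : ℂ) • (modelMap S ε (t, q)).2, ?_, ?_, ?_, ?_, ?_⟩
  · refine (dmap_standardMap (modelMap S ε (t, q)) (b 0)).trans ?_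
    rw [hb0', he1', he1, hproj]
    refine Prod.ext rfl ?_
    change (EuclideanSpace.single 0 0 : EuclideanSpace ℝ (Fin 1)) = 0
    simp
  · refine (dmap_standardMap (modelMap S ε (t, q)) (b 2)).trans ?_
    rw [hb2, he2']
    rfl
  · refine (congrArg (fun l : _ →L[ℝ] _ => l (b 0)) (dmap_proj (modelMap S ε (t, q)))).trans ?_
    rw [hb0, hproj]
    rfl
  · refine (congrArg (fun l : _ →L[ℝ] _ => l (b 1)) (dmap_proj (modelMap S ε (t, q)))).trans ?_
    rw [hb1, hproj]
    rfl
  · refine hb2.trans (Eq.trans ?_ (verticalVector_eq _ _).symm)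
    rw [hbc]
  · refine hb3.trans (Eq.trans ?_ (verticalVector_eq _ _).symm)
    rw [smul_smul, hbc, mul_assoc]
  · have := det_adapted b (4 * Real.pi * ε)
    rw [hb3', hb1'] at this
    refine lt_of_lt_of_eq (by positivity : 0 < 4 * Real.pi * ε) this.symm

theorem IsUnitFrame.isMonodromy (hS : IsUnitFrame h n S) (hε : 0 < ε) :
    IsMonodromy h ε hε ((torusTwist ^ (-n) : Torus ≃ₘ⟮IT, IT⟯ Torus) :
      MappingClassGroup IT Torus) :=
  ⟨_, modelMap S ε, rfl, hS.isMappingTorus hε, hS.isPositiveFibreFrame_modelMap hε⟩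

end ModelOrientation

/-! ### The twist is a right-handed Dehn twist -/

/-- An increasing diffeomorphism from the line to the interval `(0, 1)`, with `0 ↦ 1/4`,
`1/2 ↦ 1/2` and `1 ↦ 3/4`. -/
def squeeze (t : ℝ) : ℝ := 1 / 2 + Real.arctan (2 * t - 1) / Real.pi

lemma hasDerivAt_squeeze (t : ℝ) :
    HasDerivAt squeeze (1 / (1 + (2 * t - 1) ^ 2) * 2 / Real.pi) t := by
  have h1 : HasDerivAt (fun t : ℝ => 2 * t - 1) 2 t := by
    simpa using ((hasDerivAt_id t).const_mul 2).sub_const 1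
  exact (h1.arctan.div_const Real.pi).const_add (1 / 2)

lemma contDiff_squeeze : ContDiff ℝ ∞ squeeze :=
  contDiff_const.add ((Real.contDiff_arctan.comp
    (by fun_prop : ContDiff ℝ ∞ fun t : ℝ => 2 * t - 1)).div_const _)

lemma strictMono_squeeze : StrictMono squeeze := fun s t hst => by
  have := Real.arctan_strictMono (by linarith : 2 * s - 1 < 2 * t - 1)
  have := div_lt_div_of_pos_right this Real.pi_pos
  simp only [squeeze]
  linarith

lemma squeeze_mem_Ioo (t : ℝ) : squeeze t ∈ Ioo (0 : ℝ) 1 := by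
  have h1 := Real.neg_pi_div_two_lt_arctan (2 * t - 1)
  have h2 := Real.arctan_lt_pi_div_two (2 * t - 1)
  have hp := Real.pi_pos
  constructor
  · have : -(1 / 2) < Real.arctan (2 * t - 1) / Real.pi := by rw [lt_div_iff₀ hp]; linarith
    simp only [squeeze]; linarith
  · have : Real.arctan (2 * t - 1) / Real.pi < 1 / 2 := by rw [div_lt_iff₀ hp]; linarith
    simp only [squeeze]; linarith

lemma exists_squeeze_eq {s : ℝ} (hs : s ∈ Ioo (0 : ℝ) 1) : ∃ t, squeeze t = s := by
  have hp := Real.pi_pos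
  refine ⟨(Real.tan (Real.pi * (s - 1 / 2)) + 1) / 2, ?_⟩
  have : 2 * ((Real.tan (Real.pi * (s - 1 / 2)) + 1) / 2) - 1 =
      Real.tan (Real.pi * (s - 1 / 2)) := by
    ring
  rw [squeeze, this, Real.arctan_tan (by nlinarith [hs.1]) (by nlinarith [hs.2])]
  field_simp
  ring

lemma squeeze_zero : squeeze 0 = 1 / 4 := by
  have hp := Real.pi_pos.ne'
  have : (2 * 0 - 1 : ℝ) = -1 := by norm_num
  rw [squeeze, this, Real.arctan_neg, Real.arctan_one]
  field_simp
  norm_num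

lemma squeeze_half : squeeze (1 / 2) = 1 / 2 := by simp [squeeze]

lemma squeeze_one : squeeze 1 = 3 / 4 := by
  have hp := Real.pi_pos.ne'
  have : (2 * 1 - 1 : ℝ) = 1 := by norm_num
  rw [squeeze, this, Real.arctan_one]
  field_simp
  norm_num

/-- The annulus of the twist, the complement of the circle `y = 1`. -/
def twistAnnulus (p : Circle × ℝ) : Torus := (p.1, circ (squeeze p.2))

lemma isOrientedAnnulus_twistAnnulus : IsOrientedAnnulus twistAnnulus where
  smooth := contMDiff_fst.prodMk
    (contMDiff_circ.comp (contDiff_squeeze.contMDiff.comp contMDiff_snd))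
  injective := fun p p' h => by
    have h1 : p.1 = p'.1 := congrArg (fun q : Torus => q.1) h
    have h2 : circ (squeeze p.2) = circ (squeeze p'.2) := congrArg (fun q : Torus => q.2) h
    obtain ⟨m, hm⟩ := circ_eq_circ_iff.1 h2
    have a1 := squeeze_mem_Ioo p.2
    have a2 := squeeze_mem_Ioo p'.2
    have m0 : m = 0 := by
      have b1 : (m : ℝ) < 1 := by linarith [a1.2, a2.1]
      have b2 : (-1 : ℝ) < m := by linarith [a1.1, a2.2]
      have b1' : m < 1 := by exact_mod_cast b1
      have b2' : -1 < m := by exact_mod_cast b2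
      omega
    rw [m0, Int.cast_zero, add_zero] at hm
    exact Prod.ext h1 (strictMono_squeeze.injective hm)
  oriented := fun p => by
    have hd := hasDerivAt_squeeze p.2
    refine ⟨1, 0, 0, 1 / (1 + (2 * p.2 - 1) ^ 2) * 2 / Real.pi, ?_, ?_, ?_⟩
    · rw [one_smul, zero_smul, add_zero]
      change dmap (𝓡 1) IT (fun z : Circle => (z, circ (squeeze p.2))) p.1 (circleVec p.1) =
        (circleVec p.1, (0 : EuclideanSpace ℝ (Fin 1)))
      rw [dmap_prodMk (f := fun z => z) mdifferentiableAt_id mdifferentiableAt_const, dmap_const,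
        dmap_id]
      rfl
    · rw [zero_smul, zero_add]
      have h1 : MDifferentiableAt 𝓘(ℝ, ℝ) 𝓘(ℝ, ℝ) squeeze p.2 :=
        hd.differentiableAt.mdifferentiableAt
      have h2 : MDifferentiableAt 𝓘(ℝ, ℝ) (𝓡 1) (fun t => circ (squeeze t)) p.2 :=
        (mdiff_circ (squeeze p.2)).comp p.2 h1
      change dmap 𝓘(ℝ, ℝ) IT (fun t : ℝ => (p.1, circ (squeeze t))) p.2 1 =
        (_ • (0 : EuclideanSpace ℝ (Fin 1)), _ • circleVec (circ (squeeze p.2)))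
      rw [dmap_prodMk mdifferentiableAt_const h2, dmap_const, dmap_comp_apply p.2 (mdiff_circ _) h1,
        dmap_eq_fderiv, circleVec_circ, ← map_smul, smul_eq_mul, mul_one, smul_zero]
      exact Prod.ext rfl (congrArg (dmap 𝓘(ℝ, ℝ) (𝓡 1) circ (squeeze p.2)) hd.deriv)
    · have : 0 < 1 + (2 * p.2 - 1) ^ 2 := by positivity
      have := Real.pi_pos
      rw [mul_zero, sub_zero, one_mul]
      positivity

lemma isRightHandedDehnTwist_torusTwist : IsRightHandedDehnTwist torusTwist := by
  have hIcc : ∀ t, 0 ≤ squeeze t ∧ squeeze t ≤ 1 := fun t =>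
    ⟨(squeeze_mem_Ioo t).1.le, (squeeze_mem_Ioo t).2.le⟩
  refine ⟨twistAnnulus, ⟨isOrientedAnnulus_twistAnnulus, ⟨fun t => step (squeeze t),
    contDiff_step.comp contDiff_squeeze, fun t ht => ?_, fun t ht => ?_, fun z t => ?_⟩,
    fun q hq => ?_⟩, ?_⟩
  · have := strictMono_squeeze.monotone ht
    rw [squeeze_zero] at this
    exact step_of_le (by linarith)
  · have := strictMono_squeeze.monotone ht
    rw [squeeze_one] at this
    exact step_of_ge (by linarith)
  · simp only [twistAnnulus, torusTwist_apply, circStaircase_circ,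
      staircase_eq_step (hIcc t).1 (hIcc t).2]
  · -- Outside the annulus the second coordinate is `1`, where the twist is trivial.
    obtain ⟨t, ht⟩ := exists_circ_eq q.2
    have ht0 : circ (Int.fract t) = q.2 := by
      rw [Int.fract, circ_sub, ht, circ_intCast]; simp
    rcases (Int.fract_nonneg t).eq_or_lt with h0 | h0
    · rw [torusTwist_apply, ← ht0, ← h0, circStaircase_circ, staircase_eq_step le_rfl zero_le_one,
        step_of_le (by norm_num), circ_zero, mul_one]
      exact Prod.ext rfl (by rw [← circ_zero, h0, ht0])
    · obtain ⟨s, hs⟩ := exists_squeeze_eq ⟨h0, Int.fract_lt_one t⟩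
      exact absurd ⟨(q.1, s), Prod.ext rfl ((congrArg circ hs).trans ht0)⟩ hq
  · -- The complement of the core `y = 1/2` is the image of a strip of width one.
    have : (range fun z : Circle => twistAnnulus (z, 1 / 2))ᶜ =
        cover '' (univ ×ˢ Ioo (-1 / 2) (1 / 2)) := by
      ext q
      obtain ⟨x, hx⟩ := exists_circ_eq q.1
      constructor
      · intro hq
        obtain ⟨t, ht⟩ := exists_circ_eq q.2
        let s := Int.fract (t + 1 / 2) - 1 / 2
        have hs : circ s = q.2 := by
          rw [← ht, circ_eq_circ_iff]
          exact ⟨-⌊t + 1 / 2⌋, by simp only [s, Int.fract]; push_cast; ring⟩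
        have hne : Int.fract (t + 1 / 2) ≠ 0 := fun h0 => by
          refine hq ⟨q.1, Prod.ext rfl ?_⟩
          change circ (squeeze (1 / 2)) = q.2
          rw [squeeze_half, ← hs, circ_eq_circ_iff]
          exact ⟨1, by simp only [s, h0]; norm_num⟩
        refine ⟨(x, s), ⟨mem_univ _, ?_, ?_⟩, Prod.ext hx hs⟩
        · have := (Int.fract_nonneg (t + 1 / 2)).lt_of_ne hne.symm
          simp only [s]; linarith
        · have := Int.fract_lt_one (t + 1 / 2)
          simp only [s]; linarith
      · rintro ⟨p, ⟨-, hp1, hp2⟩, rfl⟩ ⟨z, hz⟩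
        have h2 : circ (squeeze (1 / 2)) = circ p.2 := congrArg Prod.snd hz
        rw [squeeze_half] at h2
        obtain ⟨m, hm⟩ := circ_eq_circ_iff.1 h2
        have b1 : (m : ℝ) < 1 := by linarith
        have b2 : (0 : ℝ) < m := by linarith
        have b1' : m < 1 := by exact_mod_cast b1
        have b2' : 0 < m := by exact_mod_cast b2
        omega
    rw [this]
    refine IsConnected.image ?_ _ contMDiff_cover.continuous.continuousOn
    exact isConnected_univ.prod (isConnected_Ioo (by norm_num))

/-! ### Conjugation of Dehn twists -/

/-- A map of the torus whose derivative at `q` is orientation preserving. -/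
def PreservesOrientationAt (g : Torus → Torus) (q : Torus) : Prop :=
  ∀ u w : TangentSpace IT q, IsPositiveTorusFrame q u w →
    IsPositiveTorusFrame (g q) (mfderiv IT IT g q u) (mfderiv IT IT g q w)

lemma IsRightHandedDehnTwist.conj {δ : Torus ≃ₘ⟮IT, IT⟯ Torus} (hδ : IsRightHandedDehnTwist δ)
    (g : Torus ≃ₘ⟮IT, IT⟯ Torus) (hg : ∀ q, PreservesOrientationAt g q) :
    IsRightHandedDehnTwist (g * δ * g⁻¹) := by
  obtain ⟨A, ⟨⟨h1, h2, h3⟩, ⟨χ, hχ, hχ0, hχ1, h4⟩, h5⟩, h6⟩ := hδ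
  have happ : ∀ q, (g * δ * g⁻¹) q = g (δ (g.symm q)) := fun _ => rfl
  have hgd : ∀ q, MDifferentiableAt IT IT g q := g.contMDiff.mdifferentiable (by simp)
  refine ⟨fun p => g (A p), ⟨⟨g.contMDiff.comp h1, g.injective.comp h2, fun p => ?_⟩,
    ⟨χ, hχ, hχ0, hχ1, fun z t => ?_⟩, fun q hq => ?_⟩, ?_⟩
  · have d1 : MDifferentiableAt (𝓡 1) IT (fun z : Circle => A (z, p.2)) p.1 :=
      (h1.comp (contMDiff_id.prodMk contMDiff_const)).mdifferentiable (by simp) p.1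
    have d2 : MDifferentiableAt 𝓘(ℝ, ℝ) IT (fun t : ℝ => A (p.1, t)) p.2 :=
      (h1.comp (contMDiff_const.prodMk contMDiff_id)).mdifferentiable (by simp) p.2
    have := hg (A p) _ _ (h3 p)
    have e1 := dmap_comp_apply p.1 (hgd (A p)) d1 (circleVec p.1)
    have e2 := dmap_comp_apply p.2 (hgd (A p)) d2 1
    exact e1 ▸ e2 ▸ this
  · rw [happ, g.symm_apply_apply, h4]
  · rw [happ, h5, g.apply_symm_apply]
    rintro ⟨p, hp⟩
    exact hq ⟨p, (congrArg g hp).trans (g.apply_symm_apply q)⟩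
  · have : (range fun z : Circle => g (A (z, 1 / 2)))ᶜ = g '' (range fun z => A (z, 1 / 2))ᶜ := by
      rw [image_compl_eq (f := g) g.bijective, ← range_comp]; rfl
    rw [this]
    exact h6.image _ g.continuous.continuousOn

lemma det_pos_of_comb {V : Type*} [AddCommGroup V] [Module ℝ V] {X Y : V}
    (ind : ∀ {a b : ℝ}, a • X + b • Y = 0 → a = 0 ∧ b = 0) {α β γ δ a b c d α' β' γ' δ' : ℝ}
    (h1 : α' • (α • X + β • Y) + β' • (γ • X + δ • Y) = a • X + b • Y)
    (h2 : γ' • (α • X + β • Y) + δ' • (γ • X + δ • Y) = c • X + d • Y)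
    (hp : 0 < α * δ - β * γ) (hq : 0 < a * d - b * c) : 0 < α' * δ' - β' * γ' := by
  obtain ⟨e1, e2⟩ := ind (a := α' * α + β' * γ - a) (b := α' * β + β' * δ - b) (by
    rw [← sub_eq_zero] at h1; rw [← h1]; module)
  obtain ⟨e3, e4⟩ := ind (a := γ' * α + δ' * γ - c) (b := γ' * β + δ' * δ - d) (by
    rw [← sub_eq_zero] at h2; rw [← h2]; module)
  have key : (α' * δ' - β' * γ') * (α * δ - β * γ) = a * d - b * c := by
    rw [sub_eq_zero] at e1 e2 e3 e4
    rw [← e1, ← e2, ← e3, ← e4]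
    ring
  exact pos_of_mul_pos_left (by rw [key]; exact hq) hp.le

/-- The inverse of an orientation-preserving diffeomorphism is orientation preserving. -/
lemma preservesOrientationAt_symm (g : Torus ≃ₘ⟮IT, IT⟯ Torus)
    (hg : ∀ q, IsPositiveTorusFrame (g q) (mfderiv IT IT g q (torusField₁ q))
      (mfderiv IT IT g q (torusField₂ q))) (q : Torus) : PreservesOrientationAt g.symm q := by
  obtain ⟨x, rfl⟩ := g.surjective q
  rintro u w ⟨a, b, c, d, hu, hw, hpos⟩
  obtain ⟨α, β, γ, δ, h1, h2, hpos'⟩ := hg x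
  have hx : g.symm (g x) = x := g.symm_apply_apply x
  have hcancel : ∀ u, dmap IT IT g x (dmap IT IT g.symm (g x) u) = u := fun u => by
    have e := dmap_comp_apply (g := g) (f := g.symm) (I := IT) (I' := IT) (I'' := IT) (g x)
      (g.contMDiff.mdifferentiable (by simp) _) (g.symm.contMDiff.mdifferentiable (by simp) _) u
    have e' : (fun y => g (g.symm y)) = fun y => y := funext g.apply_symm_apply
    rw [hx, e', dmap_id] at e
    exact e.symm
  obtain ⟨α', β', h3⟩ := exists_torusField_comb x (dmap IT IT g.symm (g x) u)
  obtain ⟨γ', δ', h4⟩ := exists_torusField_comb x (dmap IT IT g.symm (g x) w)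
  have hlin : ∀ s t : ℝ, mfderiv IT IT g x (s • torusField₁ x + t • torusField₂ x) =
      s • mfderiv IT IT g x (torusField₁ x) + t • mfderiv IT IT g x (torusField₂ x) := fun s t => by
    rw [map_add, map_smul, map_smul]
  have transport : ∀ y (U W : EuclideanSpace ℝ (Fin 1) × EuclideanSpace ℝ (Fin 1)), y = x →
      IsPositiveTorusFrame x U W → IsPositiveTorusFrame y U W := by
    rintro _ U W rfl h
    exact h
  refine transport _ _ _ hx ⟨α', β', γ', δ', h3, h4, ?_⟩
  refine det_pos_of_comb (X := torusField₁ (g x)) (Y := torusField₂ (g x)) torusField_comb_eq_zero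
    ?_ ?_ hpos' hpos
  · rw [← h1, ← h2, ← hlin, ← h3]
    exact (hcancel u).trans hu
  · rw [← h1, ← h2, ← hlin, ← h4]
    exact (hcancel w).trans hw

/-! ### Bijections with invertible derivatives -/

section InverseFunction

variable {E H M H' M' : Type*} [NormedAddCommGroup E] [NormedSpace ℝ E] [FiniteDimensional ℝ E]
  [TopologicalSpace H] [TopologicalSpace M] [ChartedSpace H M]
  [TopologicalSpace H'] [TopologicalSpace M'] [ChartedSpace H' M']
  {I : ModelWithCorners ℝ E H} {I' : ModelWithCorners ℝ E H'} [I.Boundaryless] [IsManifold I ∞ M]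

/-- The inverse function theorem for manifolds. -/
lemma exists_local_right_inverse {f : M → M'} (hf : ContMDiff I I' ∞ f) (x : M)
    (hd : Injective (dmap I I' f x)) :
    ∃ g : M' → M, ContMDiffAt I' I ∞ g (f x) ∧ ∀ᶠ y in 𝓝 (f x), f (g y) = y := by
  have : CompleteSpace E := FiniteDimensional.complete ℝ E
  let F : E → E := writtenInExtChartAt I I' x f
  let D : E ≃L[ℝ] E :=
    (LinearEquiv.ofInjectiveEndo (dmap I I' f x).toLinearMap hd).toContinuousLinearEquiv
  have hFd : HasFDerivAt F (D : E →L[ℝ] E) (extChartAt I x x) := by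
    have h1 : HasFDerivWithinAt F (dmap I I' f x) (range I) (extChartAt I x x) :=
      (hf.mdifferentiable (by simp) x).hasMFDerivAt.2
    rw [ModelWithCorners.range_eq_univ, hasFDerivWithinAt_univ] at h1
    have h2 : (D : E →L[ℝ] E) = dmap I I' f x := by ext u; rfl
    rw [h2]
    exact h1
  have hFs : ContDiffAt ℝ ∞ F (extChartAt I x x) := by
    have h1 := (contMDiffAt_iff.1 (hf x)).2
    rw [ModelWithCorners.range_eq_univ, contDiffWithinAt_univ] at h1
    exact h1
  have hst : HasStrictFDerivAt F (D : E →L[ℝ] E) (extChartAt I x x) :=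
    hFs.hasStrictFDerivAt' hFd (by simp)
  let G : E → E := hst.localInverse F D (extChartAt I x x)
  have hF0 : F (extChartAt I x x) = extChartAt I' (f x) (f x) := by
    simp only [F, writtenInExtChartAt, comp_apply, extChartAt_to_inv]
  have hG0 : G (extChartAt I' (f x) (f x)) = extChartAt I x x := by
    rw [← hF0]; exact hst.localInverse_apply_image
  have hGs : ContDiffAt ℝ ∞ G (extChartAt I' (f x) (f x)) := by
    rw [← hF0]; exact hFs.to_localInverse hFd (by simp)
  have hFG : ∀ᶠ z in 𝓝 (extChartAt I' (f x) (f x)), F (G z) = z := by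
    rw [← hF0]; exact hst.eventually_right_inverse
  let g : M' → M := fun y => (extChartAt I x).symm (G (extChartAt I' (f x) y))
  have hg0 : g (f x) = x := by simp only [g, hG0, extChartAt_to_inv]
  have hg : ContMDiffAt I' I ∞ g (f x) := by
    have h1 : ContMDiffAt I' 𝓘(ℝ, E) ∞ (fun y => G (extChartAt I' (f x) y)) (f x) :=
      ContMDiffAt.comp (g := G) (f x) hGs.contMDiffAt contMDiffAt_extChartAt
    refine ContMDiffAt.comp (g := (extChartAt I x).symm) (f x) ?_ h1
    rw [hG0]
    exact (contMDiffOn_extChartAt_symm x).contMDiffAt (extChartAt_target_mem_nhds x)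
  refine ⟨g, hg, ?_⟩
  have hfg : ContinuousAt (fun y => f (g y)) (f x) :=
    ContinuousAt.comp (g := f) hf.continuous.continuousAt hg.continuousAt
  have h1 : ∀ᶠ y in 𝓝 (f x), f (g y) ∈ (extChartAt I' (f x)).source :=
    hfg.eventually (by
      change _ ∈ 𝓝 (f (g (f x))); rw [hg0]; exact extChartAt_source_mem_nhds (f x))
  filter_upwards [h1, extChartAt_source_mem_nhds (I := I') (f x),
    (continuousAt_extChartAt (I := I') (f x)).eventually hFG] with y hy hy' hyG
  exact (extChartAt I' (f x)).injOn hy hy' hyG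

/-- A smooth bijection with injective derivatives is a diffeomorphism. -/
lemma exists_diffeomorph_of_bijective {f : M → M'} (hf : ContMDiff I I' ∞ f) (hb : Bijective f)
    (hd : ∀ x, Injective (dmap I I' f x)) : ∃ Φ : M ≃ₘ⟮I, I'⟯ M', ⇑Φ = f := by
  refine ⟨⟨Equiv.ofBijective f hb, hf, fun y => ?_⟩, rfl⟩
  obtain ⟨x, rfl⟩ := hb.2 y
  obtain ⟨g, hg, hfg⟩ := exists_local_right_inverse hf x (hd x)
  refine hg.congr_of_eventuallyEq ?_
  filter_upwards [hfg] with y hy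
  refine hb.1 ?_
  rw [hy]
  exact Equiv.ofBijective_apply_symm_apply f hb y

end InverseFunction

/-! ### Uniqueness of the monodromy -/

/-- The diffeomorphism at time `t` of a level-preserving diffeomorphism of `ℝ × T²`. -/
def levelDiffeo (Γ : (ℝ × Torus) ≃ₘ⟮𝓘(ℝ, ℝ).prod IT, 𝓘(ℝ, ℝ).prod IT⟯ (ℝ × Torus))
    (hΓ : ∀ p, (Γ p).1 = p.1) (t : ℝ) : Torus ≃ₘ⟮IT, IT⟯ Torus :=
  have hΓ' : ∀ p, (Γ.symm p).1 = p.1 := fun p => by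
    conv_rhs => rw [← Γ.apply_symm_apply p, hΓ]
  { toFun := fun q => (Γ (t, q)).2
    invFun := fun q => (Γ.symm (t, q)).2
    left_inv := fun q => by
      have : (t, (Γ (t, q)).2) = Γ (t, q) := Prod.ext (hΓ (t, q)).symm rfl
      change (Γ.symm (t, (Γ (t, q)).2)).2 = q
      rw [this, Γ.symm_apply_apply]
    right_inv := fun q => by
      have : (t, (Γ.symm (t, q)).2) = Γ.symm (t, q) := Prod.ext (hΓ' (t, q)).symm rfl
      change (Γ (t, (Γ.symm (t, q)).2)).2 = q
      rw [this, Γ.apply_symm_apply]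
    contMDiff_toFun := contMDiff_snd.comp
      (Γ.contMDiff.comp (contMDiff_const.prodMk contMDiff_id))
    contMDiff_invFun := contMDiff_snd.comp
      (Γ.symm.contMDiff.comp (contMDiff_const.prodMk contMDiff_id)) }

lemma mk_levelDiffeo (Γ : (ℝ × Torus) ≃ₘ⟮𝓘(ℝ, ℝ).prod IT, 𝓘(ℝ, ℝ).prod IT⟯ (ℝ × Torus))
    (hΓ : ∀ p, (Γ p).1 = p.1) (t : ℝ) (q : Torus) : (t, levelDiffeo Γ hΓ t q) = Γ (t, q) :=
  Prod.ext (hΓ (t, q)).symm rfl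

/-- The diffeomorphisms of a smooth family represent the same mapping class. -/
lemma mappingClass_levelDiffeo
    (Γ : (ℝ × Torus) ≃ₘ⟮𝓘(ℝ, ℝ).prod IT, 𝓘(ℝ, ℝ).prod IT⟯ (ℝ × Torus))
    (hΓ : ∀ p, (Γ p).1 = p.1) :
    (levelDiffeo Γ hΓ 1 : MappingClassGroup IT Torus) = levelDiffeo Γ hΓ 0 := by
  rw [QuotientGroup.eq_iff_div_mem]
  let P := (Diffeomorph.refl 𝓘(ℝ, ℝ) ℝ ∞).prodCongr (levelDiffeo Γ hΓ 0)
  have hP : ∀ p : ℝ × Torus, P.symm p = (p.1, (levelDiffeo Γ hΓ 0).symm p.2) := fun _ => rfl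
  refine ⟨P.symm.trans Γ, fun p => ?_, fun x => ?_, fun x => ?_⟩
  · simp [hP, hΓ]
  · simp only [Diffeomorph.coe_trans, comp_apply, hP]
    rw [← mk_levelDiffeo Γ hΓ, Diffeomorph.apply_symm_apply]
  · simp only [Diffeomorph.coe_trans, comp_apply, hP]
    rw [← mk_levelDiffeo Γ hΓ, div_eq_mul_inv]
    rfl

section Uniqueness

variable {L : Torus → Type*} [∀ q, AddCommGroup (L q)] [∀ q, Module ℂ (L q)]
  [∀ q, TopologicalSpace (L q)] [TopologicalSpace (TotalSpace ℂ L)] [FiberBundle ℂ L]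
  [VectorBundle ℂ ℂ L] [VectorBundle ℝ ℂ L] [ContMDiffVectorBundle ∞ ℂ L IT]
  {h : HermitianMetric L} {n : ℤ} {S : ℝ × Circle → TotalSpace ℂ L} {ε : ℝ}

/-- Two identifications of the preimage of the circle with a mapping torus differ, on `ℝ × T²`, by
a level-preserving diffeomorphism. -/
lemma IsUnitFrame.exists_levelPreserving (hS : IsUnitFrame h n S) {hε : 0 < ε}
    {φ : Torus ≃ₘ⟮IT, IT⟯ Torus} {H : ℝ × Torus → TotalSpace ℂ L}
    (hH : IsMappingTorus IT IL (standardMap h) (gammaCircle ε hε) φ H) :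
    ∃ Γ : (ℝ × Torus) ≃ₘ⟮𝓘(ℝ, ℝ).prod IT, 𝓘(ℝ, ℝ).prod IT⟯ (ℝ × Torus),
      (∀ p, (Γ p).1 = p.1) ∧ ∀ p, modelMap S ε (Γ p) = H p := by
  have hγ : ∀ p : ℝ × Torus, (H p).proj.1 = circ p.1 ∧ h.radius (H p) ^ 2 = ε := fun p => by
    have : H p ∈ standardMap h ⁻¹' {gammaCircle ε hε p.1} := by
      rw [← hH.range_eq]; exact ⟨p.2, rfl⟩
    exact standardMap_eq_gammaCircle_iff.1 this
  -- The local inverse `fibrePhase S t` of the model parametrization, applied to `H` at time `t`.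
  let f : ℝ × Torus → ℝ × Torus := fun p => (p.1, fibrePhase S p.1 (H p))
  have hf : ∀ p, modelMap S ε (f p) = H p := fun p =>
    hS.modelMap_fibrePhase (by simp) (hγ p).1 (hγ p).2
  have hinj : ∀ t, Injective fun q => modelMap S ε (t, q) := (hS.isMappingTorus hε).injective
  have hfs : ContMDiff (𝓘(ℝ, ℝ).prod IT) (𝓘(ℝ, ℝ).prod IT) ∞ f := fun p => by
    have h1 : ∀ᶠ p' : ℝ × Torus in 𝓝 p, |p'.1 - p.1| < 1 / 2 := by
      have hc : Continuous fun p' : ℝ × Torus => |p'.1 - p.1| := by fun_prop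
      exact (hc.tendsto p).eventually_lt_const (by simp)
    have h2 : f =ᶠ[𝓝 p] fun p' => (p'.1, fibrePhase S p.1 (H p')) := by
      filter_upwards [h1] with p' hp'
      refine Prod.ext rfl (hinj p'.1 ?_)
      exact (hf p').trans (hS.modelMap_fibrePhase hp' (hγ p').1 (hγ p').2).symm
    refine ContMDiffAt.congr_of_eventuallyEq (contMDiffAt_fst.prodMk ?_) h2
    refine ContMDiffAt.comp (g := fibrePhase S p.1) p
      (hS.contMDiffAt_fibrePhase (by rw [(hγ p).1]; exact circ_mem_arc p.1) fun h0 => ?_)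
      (hH.smooth p)
    have h3 := (hγ p).2
    rw [(radius_eq_zero_iff h).2 h0] at h3
    exact hε.ne (by simpa using h3)
  have hfb : Bijective f := by
    constructor
    · rintro ⟨t, q⟩ ⟨t', q'⟩ hq
      obtain rfl : t = t' := congrArg Prod.fst hq
      have h1 : H (t, q) = H (t, q') := by rw [← hf, ← hf, hq]
      rw [hH.injective t h1]
    · rintro ⟨t, q⟩
      have h1 : modelMap S ε (t, q) ∈ range fun v => H (t, v) := by
        rw [hH.range_eq]; exact hS.standardMap_modelMap hε t q
      obtain ⟨v, hv⟩ := h1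
      exact ⟨(t, v), Prod.ext rfl (hinj t ((hf (t, v)).trans hv))⟩
  have hfd : ∀ p, Injective (dmap (𝓘(ℝ, ℝ).prod IT) (𝓘(ℝ, ℝ).prod IT) f p) := fun p u u' huu => by
    have h1 := fun u => dmap_comp_apply (g := modelMap S ε) p
      (hS.contMDiff_modelMap.mdifferentiable (by simp) (f p)) (hfs.mdifferentiable (by simp) p) u
    rw [funext hf] at h1
    exact hH.immersive p (((h1 u).trans (congrArg _ huu)).trans (h1 u').symm)
  obtain ⟨Γ, hΓ⟩ := exists_diffeomorph_of_bijective hfs hfb hfd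
  exact ⟨Γ, fun p => by rw [hΓ], fun p => by rw [hΓ, hf]⟩

/-- The identification of two orientation-preserving parametrizations of a fibre preserves the
orientation of the torus. -/
lemma IsUnitFrame.isPositiveTorusFrame (hS : IsUnitFrame h n S) (hε : 0 < ε) (t : ℝ)
    (ψ : Torus ≃ₘ⟮IT, IT⟯ Torus) (q : Torus)
    (hψ : IsPositiveFibreFrame h (modelMap S ε (t, ψ q))
      (mfderiv IT IL (fun q' => modelMap S ε (t, ψ q')) q (torusField₁ q))
      (mfderiv IT IL (fun q' => modelMap S ε (t, ψ q')) q (torusField₂ q))) :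
    IsPositiveTorusFrame (ψ q) (mfderiv IT IT ψ q (torusField₁ q))
      (mfderiv IT IT ψ q (torusField₂ q)) := by
  have hm : ∀ x, MDifferentiableAt IT IL (fun q' => modelMap S ε (t, q')) x :=
    (hS.contMDiff_modelMap.comp (contMDiff_const.prodMk contMDiff_id)).mdifferentiable (by simp)
  have hker : ∀ u, dmap IL IC (standardMap h) (modelMap S ε (t, ψ q))
      (dmap IT IL (fun q' => modelMap S ε (t, q')) (ψ q) u) = 0 := fun u => by
    rw [← dmap_comp_apply (g := standardMap h) (f := fun q' => modelMap S ε (t, q')) (ψ q)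
      ((contMDiff_standardMap h).mdifferentiable (by simp) _) (hm _)]
    simp_rw [hS.standardMap_modelMap hε]
    rw [dmap_const]; rfl
  have hchain := fun u => dmap_comp_apply (g := fun q' => modelMap S ε (t, q')) (f := ψ) q (hm _)
    (ψ.contMDiff.mdifferentiable (by simp) q) u
  obtain ⟨a, b, hab⟩ := exists_torusField_comb (ψ q) (mfderiv IT IT ψ q (torusField₁ q))
  obtain ⟨c, d, hcd⟩ := exists_torusField_comb (ψ q) (mfderiv IT IT ψ q (torusField₂ q))
  refine ⟨a, b, c, d, hab, hcd, ?_⟩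
  refine det_pos_of_isPositiveFibreFrame (hker (torusField₁ (ψ q))) (hker (torusField₂ (ψ q)))
    (hS.isPositiveFibreFrame_modelMap hε t (ψ q)) hψ ?_ ?_
  · refine (hchain (torusField₁ q)).trans ((congrArg (dmap IT IL (fun q' => modelMap S ε (t, q'))
      (ψ q)) hab).trans ?_)
    exact (map_add _ _ _).trans (congrArg₂ (· + ·) (map_smul _ _ _) (map_smul _ _ _))
  · refine (hchain (torusField₂ q)).trans ((congrArg (dmap IT IL (fun q' => modelMap S ε (t, q'))
      (ψ q)) hcd).trans ?_)
    exact (map_add _ _ _).trans (congrArg₂ (· + ·) (map_smul _ _ _) (map_smul _ _ _))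

/-- Every monodromy is the class of a conjugate of a power of the standard twist. -/
theorem IsUnitFrame.exists_dehnTwist_of_isMonodromy (hS : IsUnitFrame h n S) {hε : 0 < ε}
    {μ : MappingClassGroup IT Torus} (hμ : IsMonodromy h ε hε μ) :
    ∃ δ : Torus ≃ₘ⟮IT, IT⟯ Torus, IsRightHandedDehnTwist δ ∧
      μ = (δ : MappingClassGroup IT Torus) ^ (-n) := by
  obtain ⟨φ, H, rfl, hH, hor⟩ := hμ
  obtain ⟨Γ, hΓ, hΓH⟩ := hS.exists_levelPreserving hH
  obtain rfl : (fun p => modelMap S ε (Γ p)) = H := funext hΓH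
  let ψ : ℝ → Torus ≃ₘ⟮IT, IT⟯ Torus := levelDiffeo Γ hΓ
  have hψ : ∀ t q, Γ (t, q) = (t, ψ t q) := fun t q => (mk_levelDiffeo Γ hΓ t q).symm
  have horient : ∀ q, IsPositiveTorusFrame (ψ 0 q) (mfderiv IT IT (ψ 0) q (torusField₁ q))
      (mfderiv IT IT (ψ 0) q (torusField₂ q)) := fun q => by
    have key : ∀ g : Torus → TotalSpace ℂ L, (fun q' => modelMap S ε (Γ (0, q'))) = g →
        IsPositiveFibreFrame h (g q) (mfderiv IT IL g q (torusField₁ q))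
          (mfderiv IT IL g q (torusField₂ q)) := by
      rintro _ rfl
      exact hor 0 q
    exact hS.isPositiveTorusFrame hε 0 (ψ 0) q (key _ (funext fun q' => by rw [hψ]))
  -- The gluing maps are related by the identifications of the fibres at times `0` and `1`.
  have hglue : torusTwist ^ (-n) * ψ 1 = ψ 0 * φ := Diffeomorph.ext fun q => by
    have h1 := hH.glue 0 q
    simp only [hψ, zero_add] at h1
    have h2 := (hS.isMappingTorus hε).glue 0 (ψ 1 q)
    rw [zero_add, h1] at h2
    exact ((hS.isMappingTorus hε).injective 0 h2).symm
  refine ⟨(ψ 0)⁻¹ * torusTwist * ((ψ 0)⁻¹)⁻¹, isRightHandedDehnTwist_torusTwist.conj (ψ 0)⁻¹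
    (preservesOrientationAt_symm (ψ 0) horient), ?_⟩
  have hφ : φ = (ψ 0)⁻¹ * (torusTwist ^ (-n) * ψ 1) := by rw [hglue, inv_mul_cancel_left]
  have h1 : (ψ 1 : MappingClassGroup IT Torus) = ψ 0 := mappingClass_levelDiffeo Γ hΓ
  rw [hφ, QuotientGroup.mk_mul, QuotientGroup.mk_mul, h1, inv_inv, ← QuotientGroup.mk_mul,
    ← QuotientGroup.mk_mul, ← QuotientGroup.mk_zpow]
  congr 1
  have := conj_zpow (i := -n) (a := (ψ 0)⁻¹) (b := torusTwist)
  rw [inv_inv] at this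
  rw [this, mul_assoc]

end Uniqueness

end BoundaryFibration

end

theorem mainTheorem10 (n : ℤ) (L : Torus → Type*)
    [∀ q, AddCommGroup (L q)] [∀ q, Module ℂ (L q)] [∀ q, TopologicalSpace (L q)]
    [∀ q, IsTopologicalAddGroup (L q)] [∀ q, ContinuousSMul ℝ (L q)]
    [TopologicalSpace (TotalSpace ℂ L)] [FiberBundle ℂ L]
    [VectorBundle ℂ ℂ L] [VectorBundle ℝ ℂ L] [ContMDiffVectorBundle ∞ ℂ L IT]
    (hL : HasFirstChernClass L n) (h : HermitianMetric L) :
    IsBoundaryFibration IL IC IT (𝓡 1) (standardMap h) (zeroSection ℂ L) boundaryCircle ∧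
    ∀ (ε : ℝ) (hε : 0 < ε),
      (∃ μ, IsMonodromy h ε hε μ) ∧
      ∀ μ, IsMonodromy h ε hε μ →
        ∃ δ : Torus ≃ₘ⟮IT, IT⟯ Torus, IsRightHandedDehnTwist δ ∧
          μ = (δ : MappingClassGroup IT Torus) ^ (-n) := by
  obtain ⟨S, hS⟩ := exists_unitFrame hL h
  exact ⟨hS.isBoundaryFibration, fun ε hε =>
    ⟨⟨_, hS.isMonodromy hε⟩, fun μ hμ => hS.exists_dehnTwist_of_isMonodromy hμ⟩⟩
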